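/- **Setting.** Let $(i,H,B)$ be an abstract Wiener space in the sense of Gross: $H$ is a real separable Hilbert space, $B$ a real Banach space, $i:H\to B$ a continuous linear injection with dense range, and the norm of $B$ is measurable, i.e. for all $\varepsilon,h>0$ there is a finite-dimensional $F\subset H$ such that $\mu_{E,h}(\{y\in E:\|i(y)\|_B>\varepsilon\})<\varepsilon$ for every finite-dimensional $E\subset H$ orthogonal to $F$. Here, for finite-dimensional $E$, $d\mu_{E,h}(x)=(2\pi h)^{-\dim E/2}e^{-|x|^2/(2h)}dx$. Write $B'\subset H'=H\subset B$. For finite-dimensional $E\subset B'$ with orthonormal basis $(u_j)$ (for the scalar product of $H$) let $P_E(x)=\sum_j u_j(x)u_j$, $x\in B$, and let $\mu_{B,h}$ be the Borel probability measure on $B$ whose image under each such $P_E$ is $\mu_{E,h}$. Put $\mu_{B^2,h}=\mu_{B,h}\otimes\mu_{B,h}$ and $\langle f,g\rangle=\int_B f\overline g\,d\mu_{B,h/2}$. Let $u\mapsto\ell_u$ be the continuous linear extension to $H$ of the inclusion $B'\to L^2(B,\mu_{B,h})$ (for the parameter $h$ in use), $\ell_{a+ib}=\ell_a+i\ell_b$,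 and $\ell_{(a,b)}(x,\xi)=\ell_a(x)+\ell_b(\xi)$ on $B^2$. A Borel function $\widetilde F$ on $B^2$ is a *stochastic extension* of a Borel function $F$ on $H^2$ with respect to $\mu_{B^2,h}$ if for every increasing sequence $(E_n)$ of finite-dimensional subspaces of $H^2$ with dense union, $F\circ\widetilde\pi_{E_n}\to\widetilde F$ in $\mu_{B^2,h}$-probability, where $\widetilde\pi_E=\sum_j\ell_{u_j}u_j$ for an orthonormal basis $(u_j)$ of $E$. Fix $h>0$. Let $\mathcal D$ be the set of functions $f=\widehat f\circ P_E$ on $B$, with $E\subset B'$ finite-dimensional and $\widehat f:E\to\mathbb C$ such that $x\mapsto\widehat f(x)e^{-|x|^2/(2h)}$ is a Schwartz function. For $f=\widehat f\circ P_E$, $g=\widehat g\circ P_E$ in $\mathcal D$ (with a common $E$), let $$H_h^{Gauss}(f,g)(z,\zeta)=\widehat H(P_Ez,P_E\zeta),\qquad \widehat H(z,\zeta)=e^{|\zeta|^2/h}\int_E e^{-\frac{2i}{h}\zeta\cdot t}\,\widehat f(z+t)\overline{\widehat g(z-t)}\,d\mu_{E,h/2}(t).$$ A function $G\in L^1(B^2,\mu_{B^2,h/2})$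 is called admissible if $\sup_{Y\in H^2}(1+|Y|)^{-m}\|G(\cdot+Y)\|_{L^1(B^2,\mu_{B^2,h/2})}<\infty$ for some integer $m\ge0$; for such $G$ one sets $$Q_h^{Weyl}(G)(f,g)=\int_{B^2}G\,H_h^{Gauss}(f,g)\,d\mu_{B^2,h/2}.$$ Moreover $Q_h^{AW}(G)=Q_h^{Weyl}(\widetilde H_{h/2}G)$, where $(\widetilde H_tG)(X)=\int_{B^2}G(X+Y)\,d\mu_{B^2,t}(Y)$. For $a,b\in H$ let $$(U_{a,b,h}f)(u)=e^{-\frac h2|b|^2+\frac{ih}{2}a\cdot b+i\ell_{a+ib}(u)}f(u+hb),$$ $\ell$ being taken with respect to $\mu_{B,h/2}$. **Proposition 8.13.** (1) Let $a,b\in H$ and $\varphi_{a,b}(x,\xi)=a\cdot x+b\cdot\xi$ on $H^2$. Then $\varphi_{a,b}$ has a stochastic extension with respect to $\mu_{B^2,h/2}$. Every such extension $\widetilde\varphi_{a,b}$ is admissible, and for all $f,g\in\mathcal D$ the integral defining $Q_h^{Weyl}(\widetilde\varphi_{a,b})(f,g)$ converges absolutely, the function $\ell_{a+ib}f+\frac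 hi\,b\cdot\frac{\partial f}{\partial u}$ (the Segal field applied to $f$) and $g$ are in $L^2(B,\mu_{B,h/2})$, and $$Q_h^{Weyl}(\widetilde\varphi_{a,b})(f,g)=\Big\langle \ell_{a+ib}f+\frac hi\,b\cdot\frac{\partial f}{\partial u},\,g\Big\rangle .$$ (2) Let $\nu$ be a complex (bounded) Borel measure on $H^2$ and $F(t,\tau)=\int_{H^2}e^{i(x\cdot t+\xi\cdot\tau)}d\nu(x,\xi)$. Then there is a Borel function on $B^2$ which is a stochastic extension of $F$ with respect to both $\mu_{B^2,h/2}$ and $\mu_{B^2,h}$. For all $f,g\in\mathcal D$, $U_{x,\xi,h}f\in L^2(B,\mu_{B,h/2})$ for all $x,\xi\in H$, the function $(x,\xi)\mapsto\langle U_{x,\xi,h}f,g\rangle$ is $|\nu|$-integrable, and: * for every stochastic extension $\widetilde F$ of $F$ with respect to $\mu_{B^2,h/2}$, $\widetilde F$ is admissible, the integral defining $Q_h^{Weyl}(\widetilde F)(f,g)$ converges absolutely, and $$Q_h^{Weyl}(\widetilde F)(f,g)=\int_{H^2}\langle U_{x,\xi,h}f,g\rangle\,d\nu(x,\xi);$$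 * for every stochastic extension $\widetilde F$ of $F$ with respect to $\mu_{B^2,h}$, $\widetilde H_{h/2}\widetilde F$ is admissible, the integral defining $Q_h^{AW}(\widetilde F)(f,g)$ converges absolutely, and $$Q_h^{AW}(\widetilde F)(f,g)=\int_{H^2}e^{-\frac h4(|x|^2+|\xi|^2)}\langle U_{x,\xi,h}f,g\rangle\,d\nu(x,\xi).$$ Finally, there is a bounded operator $Op_h^{Weyl}(F)$ on $L^2(B,\mu_{B,h/2})$, of norm at most $|\nu|(H^2)$, such that $\mathcal D\subset L^2(B,\mu_{B,h/2})$ and $Q_h^{Weyl}(\widetilde F)(f,g)=\langle Op_h^{Weyl}(F)f,g\rangle$ for all $f,g\in\mathcal D$ and every stochastic extension $\widetilde F$ of $F$ with respect to $\mu_{B^2,h/2}$. -/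

import Mathlib

open MeasureTheory Filter Topology
open scoped ENNReal RealInnerProductSpace SchwartzMap ComplexConjugate

noncomputable section

namespace WienerWeyl

section FiniteDimensional

variable {E : Type*} [NormedAddCommGroup E] [InnerProductSpace ℝ E] [FiniteDimensional ℝ E]
  [MeasurableSpace E] [BorelSpace E]

variable (E) in
/-- The Gaussian measure `μ_{E,h}` of variance parameter `h` on a finite-dimensional Euclidean
space: density `(2πh)^{-dim E / 2} exp(-|x|² / 2h)` with respect to Lebesgue measure. -/
def gaussMeasure (h : ℝ) : Measure E :=
  (volume : Measure E).withDensity fun x =>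
    ENNReal.ofReal ((2 * Real.pi * h) ^ (-(Module.finrank ℝ E : ℝ) / 2) *
      Real.exp (-‖x‖ ^ 2 / (2 * h)))

/-- The map `γ_{E,h/2}`, an isometry from `L²(E, μ_{E,h/2})` to `L²(E, Lebesgue)`:
`(γ φ)(x) = (πh)^{-dim E / 4} φ(x) exp(-|x|² / 2h)`. -/
def gammaMap (h : ℝ) (φ : E → ℂ) (x : E) : ℂ :=
  (((Real.pi * h) ^ (-(Module.finrank ℝ E : ℝ) / 4) : ℝ) : ℂ) * φ x *
    ((Real.exp (-‖x‖ ^ 2 / (2 * h)) : ℝ) : ℂ)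

variable (E) in
/-- The space `S_E` of the functions `φ` such that `γ_{E,h/2} φ` is a Schwartz function. -/
def schwartzGauss (h : ℝ) : Set (E → ℂ) :=
  {φ | ∃ s : 𝓢(E, ℂ), ∀ x, s x = gammaMap h φ x}

/-- The Wigner-Gauss function on `E × E`:
`exp(|ζ|²/h) ∫ exp(-(2i/h) ζ·t) φ(z+t) conj(ψ(z-t)) dμ_{E,h/2}(t)`. -/
def wignerHat (h : ℝ) (φ ψ : E → ℂ) (z ζ : E) : ℂ :=
  ((Real.exp (‖ζ‖ ^ 2 / h) : ℝ) : ℂ) *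
    ∫ t, Complex.exp (-(2 * Complex.I / (h : ℂ)) * ((⟪ζ, t⟫ : ℝ) : ℂ)) *
      φ (z + t) * conj (ψ (z - t)) ∂(gaussMeasure E (h / 2))

end FiniteDimensional

variable {H B : Type*} [NormedAddCommGroup H] [InnerProductSpace ℝ H]
  [MeasurableSpace H] [BorelSpace H]
  [NormedAddCommGroup B] [NormedSpace ℝ B] [MeasurableSpace B]

/-- `(i, H, B)` is an abstract Wiener space in the sense of Gross: `i` is a continuous injection
with dense range and the norm of `B` is measurable. The set whose measure is taken is the base, in
`E`, of the cylinder set `{x ∈ H | ‖i (π_E x)‖ > ε}`, so that its `μ_{E,h}`-measure is the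
canonical Gaussian cylinder measure `μ_{H,h}` of that cylinder set. -/
structure IsAbstractWiener (i : H →L[ℝ] B) : Prop where
  injective : Function.Injective i
  denseRange : DenseRange i
  measurable_norm : ∀ ε : ℝ, 0 < ε → ∀ h : ℝ, 0 < h →
    ∃ F : Submodule ℝ H, FiniteDimensional ℝ F ∧
      ∀ (E : Submodule ℝ H) [FiniteDimensional ℝ E], E ⟂ F →
        gaussMeasure E h {y : E | ε < ‖i (y : H)‖} < ENNReal.ofReal ε

/-- The continuous functional `L ∈ B'` is identified with the vector `e ∈ H` (through
`B' ⊂ H' = H`): `L(x) = e·x` for `x ∈ H`. -/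
def Represents (i : H →L[ℝ] B) (L : StrongDual ℝ B) (e : H) : Prop :=
  ∀ x : H, L (i x) = ⟪e, x⟫

/-- The subspace `E` of `H` is contained in `B'`. -/
def InDual (i : H →L[ℝ] B) (E : Submodule ℝ H) : Prop :=
  ∀ e ∈ E, ∃ L : StrongDual ℝ B, Represents i L e

open Classical in
/-- The functional on `B` given by a vector `e` of `B' ⊂ H` (zero if `e` is not in `B'`). -/
def functional (i : H →L[ℝ] B) (e : H) : StrongDual ℝ B :=
  if he : ∃ L : StrongDual ℝ B, Represents i L e then he.choose else 0

/-- `P_E : B → E`, `P_E x = ∑ u_j(x) u_j` for an orthonormal basis `(u_j)` of `E ⊂ B'`. -/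
def projB (i : H →L[ℝ] B) (E : Submodule ℝ H) [FiniteDimensional ℝ E] : B →L[ℝ] E :=
  ∑ j, (functional i (stdOrthonormalBasis ℝ E j : H)).smulRight (stdOrthonormalBasis ℝ E j)

/-- `μ` is a probability measure on `B` extending the Gaussian cylinder measure:
`μ(P_E⁻¹(Ω)) = μ_{E,h}(Ω)` for all finite-dimensional `E ⊂ B'` and all Borel sets `Ω ⊂ E`. -/
structure IsWienerMeasure (i : H →L[ℝ] B) (h : ℝ) (μ : Measure B) : Prop where
  isProbabilityMeasure : IsProbabilityMeasure μ
  map_projB : ∀ (E : Submodule ℝ H) [FiniteDimensional ℝ E], InDual i E →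
    μ.map (projB i E) = gaussMeasure E h

open Classical in
/-- The Wiener measure `μ_{B,h}`: the (unique) extension of the Gaussian cylinder measure to a
Borel measure on `B`. Such an extension exists for an abstract Wiener space and `h > 0`. -/
def wienerMeasure (i : H →L[ℝ] B) (h : ℝ) : Measure B :=
  if hμ : ∃ μ : Measure B, IsWienerMeasure i h μ then hμ.choose else 0

/-- The measure `μ_{B²,h}` on `B²`. -/
def wienerMeasure2 (i : H →L[ℝ] B) (h : ℝ) : Measure (B × B) :=
  (wienerMeasure i h).prod (wienerMeasure i h)

/-- `φ` is (a version of) `ℓ_u`, the value at `u ∈ H` of the continuous extension to `H` of the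
inclusion `B' → L²(B, μ_{B,h})`: whenever `v_n → u` in `H` with `v_n ∈ B'`, the functionals
on `B` given by the `v_n` converge to `φ` in `L²(B, μ_{B,h})`. -/
structure IsEll (i : H →L[ℝ] B) (h : ℝ) (u : H) (φ : B → ℝ) : Prop where
  measurable : Measurable φ
  memLp : MemLp φ 2 (wienerMeasure i h)
  tendsto : ∀ (v : ℕ → H) (L : ℕ → StrongDual ℝ B), (∀ n, Represents i (L n) (v n)) →
    Tendsto v atTop (𝓝 u) →
    Tendsto (fun n => eLpNorm (fun x => L n x - φ x) 2 (wienerMeasure i h)) atTop (𝓝 0)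

open Classical in
/-- A version of the random variable `ℓ_u ∈ L²(B, μ_{B,h})`, for `u ∈ H`. -/
def ell (i : H →L[ℝ] B) (h : ℝ) (u : H) : B → ℝ :=
  if hφ : ∃ φ : B → ℝ, IsEll i h u φ then hφ.choose else 0

/-- `ℓ_{(a,b)}(x, ξ) = ℓ_a(x) + ℓ_b(ξ)` on `B²`. -/
def ell2 (i : H →L[ℝ] B) (h : ℝ) (W : WithLp 2 (H × H)) (Z : B × B) : ℝ :=
  ell i h W.fst Z.1 + ell i h W.snd Z.2

/-- `π̃_E : B² → E`, `π̃_E(Z) = ∑ ℓ_{u_j}(Z) u_j`, for an orthonormal basis `(u_j)` of the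
finite-dimensional subspace `E` of the Hilbert space `H²`. -/
def projTilde (i : H →L[ℝ] B) (h : ℝ) (E : Submodule ℝ (WithLp 2 (H × H)))
    [FiniteDimensional ℝ E] (Z : B × B) : H × H :=
  WithLp.ofLp (∑ j, ell2 i h (stdOrthonormalBasis ℝ E j : WithLp 2 (H × H)) Z •
    (stdOrthonormalBasis ℝ E j : WithLp 2 (H × H)))

/-- The Borel function `Ft` on `B²` is the stochastic extension of the Borel function `F` on `H²`
with respect to `μ_{B²,h}`: for every increasing sequence `(E_n)` of finite-dimensional subspaces
of `H²` with dense union, `F ∘ π̃_{E_n}` converges to `Ft` in probability. -/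
structure IsStochExt (i : H →L[ℝ] B) (h : ℝ) (F : H × H → ℂ) (Ft : B × B → ℂ) : Prop where
  measurable_symbol : Measurable F
  measurable_ext : Measurable Ft
  tendsto : ∀ (E : ℕ → Submodule ℝ (WithLp 2 (H × H))) [∀ n, FiniteDimensional ℝ (E n)],
    Monotone E → Dense (⋃ n, (E n : Set (WithLp 2 (H × H)))) →
    TendstoInMeasure (wienerMeasure2 i h) (fun n Z => F (projTilde i h (E n) Z)) atTop Ft

/-- The space `𝒟` of cylindrical functions `φ ∘ P_E` on `B`, with `E ⊂ B'` finite-dimensional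
and `φ ∈ S_E`. -/
def testSpace (i : H →L[ℝ] B) (h : ℝ) : Set (B → ℂ) :=
  {f | ∃ (E : Submodule ℝ H) (_ : FiniteDimensional ℝ E) (φ : E → ℂ),
    InDual i E ∧ φ ∈ schwartzGauss E h ∧ f = φ ∘ projB i E}

/-- A representation `f = φ ∘ P_E`, `g = ψ ∘ P_E` over a common finite-dimensional `E ⊂ B'`. -/
structure CommonRep (i : H →L[ℝ] B) (h : ℝ) (f g : B → ℂ) where
  E : Submodule ℝ H
  finDim : FiniteDimensional ℝ E
  inDual : InDual i E
  φ : E → ℂ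
  ψ : E → ℂ
  φ_mem : φ ∈ schwartzGauss E h
  ψ_mem : ψ ∈ schwartzGauss E h
  eq_left : f = φ ∘ projB i E
  eq_right : g = ψ ∘ projB i E

/-- The Wigner-Gauss function on `B²` computed with a given common representation. -/
def CommonRep.wigner {i : H →L[ℝ] B} {h : ℝ} {f g : B → ℂ} (r : CommonRep i h f g)
    (Z : B × B) : ℂ :=
  haveI := r.finDim
  wignerHat h r.φ r.ψ (projB i r.E Z.1) (projB i r.E Z.2)

open Classical in
/-- The Wigner-Gauss function `H_h^{Gauss}(f, g)` on `B²` for `f, g ∈ 𝒟`; it does not depend on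
the common representation of `f` and `g`. -/
def wignerGauss (i : H →L[ℝ] B) (h : ℝ) (f g : B → ℂ) : B × B → ℂ :=
  if r : Nonempty (CommonRep i h f g) then (Classical.choice r).wigner else 0

/-- The quadratic Weyl form `Q_h^{Weyl}(F)(f, g) = ∫ F H_h^{Gauss}(f, g) dμ_{B²,h/2}`. -/
def weylForm (i : H →L[ℝ] B) (h : ℝ) (F : B × B → ℂ) (f g : B → ℂ) : ℂ :=
  ∫ Z, F Z * wignerGauss i h f g Z ∂(wienerMeasure2 i (h / 2))

/-- The norm `N_m(F) = sup_{Y ∈ H²} ‖F(· + Y)‖_{L¹(B², μ_{B²,h/2})} / (1 + |Y|)^m`. -/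
def growthNorm (i : H →L[ℝ] B) (h : ℝ) (m : ℕ) (F : B × B → ℂ) : ℝ≥0∞ :=
  ⨆ Y : H × H,
    eLpNorm (fun Z : B × B => F (Z + (i Y.1, i Y.2))) 1 (wienerMeasure2 i (h / 2)) /
      ENNReal.ofReal ((1 + ‖WithLp.toLp 2 Y‖) ^ m)

/-- The condition under which the Weyl form of `F` is defined: `F ∈ L¹(B², μ_{B²,h/2})` and
`N_m(F)` is finite for some `m`. -/
def IsWeylSymbol (i : H →L[ℝ] B) (h : ℝ) (F : B × B → ℂ) : Prop :=
  MemLp F 1 (wienerMeasure2 i (h / 2)) ∧ ∃ m : ℕ, growthNorm i h m F < ⊤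

/-- The heat operator `(H̃_t F)(X) = ∫ F(X + Y) dμ_{B²,t}(Y)`. -/
def heat (i : H →L[ℝ] B) (t : ℝ) (F : B × B → ℂ) (X : B × B) : ℂ :=
  ∫ Y, F (X + Y) ∂(wienerMeasure2 i t)

/-- The quadratic anti-Wick form `Q_h^{AW}(F)(f, g) = Q_h^{Weyl}(H̃_{h/2} F)(f, g)`. -/
def antiWickForm (i : H →L[ℝ] B) (h : ℝ) (F : B × B → ℂ) (f g : B → ℂ) : ℂ :=
  weylForm i h (heat i (h / 2) F) f g

/-- The scalar product `⟨f, g⟩ = ∫ f conj(g) dμ_{B,h/2}` of `L²(B, μ_{B,h/2})`. -/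
def l2Inner (i : H →L[ℝ] B) (h : ℝ) (f g : B → ℂ) : ℂ :=
  ∫ u, f u * conj (g u) ∂(wienerMeasure i (h / 2))

/-- The symbol `φ_{a,b}(x, ξ) = a·x + b·ξ` on `H²`. -/
def linearSymbol (a b : H) (X : H × H) : ℂ :=
  ((⟪a, X.1⟫ + ⟪b, X.2⟫ : ℝ) : ℂ)

/-- `ℓ_{a+ib} = ℓ_a + i ℓ_b` as a random variable on `(B, μ_{B,h/2})`. -/
def ellC (i : H →L[ℝ] B) (h : ℝ) (a b : H) (u : B) : ℂ :=
  (ell i (h / 2) a u : ℂ) + Complex.I * (ell i (h / 2) b u : ℂ)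

/-- The Segal field `ℓ_{a+ib} f + (h/i) b·∂f/∂u`. -/
def segalField (i : H →L[ℝ] B) (h : ℝ) (a b : H) (f : B → ℂ) (u : B) : ℂ :=
  ellC i h a b u * f u + ((h : ℂ) / Complex.I) * lineDeriv ℝ f u (i b)

/-- The unitary Weyl operator
`(U_{a,b,h} f)(u) = exp(-(h/2)|b|² + i(h/2) a·b + i ℓ_{a+ib}(u)) f(u + hb)`. -/
def weylU (i : H →L[ℝ] B) (h : ℝ) (a b : H) (f : B → ℂ) (u : B) : ℂ :=
  Complex.exp (-((h / 2 * ‖b‖ ^ 2 : ℝ) : ℂ) + Complex.I * ((h / 2 * ⟪a, b⟫ : ℝ) : ℂ) +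
    Complex.I * ellC i h a b u) * f (u + h • i b)

/-- The integral of a complex function against a complex measure. -/
def cIntegral {X : Type*} [MeasurableSpace X] (ν : ComplexMeasure X) (f : X → ℂ) : ℂ :=
  ν.integral f (ContinuousLinearMap.mul ℝ ℂ)

end WienerWeyl

end

set_option linter.unusedSectionVars false

/-! Everything reduces to plane waves and linear forms evaluated on an isonormal Gaussian process:
`u ↦ ℓ_u` is almost surely linear, `ℓ_u` is centred Gaussian with variance proportional to `|u|²`,
and orthogonality of indices means independence (`IsIsonormal`). This presupposes that the Wiener
measure exists, so Gross's theorem is proved on the way: a sum of independent Gaussians on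
orthogonal blocks of `H` converges almost surely in `B`, because measurability of the norm makes the
blocks summably small.

Let `f`, `g` be cylindrical over `E ⊂ B'`. Split an index `W` of `H²` into its part in `E × E` and
an orthogonal remainder `W'`. Then `ℓ_W` is a linear function of `P_E` plus a centred Gaussian
independent of `P_E`, so pairing `ℓ_W` or `exp(i ℓ_W)` with the Wigner function gives a
finite-dimensional integral, corrected by the mean or the characteristic function of `ℓ_{W'}`. In
finite dimension `gammaMap` turns the Wigner-Gauss function into the ordinary Wigner transform of
Schwartz functions, a Fourier transform: multiplication by the phase space coordinates, integration
by parts and Fourier inversion evaluate the forms. The same splitting is applied to the Segal field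
and to the Weyl operator `U`; the complex moment `E exp(ℓ_a + i ℓ_b)` shows that the remainder
contributes the same factor on both sides. Hence the Weyl form of `ℓ_{a,b}` is the Segal form, and
that of `exp(i ℓ_W)` is `⟨U_W f, g⟩`.

For part (2), `ν` is written `θ |ν|`, and `F` is a superposition of plane waves. The estimate
`E|exp(i ℓ_u) - exp(i ℓ_v)| ≤ min(2, √c |u - v|)` makes `F ∘ π̃_{E_n}` Cauchy in `L¹`. With `E_n ⊂
B' × B'` the projections are honest continuous maps independent of the variance parameter, so a
single limit in `L¹(μ_{h/2} + μ_h)` serves both parameters. The forms of any extension follow by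
Fubini and dominated convergence along an almost surely convergent subsequence, using continuity of
`W ↦ ⟨U_W f, g⟩`. For the anti-Wick form, `μ_{h/2} * μ_{h/2} = μ_h` lets the extension be evaluated
at a sum of two independent points; the plane wave factors, and the second factor averages to
`exp(-h|X|²/4)`.

Finally Cameron-Martin shows that the operators `U` are isometric. The superposed form is therefore
bounded by `|ν|(H²)` times the `L²` norms, and extension by continuity together with the Riesz
theorem gives the operator. -/

namespace WienerWeyl

/-! ### Gaussian measures on Euclidean spaces -/

section GaussFiniteDim

variable {E : Type*} [NormedAddCommGroup E] [InnerProductSpace ℝ E] [FiniteDimensional ℝ E]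
  [MeasurableSpace E] [BorelSpace E]

/-- The real density of `gaussMeasure E h`. -/
noncomputable def gaussDensity (E : Type*) [NormedAddCommGroup E] [InnerProductSpace ℝ E]
    (h : ℝ) (x : E) : ℝ :=
  (2 * Real.pi * h) ^ (-(Module.finrank ℝ E : ℝ) / 2) * Real.exp (-‖x‖ ^ 2 / (2 * h))

lemma gaussDensity_nonneg {h : ℝ} (hh : 0 < h) (x : E) : 0 ≤ gaussDensity E h x := by
  unfold gaussDensity; positivity

lemma continuous_gaussDensity (h : ℝ) : Continuous (gaussDensity E h) := by
  unfold gaussDensity; fun_prop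

lemma integral_gaussMeasure {G : Type*} [NormedAddCommGroup G] [NormedSpace ℝ G] {h : ℝ}
    (hh : 0 < h) (f : E → G) :
    ∫ x, f x ∂(gaussMeasure E h) = ∫ x, gaussDensity E h x • f x := by
  rw [gaussMeasure, integral_withDensity_eq_integral_toReal_smul
    (by exact (continuous_gaussDensity h).measurable.ennreal_ofReal)
    (ae_of_all _ fun x => ENNReal.ofReal_lt_top)]
  refine integral_congr_ae (ae_of_all _ fun x => ?_)
  have := gaussDensity_nonneg hh x
  unfold gaussDensity at this ⊢
  simp only [ENNReal.toReal_ofReal this]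

lemma integrable_gaussMeasure_iff {G : Type*} [NormedAddCommGroup G] [NormedSpace ℝ G] {h : ℝ}
    (hh : 0 < h) (f : E → G) :
    Integrable f (gaussMeasure E h) ↔ Integrable fun x => gaussDensity E h x • f x := by
  rw [gaussMeasure, integrable_withDensity_iff_integrable_smul'
    (by exact (continuous_gaussDensity h).measurable.ennreal_ofReal)
    (ae_of_all _ fun x => ENNReal.ofReal_lt_top)]
  refine integrable_congr (ae_of_all _ fun x => ?_)
  have := gaussDensity_nonneg hh x
  unfold gaussDensity at this ⊢
  simp only [ENNReal.toReal_ofReal this]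

/-- The normalising constant cancels the determinant of the Gaussian Fourier integral. The total
mass (`v = 0`) and the characteristic function are both read off from this formula. -/
lemma integral_cexp_inner_gaussMeasure {h : ℝ} (hh : 0 < h) (v : E) :
    ∫ x, Complex.exp (Complex.I * ((⟪v, x⟫ : ℝ) : ℂ)) ∂(gaussMeasure E h) =
      ((Real.exp (-h * ‖v‖ ^ 2 / 2) : ℝ) : ℂ) := by
  rw [integral_gaussMeasure hh]
  have hb : 0 < ((1 / (2 * h) : ℝ) : ℂ).re := by rw [Complex.ofReal_re]; positivity
  have key := GaussianFourier.integral_cexp_neg_mul_sq_norm_add hb Complex.I v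
  have e1 : ∀ x : E, gaussDensity E h x • Complex.exp (Complex.I * ((⟪v, x⟫ : ℝ) : ℂ)) =
      (((2 * Real.pi * h) ^ (-(Module.finrank ℝ E : ℝ) / 2) : ℝ) : ℂ) *
        Complex.exp (-((1 / (2 * h) : ℝ) : ℂ) * ↑‖x‖ ^ 2 + Complex.I * ((⟪v, x⟫ : ℝ) : ℂ)) := by
    intro x
    rw [gaussDensity, Complex.real_smul, Complex.exp_add, Complex.ofReal_mul, mul_assoc]
    congr 2
    rw [Complex.ofReal_exp]
    congr 1
    push_cast
    ring
  simp_rw [e1]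
  rw [integral_const_mul, key]
  have h2 : ((Real.pi : ℂ) / ((1 / (2 * h) : ℝ) : ℂ)) = ((2 * Real.pi * h : ℝ) : ℂ) := by
    have : (h : ℂ) ≠ 0 := by exact_mod_cast hh.ne'
    push_cast
    field_simp
  rw [h2, ← mul_assoc]
  have h3 : (((2 * Real.pi * h : ℝ) : ℂ)) ^ ((Module.finrank ℝ E : ℂ) / 2) =
      (((2 * Real.pi * h) ^ ((Module.finrank ℝ E : ℝ) / 2) : ℝ) : ℂ) := by
    rw [Complex.ofReal_cpow (by positivity)]
    push_cast; rfl
  rw [h3, ← Complex.ofReal_mul, ← Real.rpow_add (by positivity)]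
  rw [show -(Module.finrank ℝ E : ℝ) / 2 + (Module.finrank ℝ E : ℝ) / 2 = 0 by ring, Real.rpow_zero]
  rw [Complex.ofReal_one, one_mul, Complex.ofReal_exp]
  congr 1
  have : (h : ℂ) ≠ 0 := by exact_mod_cast hh.ne'
  push_cast
  rw [Complex.I_sq]
  field_simp
  ring

lemma isProbabilityMeasure_gaussMeasure {h : ℝ} (hh : 0 < h) :
    IsProbabilityMeasure (gaussMeasure E h) := by
  have h1 := integral_cexp_inner_gaussMeasure (E := E) hh 0
  simp only [inner_zero_left, Complex.ofReal_zero, mul_zero, Complex.exp_zero, norm_zero, ne_eq,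
    OfNat.ofNat_ne_zero, not_false_eq_true, zero_pow, zero_div, Real.exp_zero,
    Complex.ofReal_one] at h1
  rw [integral_const, Complex.real_smul, mul_one] at h1
  have h2 : (gaussMeasure E h).real Set.univ = 1 := by exact_mod_cast h1
  constructor
  rw [measureReal_def] at h2
  rw [← ENNReal.toReal_eq_one_iff]
  exact h2

lemma charFun_gaussMeasure {h : ℝ} (hh : 0 < h) (v : E) :
    charFun (gaussMeasure E h) v = ((Real.exp (-h * ‖v‖ ^ 2 / 2) : ℝ) : ℂ) := by
  rw [← integral_cexp_inner_gaussMeasure hh v, charFun_apply]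
  refine integral_congr_ae (ae_of_all _ fun x => ?_)
  simp only [real_inner_comm, mul_comm]

end GaussFiniteDim

/-! ### Complex measures: density and integration against the variation -/

section ComplexMeasure

variable {X : Type*} [MeasurableSpace X]

instance isFiniteMeasure_variation_signed (s : SignedMeasure X) : IsFiniteMeasure s.variation := by
  rw [← SignedMeasure.totalVariation_eq_variation]
  unfold SignedMeasure.totalVariation
  infer_instance

/-- The variation is dominated by the sum of the variations of the real and imaginary parts, which
are finite by Jordan decomposition. -/
instance isFiniteMeasure_variation_complex (ν : ComplexMeasure X) :
    IsFiniteMeasure ν.variation := by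
  have : ν.variation ≤ (ComplexMeasure.re ν).variation + (ComplexMeasure.im ν).variation := by
    refine VectorMeasure.variation_le_of_forall_enorm_le fun s hs => ?_
    have h1 : ‖ν s‖ₑ ≤ ‖ComplexMeasure.re ν s‖ₑ + ‖ComplexMeasure.im ν s‖ₑ := by
      have h0 : ν s = ((ComplexMeasure.re ν s : ℝ) : ℂ) +
          ((ComplexMeasure.im ν s : ℝ) : ℂ) * Complex.I := (Complex.re_add_im (ν s)).symm
      rw [h0]
      refine (enorm_add_le _ _).trans ?_
      rw [enorm_mul]
      simp [← ofReal_norm, Complex.norm_real]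
    refine h1.trans ?_
    rw [Measure.add_apply]
    exact add_le_add (VectorMeasure.enorm_measure_le_variation _ _)
      (VectorMeasure.enorm_measure_le_variation _ _)
  exact isFiniteMeasure_of_le _ this

/-- A set null for the variation is null for `ν`, so the real and imaginary parts have Radon-Nikodym
densities. That `|θ| = 1` almost everywhere is never needed. -/
lemma exists_integrable_density (ν : ComplexMeasure X) :
    ∃ θ : X → ℂ, Measurable θ ∧ Integrable θ ν.variation ∧
      ∀ s, MeasurableSet s → ν s = ∫ x in s, θ x ∂ν.variation := by
  have key : ∀ t : SignedMeasure X, (∀ s, ν s = 0 → t s = 0) →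
      ν.variation.withDensityᵥ (t.rnDeriv ν.variation) = t := by
    intro t ht
    refine SignedMeasure.withDensityᵥ_rnDeriv_eq t ν.variation ?_
    refine VectorMeasure.AbsolutelyContinuous.mk fun s hs h0 => ht s ?_
    rw [Measure.toENNRealVectorMeasure_apply_measurable hs] at h0
    have := VectorMeasure.enorm_measure_le_variation ν s
    rw [h0] at this
    simpa using this
  have hre := key (ComplexMeasure.re ν) fun s hs => by
    change (ν s).re = 0
    rw [hs]; rfl
  have him := key (ComplexMeasure.im ν) fun s hs => by
    change (ν s).im = 0
    rw [hs]; rfl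
  have i1 := SignedMeasure.integrable_rnDeriv (ComplexMeasure.re ν) ν.variation
  have i2 := SignedMeasure.integrable_rnDeriv (ComplexMeasure.im ν) ν.variation
  refine ⟨fun x => (((ComplexMeasure.re ν).rnDeriv ν.variation x : ℝ) : ℂ) +
    (((ComplexMeasure.im ν).rnDeriv ν.variation x : ℝ) : ℂ) * Complex.I, ?_, ?_, ?_⟩
  · have m1 := SignedMeasure.measurable_rnDeriv (ComplexMeasure.re ν) ν.variation
    have m2 := SignedMeasure.measurable_rnDeriv (ComplexMeasure.im ν) ν.variation
    fun_prop
  · exact i1.ofReal.add (i2.ofReal.mul_const _)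
  · intro s hs
    have j1 : Integrable (fun x => (((ComplexMeasure.re ν).rnDeriv ν.variation x : ℝ) : ℂ))
        (ν.variation.restrict s) := i1.ofReal.integrableOn
    have j2 : Integrable (fun x => (((ComplexMeasure.im ν).rnDeriv ν.variation x : ℝ) : ℂ) *
        Complex.I) (ν.variation.restrict s) := (i2.ofReal.mul_const _).integrableOn
    rw [integral_add j1 j2,
      integral_mul_const, integral_complex_ofReal, integral_complex_ofReal,
      ← withDensityᵥ_apply i1 hs, ← withDensityᵥ_apply i2 hs, hre, him]
    exact (Complex.re_add_im (ν s)).symm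

/-- Holds for simple functions by linearity, then for bounded ones by dominated convergence on both
sides. It replaces vector-measure integrals by ordinary ones, for which Fubini is at hand. -/
lemma cIntegral_eq_integral_of_bounded {ν : ComplexMeasure X} {θ : X → ℂ}
    (hθ : Integrable θ ν.variation)
    (hν : ∀ s, MeasurableSet s → ν s = ∫ x in s, θ x ∂ν.variation)
    {f : X → ℂ} (hf : StronglyMeasurable f) {C : ℝ} (hC : ∀ x, ‖f x‖ ≤ C) :
    cIntegral ν f = ∫ x, f x * θ x ∂ν.variation := by
  have hsimple : ∀ g : SimpleFunc X ℂ, cIntegral ν g = ∫ x, g x * θ x ∂ν.variation := by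
    intro g
    induction g using SimpleFunc.induction with
    | @const c s hs =>
      have h1 : ⇑(SimpleFunc.piecewise s hs (SimpleFunc.const X c) (SimpleFunc.const X 0)) =
          s.indicator fun _ => c := by
        ext x; simp [SimpleFunc.coe_piecewise, Set.indicator, Set.piecewise]
      rw [h1, cIntegral, VectorMeasure.integral_indicator hs, VectorMeasure.integral_const]
      have h2 : (fun x => s.indicator (fun _ => c) x * θ x) = s.indicator fun x => c * θ x := by
        ext x; by_cases hx : x ∈ s <;> simp [hx]
      rw [h2, integral_indicator hs, integral_const_mul, ← hν s hs,
        VectorMeasure.restrict_apply _ hs MeasurableSet.univ]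
      simp
    | @add f g _ hf hg =>
      have hi : ∀ k : SimpleFunc X ℂ, Integrable k ν.variation := fun k =>
        SimpleFunc.integrable_of_isFiniteMeasure k
      have hb : ∀ k : SimpleFunc X ℂ, Integrable (fun x => k x * θ x) ν.variation := fun k => by
        obtain ⟨C, hC⟩ := k.exists_forall_norm_le
        exact hθ.bdd_mul (hi k).aestronglyMeasurable (ae_of_all _ hC)
      have e : (fun x => (f + g) x * θ x) = fun x => f x * θ x + g x * θ x := by
        ext x; simp [add_mul]
      rw [e, integral_add (hb f) (hb g), ← hf, ← hg]
      exact VectorMeasure.integral_add (hi f) (hi g)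
  have hlim := fun x => hf.tendsto_approxBounded_of_norm_le (c := C) (hC x)
  have hbd := fun n x => hf.norm_approxBounded_le
    (c := C) (n := n) (x := x)
  -- The uniform bound on the approximations needs `0 ≤ C`; a negative `C` is only possible on an
  -- empty space.
  by_cases hC0 : 0 ≤ C
  swap
  · have : IsEmpty X := ⟨fun x => hC0 ((norm_nonneg _).trans (hC x))⟩
    have h1 : f = (0 : SimpleFunc X ℂ) := Subsingleton.elim _ _
    rw [h1]; exact hsimple 0
  have t1 : Tendsto (fun n => cIntegral ν (hf.approxBounded C n)) atTop (𝓝 (cIntegral ν f)) := by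
    refine VectorMeasure.tendsto_integral_of_dominated_convergence (fun _ => C)
      (fun n => (SimpleFunc.stronglyMeasurable _).aestronglyMeasurable) (integrable_const _)
      (fun n => ae_of_all _ fun x => hbd n x hC0) (ae_of_all _ hlim)
  have t2 : Tendsto (fun n => ∫ x, hf.approxBounded C n x * θ x ∂ν.variation) atTop
      (𝓝 (∫ x, f x * θ x ∂ν.variation)) := by
    refine tendsto_integral_of_dominated_convergence (fun x => C * ‖θ x‖)
      (fun n => (SimpleFunc.stronglyMeasurable _).aestronglyMeasurable.mul
        hθ.aestronglyMeasurable) (hθ.norm.const_mul _) (fun n => ae_of_all _ fun x => ?_)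
      (ae_of_all _ fun x => (hlim x).mul_const _)
    rw [norm_mul]
    exact mul_le_mul_of_nonneg_right (hbd n x hC0) (norm_nonneg _)
  simp_rw [hsimple] at t1
  exact tendsto_nhds_unique t1 t2

/-- This yields the constant `|ν|(X)` in the operator bound without comparing it with `∫ |θ|`. -/
lemma norm_cIntegral_le (ν : ComplexMeasure X) {f : X → ℂ} {C : ℝ} (hC : ∀ x, ‖f x‖ ≤ C) :
    ‖cIntegral ν f‖ ≤ C * (ν.variation Set.univ).toReal := by
  by_cases hX : Nonempty X
  · obtain ⟨x⟩ := hX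
    have hC0 : 0 ≤ C := (norm_nonneg _).trans (hC x)
    refine (VectorMeasure.norm_integral_le_of_norm_le_const (ae_of_all _ hC)).trans ?_
    rw [measureReal_def]
    refine mul_le_mul_of_nonneg_right ?_ ENNReal.toReal_nonneg
    exact mul_le_of_le_one_right hC0 (ContinuousLinearMap.opNorm_mul_le ℝ ℂ)
  · have : IsEmpty X := not_nonempty_iff.mp hX
    have h1 : ν.variation = 0 := by simp [Measure.eq_zero_of_isEmpty]
    have h2 : f = fun _ => 0 := Subsingleton.elim _ _
    rw [h1, h2, cIntegral, VectorMeasure.integral_zero]; simp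

end ComplexMeasure

end WienerWeyl

namespace WienerWeyl

/-! ### Projections along nested subspaces -/

section Projections

variable {H : Type*} [NormedAddCommGroup H] [InnerProductSpace ℝ H]

/-- The projection onto `Uᗮ ⊓ V` is the difference of the projections onto `V` and `U`, and is
orthogonal to the latter: Pythagoras. -/
lemma norm_sq_starProjection_orthogonal_inf (U V : Submodule ℝ H) [FiniteDimensional ℝ U]
    [FiniteDimensional ℝ V] (hUV : U ≤ V) (e : H) :
    ‖V.starProjection e‖ ^ 2 = ‖U.starProjection e‖ ^ 2 +
      ‖(Uᗮ ⊓ V).starProjection e‖ ^ 2 := by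
  have hw : (Uᗮ ⊓ V).starProjection e = V.starProjection e - U.starProjection e := by
    refine Submodule.eq_starProjection_of_mem_of_inner_eq_zero (K := Uᗮ ⊓ V) ?_ ?_
    · refine Submodule.mem_inf.mpr ⟨?_, V.sub_mem (Submodule.coe_mem _)
        (hUV (Submodule.coe_mem _))⟩
      rw [Submodule.mem_orthogonal']
      intro u hu
      rw [inner_sub_left]
      have h1 := Submodule.starProjection_inner_eq_zero (K := V) e u (hUV hu)
      have h2 := Submodule.starProjection_inner_eq_zero (K := U) e u hu
      rw [inner_sub_left] at h1 h2
      linarith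
    · intro w hw
      have h1 := Submodule.starProjection_inner_eq_zero (K := V) e w (Submodule.mem_inf.mp hw).2
      have h2 : ⟪U.starProjection e, w⟫ = 0 :=
        (Submodule.mem_orthogonal _ _).mp (Submodule.mem_inf.mp hw).1 _ (Submodule.coe_mem _)
      rw [inner_sub_left] at h1
      rw [inner_sub_left, inner_sub_left]
      linarith
  have h3 : ⟪U.starProjection e, (Uᗮ ⊓ V).starProjection e⟫ = 0 := by
    have : (Uᗮ ⊓ V).starProjection e ∈ Uᗮ := (Submodule.mem_inf.mp (Submodule.coe_mem _)).1
    exact (Submodule.mem_orthogonal _ _).mp this _ (Submodule.coe_mem _)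
  have h4 : V.starProjection e = U.starProjection e + (Uᗮ ⊓ V).starProjection e := by
    rw [hw]; abel
  rw [h4, norm_add_sq_real, h3]
  ring

end Projections

variable {H B : Type*} [NormedAddCommGroup H] [InnerProductSpace ℝ H] [CompleteSpace H]
  [TopologicalSpace.SeparableSpace H] [MeasurableSpace H] [BorelSpace H]
  [NormedAddCommGroup B] [NormedSpace ℝ B] [CompleteSpace B]
  [MeasurableSpace B] [BorelSpace B] {i : H →L[ℝ] B}

/-! ### The inclusion of `B'` in `H` -/

section Duality

/-- The vector of `H` representing a continuous linear form on `B`. -/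
noncomputable def dualRepr (i : H →L[ℝ] B) (L : StrongDual ℝ B) : H :=
  (InnerProductSpace.toDual ℝ H).symm (L ∘L i)

lemma represents_dualRepr (i : H →L[ℝ] B) (L : StrongDual ℝ B) :
    Represents i L (dualRepr i L) := fun x => by
  simp [dualRepr]

lemma Represents.left_unique (hi : IsAbstractWiener i) {L L' : StrongDual ℝ B} {e : H}
    (h : Represents i L e) (h' : Represents i L' e) : L = L' := by
  refine ContinuousLinearMap.coeFn_injective ?_
  refine hi.denseRange.equalizer L.continuous L'.continuous ?_
  ext x
  simp only [Function.comp_apply, h x, h' x]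

lemma represents_functional {e : H} (he : ∃ L : StrongDual ℝ B, Represents i L e) :
    Represents i (functional i e) e := by
  rw [functional, dif_pos he]; exact he.choose_spec

lemma Represents.functional_eq (hi : IsAbstractWiener i) {L : StrongDual ℝ B} {e : H}
    (h : Represents i L e) : functional i e = L :=
  (represents_functional ⟨L, h⟩).left_unique hi h

lemma Represents.add {L L' : StrongDual ℝ B} {e e' : H} (h : Represents i L e)
    (h' : Represents i L' e') : Represents i (L + L') (e + e') := fun x => by
  simp [h x, h' x, inner_add_left]

lemma Represents.smul {L : StrongDual ℝ B} {e : H} (h : Represents i L e) (r : ℝ) :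
    Represents i (r • L) (r • e) := fun x => by
  simp [h x, real_inner_smul_left]

/-- The subspace `B' ⊂ H`. -/
def dualSubmodule (i : H →L[ℝ] B) : Submodule ℝ H where
  carrier := {e | ∃ L : StrongDual ℝ B, Represents i L e}
  zero_mem' := ⟨0, fun x => by simp⟩
  add_mem' := by
    rintro a b ⟨L, hL⟩ ⟨L', hL'⟩
    exact ⟨L + L', hL.add hL'⟩
  smul_mem' := by
    rintro r a ⟨L, hL⟩
    exact ⟨r • L, hL.smul r⟩

lemma inDual_iff_le {E : Submodule ℝ H} : InDual i E ↔ E ≤ dualSubmodule i := Iff.rfl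

lemma dualRepr_mem (L : StrongDual ℝ B) : dualRepr i L ∈ dualSubmodule i :=
  ⟨L, represents_dualRepr i L⟩

/-- If `v` is orthogonal to `B'`, every continuous linear form vanishes at `i v`; by Hahn-Banach `i
v = 0`, and `i` is injective. -/
lemma dense_dualSubmodule (hi : IsAbstractWiener i) :
    Dense (dualSubmodule i : Set H) := by
  rw [Submodule.dense_iff_topologicalClosure_eq_top, Submodule.topologicalClosure_eq_top_iff,
    Submodule.eq_bot_iff]
  intro v hv
  refine hi.injective ?_
  rw [map_zero]
  refine SeparatingDual.eq_zero_of_forall_dual_eq_zero (R := ℝ) fun L => ?_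
  rw [represents_dualRepr i L v]
  exact (Submodule.mem_orthogonal _ _).mp hv _ (dualRepr_mem L)

lemma secondCountableTopology_of_isAbstractWiener (hi : IsAbstractWiener i) :
    SecondCountableTopology B := by
  have : TopologicalSpace.SeparableSpace B := hi.denseRange.separableSpace i.continuous
  exact UniformSpace.secondCountable_of_separable B

lemma functional_add (hi : IsAbstractWiener i) {e e' : H} (he : e ∈ dualSubmodule i)
    (he' : e' ∈ dualSubmodule i) :
    functional i (e + e') = functional i e + functional i e' :=
  ((represents_functional he).add (represents_functional he')).functional_eq hi

lemma functional_smul (hi : IsAbstractWiener i) {e : H} (he : e ∈ dualSubmodule i) (r : ℝ) :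
    functional i (r • e) = r • functional i e :=
  ((represents_functional he).smul r).functional_eq hi

/-- The linear map `B' → StrongDual ℝ B`. -/
noncomputable def functionalLinear (hi : IsAbstractWiener i) :
    dualSubmodule i →ₗ[ℝ] StrongDual ℝ B where
  toFun e := functional i e
  map_add' e e' := functional_add hi e.2 e'.2
  map_smul' r e := functional_smul hi e.2 r

/-- Expanding `v` in the basis makes both sides linear in the coefficients. The identity
characterises `projB` without reference to the chosen basis. -/
lemma inner_projB (hi : IsAbstractWiener i) {E : Submodule ℝ H} [FiniteDimensional ℝ E]
    (hE : InDual i E) (v : E) (x : B) : ⟪v, projB i E x⟫ = functional i v x := by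
  have h1 : (v : H) = ∑ j, ⟪stdOrthonormalBasis ℝ E j, v⟫ • (stdOrthonormalBasis ℝ E j : H) := by
    conv_lhs => rw [← (stdOrthonormalBasis ℝ E).sum_repr' v]
    simp
  have h2 : functional i v =
      ∑ j, ⟪stdOrthonormalBasis ℝ E j, v⟫ • functional i (stdOrthonormalBasis ℝ E j : H) := by
    -- `functional` is linear only on `B'`, so the expansion is first lifted to the submodule.
    have h3 := congrArg (functionalLinear hi)
      (show (⟨v, hE v v.2⟩ : dualSubmodule i) = ∑ j, ⟪stdOrthonormalBasis ℝ E j, v⟫ •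
        (⟨(stdOrthonormalBasis ℝ E j : H), hE _ (Submodule.coe_mem _)⟩ : dualSubmodule i) from
          Subtype.ext (by simpa using h1))
    rw [map_sum] at h3
    simp only [map_smul] at h3
    exact h3
  rw [h2]
  simp only [projB, FunLike.coe_sum, Finset.sum_apply, ContinuousLinearMap.smulRight_apply,
    FunLike.coe_smul, Pi.smul_apply, smul_eq_mul, inner_sum, real_inner_smul_right]
  exact Finset.sum_congr rfl fun j _ => by rw [real_inner_comm, mul_comm]

lemma projB_apply_coe (hi : IsAbstractWiener i) {E : Submodule ℝ H} [FiniteDimensional ℝ E]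
    (hE : InDual i E) (y : H) : projB i E (i y) = E.orthogonalProjectionOnto y := by
  refine ext_inner_left ℝ fun v => ?_
  rw [inner_projB hi hE, represents_functional (hE v v.2) y]
  rw [Submodule.coe_inner]
  have := Submodule.starProjection_inner_eq_zero (K := E) y v v.2
  rw [inner_sub_left, sub_eq_zero, real_inner_comm] at this
  rw [this, real_inner_comm]
  rfl

end Duality

/-! ### Gross's theorem: existence of the Wiener measure -/

section Existence

/-- The blocks are the successive orthogonal differences of an increasing sequence `U n` that
absorbs the exceptional subspaces given by measurability of the norm with `ε = 2⁻ⁿ`. The squared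
projections telescope to that onto `U n`, which exhausts `H`. -/
lemma exists_orthogonal_blocks (hi : IsAbstractWiener i) {h : ℝ} (hh : 0 < h) :
    ∃ (D : ℕ → Submodule ℝ H) (_ : ∀ n, FiniteDimensional ℝ (D n)),
      (∀ n, gaussMeasure (D (n + 1)) h {y : D (n + 1) | (1 / 2) ^ n < ‖i (y : H)‖} <
        ENNReal.ofReal ((1 / 2) ^ n)) ∧
      ∀ e : H, Tendsto (fun n => ∑ k ∈ Finset.range n, ‖(D k).orthogonalProjectionOnto e‖ ^ 2) atTop
        (𝓝 (‖e‖ ^ 2)) := by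
  have hmeas := fun n : ℕ => hi.measurable_norm ((1 / 2) ^ n) (by positivity) h hh
  choose F hF hF2 using hmeas
  -- Adding one vector of a dense sequence at each stage makes the union of the `U n` dense.
  let G : ℕ → Submodule ℝ H := fun k => F k ⊔ Submodule.span ℝ {TopologicalSpace.denseSeq H k}
  have hG : ∀ k, FiniteDimensional ℝ (G k) := fun k => inferInstance
  let U : ℕ → Submodule ℝ H := fun n => (Finset.range n).sup G
  have hU : ∀ n, FiniteDimensional ℝ (U n) := fun n =>
    Submodule.finiteDimensional_finset_sup _ _
  have hmono : Monotone U := fun a b hab => Finset.sup_mono (Finset.range_mono hab)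
  have hGU : ∀ k, G k ≤ U (k + 1) := fun k => Finset.le_sup (f := G) (by simp)
  have hD : ∀ n, FiniteDimensional ℝ ((U n)ᗮ ⊓ U (n + 1) : Submodule ℝ H) := fun n =>
    Submodule.finiteDimensional_of_le inf_le_right
  refine ⟨fun n => (U n)ᗮ ⊓ U (n + 1), hD, fun n => ?_, fun e => ?_⟩
  -- `U (n + 1)` is the first guaranteed to contain `F n`; hence the shift of index, with no
  -- smallness claimed for block `0`.
  · refine hF2 n _ ?_
    rw [Submodule.isOrtho_iff_le]
    exact inf_le_left.trans (Submodule.orthogonal_le (le_sup_left.trans (hGU n)))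
  · have h1 : ∀ n, ∑ k ∈ Finset.range n,
        ‖((U k)ᗮ ⊓ U (k + 1)).orthogonalProjectionOnto e‖ ^ 2 = ‖(U n).starProjection e‖ ^ 2 := by
      intro n
      induction n with
      | zero =>
        have : (U 0).starProjection e = 0 := by
          have h0 : (U 0).starProjection e ∈ U 0 := Submodule.coe_mem _
          simp [U]
        simp [this]
      | succ n ih =>
        rw [Finset.sum_range_succ, ih,
          norm_sq_starProjection_orthogonal_inf (U n) (U (n + 1)) (hmono n.le_succ) e]
        rfl
    simp_rw [h1]
    have htop : ⊤ ≤ (⨆ n, U n).topologicalClosure := by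
      rw [top_le_iff, ← Submodule.dense_iff_topologicalClosure_eq_top]
      refine (TopologicalSpace.denseRange_denseSeq H).mono ?_
      rintro _ ⟨k, rfl⟩
      exact (le_iSup U (k + 1)) (hGU k ((le_sup_right : _ ≤ G k)
        (Submodule.mem_span_singleton_self _)))
    exact ((Submodule.starProjection_tendsto_self U hmono e htop).norm).pow 2

/-- `μ` is the law of `∑ i(ω_n)` for independent Gaussians `ω_n` on the blocks. The series converges
almost surely in `B` by Borel-Cantelli, and the characteristic functional is the limit of the finite
products. -/
theorem exists_measure_integral_cexp (hi : IsAbstractWiener i) {h : ℝ} (hh : 0 < h) :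
    ∃ μ : Measure B, IsProbabilityMeasure μ ∧ ∀ (L : StrongDual ℝ B) (e : H), Represents i L e →
      ∫ x, Complex.exp (Complex.I * ((L x : ℝ) : ℂ)) ∂μ =
        ((Real.exp (-h * ‖e‖ ^ 2 / 2) : ℝ) : ℂ) := by
  have := secondCountableTopology_of_isAbstractWiener hi
  obtain ⟨D, hD, hsmall, hlim⟩ := exists_orthogonal_blocks hi hh
  have hγ : ∀ n, IsProbabilityMeasure (gaussMeasure (D n) h) := fun n =>
    isProbabilityMeasure_gaussMeasure hh
  let P : Measure (Π n, D n) := Measure.infinitePi fun n => gaussMeasure (D n) h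
  let T : ℕ → (Π n, D n) → B := fun n ω => i (ω n : H)
  have hTm : ∀ n, Measurable (T n) := fun n =>
    (i.continuous.comp continuous_subtype_val).measurable.comp (measurable_pi_apply n)
  have hT : ∀ n, P {ω | (1 / 2) ^ n < ‖T (n + 1) ω‖} ≤ ENNReal.ofReal ((1 / 2) ^ n) := by
    intro n
    have h1 := measurePreserving_eval_infinitePi (fun n => gaussMeasure (D n) h) (n + 1)
    have h2 : MeasurableSet {y : D (n + 1) | (1 / 2 : ℝ) ^ n < ‖i (y : H)‖} :=
      measurableSet_lt measurable_const
        (i.continuous.comp continuous_subtype_val).norm.measurable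
    have h3 := h1.measure_preimage h2.nullMeasurableSet
    exact (h3.trans_lt (hsmall n)).le
  have hsum : ∑' n, P {ω | (1 / 2) ^ n < ‖T (n + 1) ω‖} ≠ ∞ := by
    refine ne_top_of_le_ne_top ?_ (ENNReal.tsum_le_tsum hT)
    rw [← ENNReal.ofReal_tsum_of_nonneg (fun n => by positivity)
      (summable_geometric_of_lt_one (by norm_num) (by norm_num))]
    exact ENNReal.ofReal_ne_top
  have hconv : ∀ᵐ ω ∂P, ∃ l, Tendsto (fun n => ∑ k ∈ Finset.range n, T k ω) atTop (𝓝 l) := by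
    filter_upwards [ae_eventually_notMem hsum] with ω hω
    have h1 : Summable fun n => T (n + 1) ω := by
      -- Almost surely only finitely many terms exceed their geometric bound.
      refine Summable.of_norm_bounded_eventually_nat (g := fun n => (1 / 2 : ℝ) ^ n)
        (summable_geometric_of_lt_one (by norm_num) (by norm_num)) ?_
      filter_upwards [hω] with n hn
      simpa using hn
    exact ⟨_, ((summable_nat_add_iff 1).mp h1).hasSum.tendsto_sum_nat⟩
  obtain ⟨S, hSm, hS⟩ := measurable_limit_of_tendsto_metrizable_ae
    (f := fun n ω => ∑ k ∈ Finset.range n, T k ω)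
    (fun n => (Finset.measurable_fun_sum _ fun k _ => hTm k).aemeasurable) hconv
  refine ⟨P.map S, Measure.isProbabilityMeasure_map hSm.aemeasurable, fun L e hLe => ?_⟩
  rw [integral_map hSm.aemeasurable (by fun_prop)]
  have hpart : ∀ n, ∫ ω, Complex.exp (Complex.I * ((L (∑ k ∈ Finset.range n, T k ω) : ℝ) : ℂ)) ∂P
      = ((Real.exp (-h * (∑ k ∈ Finset.range n,
          ‖(D k).orthogonalProjectionOnto e‖ ^ 2) / 2) : ℝ) : ℂ) := by
    intro n
    have hc : ∀ k, Continuous fun y : D k => ⟪e, (y : H)⟫ := fun k => by fun_prop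
    have hXm : ∀ k, Measurable fun ω : Π n, D n => ⟪e, (ω k : H)⟫ := fun k =>
      (hc k).measurable.comp (measurable_pi_apply k)
    have hind : ProbabilityTheory.iIndepFun (fun k (ω : Π n, D n) => ⟪e, (ω k : H)⟫) P :=
      ProbabilityTheory.iIndepFun_infinitePi (X := fun k (y : D k) => ⟪e, (y : H)⟫)
        fun k => (hc k).measurable
    have h1 := ProbabilityTheory.iIndepFun.charFun_map_fun_finsetSum_eq_prod
      (s := Finset.range n) (P := P) (X := fun k (ω : Π n, D n) => ⟪e, (ω k : H)⟫)
      (fun k _ => (hXm k).aemeasurable)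
      (hind.precomp (g := fun k : Finset.range n => (k : ℕ)) Subtype.val_injective)
    -- The characteristic function of the scalar partial sum at `1` is the integral sought.
    have h2 := congrFun h1 1
    rw [charFun_apply, integral_map (Finset.measurable_fun_sum _ fun k _ => hXm k).aemeasurable
      (by fun_prop), Finset.prod_apply] at h2
    have h3 : ∀ k, charFun (P.map fun ω : Π n, D n => ⟪e, (ω k : H)⟫) 1 =
        ((Real.exp (-h * ‖(D k).orthogonalProjectionOnto e‖ ^ 2 / 2) : ℝ) : ℂ) := by
      intro k
      rw [charFun_apply, integral_map (hXm k).aemeasurable (by fun_prop),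
        ← integral_cexp_inner_gaussMeasure hh]
      have h4 := (measurePreserving_eval_infinitePi (fun n => gaussMeasure (D n) h) k)
      rw [← h4.map_eq, integral_map h4.measurable.aemeasurable (by fun_prop)]
      refine integral_congr_ae (ae_of_all _ fun ω => ?_)
      have h5 : ⟪(D k).orthogonalProjectionOnto e, ω k⟫ = ⟪e, (ω k : H)⟫ := by
        have := Submodule.starProjection_inner_eq_zero (K := D k) e (ω k) (ω k).2
        rw [inner_sub_left, sub_eq_zero] at this
        rw [this]; rfl
      simp only [Function.eval, h5]
      simp [mul_comm]
    simp_rw [h3] at h2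
    rw [← Complex.ofReal_prod, ← Real.exp_sum, ← Finset.sum_div, ← Finset.mul_sum] at h2
    rw [← h2]
    refine integral_congr_ae (ae_of_all _ fun ω => ?_)
    simp only [map_sum, T, hLe _]
    simp [mul_comm]
  have t1 : Tendsto (fun n => ∫ ω, Complex.exp (Complex.I *
      ((L (∑ k ∈ Finset.range n, T k ω) : ℝ) : ℂ)) ∂P) atTop
      (𝓝 (∫ ω, Complex.exp (Complex.I * ((L (S ω) : ℝ) : ℂ)) ∂P)) := by
    refine tendsto_integral_of_dominated_convergence (fun _ => 1) (fun n => ?_)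
      (integrable_const _) (fun n => ae_of_all _ fun ω => ?_) ?_
    · have : Measurable fun ω => ∑ k ∈ Finset.range n, T k ω :=
        Finset.measurable_fun_sum _ fun k _ => hTm k
      exact (by fun_prop : Measurable _).aestronglyMeasurable
    · rw [mul_comm, Complex.norm_exp_ofReal_mul_I]
    · filter_upwards [hS] with ω hω
      have hc : Continuous fun x : B => Complex.exp (Complex.I * ((L x : ℝ) : ℂ)) := by fun_prop
      exact (hc.tendsto _).comp hω
  simp_rw [hpart] at t1
  have t2 : Tendsto (fun n => ((Real.exp (-h * (∑ k ∈ Finset.range n,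
          ‖(D k).orthogonalProjectionOnto e‖ ^ 2) / 2) : ℝ) : ℂ)) atTop
      (𝓝 ((Real.exp (-h * ‖e‖ ^ 2 / 2) : ℝ) : ℂ)) := by
    have hc : Continuous fun s : ℝ => ((Real.exp (-h * s / 2) : ℝ) : ℂ) := by fun_prop
    exact (hc.tendsto _).comp (hlim e)
  exact tendsto_nhds_unique t1 t2

/-- **Gross's theorem**: the Gaussian cylinder measure extends to a Borel measure on `B`. -/
theorem exists_isWienerMeasure (hi : IsAbstractWiener i) {h : ℝ} (hh : 0 < h) :
    ∃ μ : Measure B, IsWienerMeasure i h μ := by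
  obtain ⟨μ, hμ, hchar⟩ := exists_measure_integral_cexp hi hh
  refine ⟨μ, hμ, fun E _ hE => ?_⟩
  have := isProbabilityMeasure_gaussMeasure (E := E) hh
  have : IsProbabilityMeasure (μ.map (projB i E)) :=
    Measure.isProbabilityMeasure_map (projB i E).continuous.measurable.aemeasurable
  refine Measure.ext_of_charFun (funext fun v => ?_)
  rw [charFun_gaussMeasure hh, charFun_apply,
    integral_map (projB i E).continuous.measurable.aemeasurable (by fun_prop)]
  have := hchar (functional i v) v (represents_functional (hE v v.2))
  rw [Submodule.coe_norm, ← this]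
  refine integral_congr_ae (ae_of_all _ fun x => ?_)
  simp only
  rw [real_inner_comm, inner_projB hi hE, mul_comm]

lemma isWienerMeasure_wienerMeasure (hi : IsAbstractWiener i) {h : ℝ} (hh : 0 < h) :
    IsWienerMeasure i h (wienerMeasure i h) := by
  rw [wienerMeasure, dif_pos (exists_isWienerMeasure hi hh)]
  exact (exists_isWienerMeasure hi hh).choose_spec

lemma isProbabilityMeasure_wienerMeasure (hi : IsAbstractWiener i) {h : ℝ} (hh : 0 < h) :
    IsProbabilityMeasure (wienerMeasure i h) :=
  (isWienerMeasure_wienerMeasure hi hh).isProbabilityMeasure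

/-- `wienerMeasure` is a chosen measure, known only through its finite-dimensional images; the image
under the projection onto the line spanned by `e` suffices. -/
lemma integral_cexp_wienerMeasure (hi : IsAbstractWiener i) {h : ℝ} (hh : 0 < h)
    {L : StrongDual ℝ B} {e : H} (hL : Represents i L e) :
    ∫ x, Complex.exp (Complex.I * ((L x : ℝ) : ℂ)) ∂(wienerMeasure i h) =
      ((Real.exp (-h * ‖e‖ ^ 2 / 2) : ℝ) : ℂ) := by
  have hE : InDual i (Submodule.span ℝ {e}) := by
    rw [inDual_iff_le, Submodule.span_singleton_le_iff_mem]
    exact ⟨L, hL⟩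
  have h1 := (isWienerMeasure_wienerMeasure hi hh).map_projB _ hE
  have h2 := integral_cexp_inner_gaussMeasure hh
    (⟨e, Submodule.mem_span_singleton_self e⟩ : Submodule.span ℝ {e})
  rw [← h1, integral_map (projB i _).continuous.measurable.aemeasurable (by fun_prop)] at h2
  simp_rw [inner_projB hi hE, hL.functional_eq hi] at h2
  exact h2

end Existence

end WienerWeyl

/-! ### Isonormal Gaussian processes -/

namespace WienerWeyl

open ProbabilityTheory

/-- A centred Gaussian process indexed by a Hilbert space `K`, almost surely linear in the index,
with `Var ℓ_u = c ‖u‖²`. -/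
structure IsIsonormal {Ω K : Type*} [MeasurableSpace Ω] [NormedAddCommGroup K]
    [InnerProductSpace ℝ K] (P : Measure Ω) (c : ℝ) (ℓ : K → Ω → ℝ) : Prop where
  measurable : ∀ u, Measurable (ℓ u)
  add : ∀ u v, ∀ᵐ ω ∂P, ℓ (u + v) ω = ℓ u ω + ℓ v ω
  smul : ∀ (r : ℝ) u, ∀ᵐ ω ∂P, ℓ (r • u) ω = r * ℓ u ω
  integral_cexp : ∀ u, ∫ ω, Complex.exp (Complex.I * ((ℓ u ω : ℝ) : ℂ)) ∂P =
    ((Real.exp (-c * ‖u‖ ^ 2 / 2) : ℝ) : ℂ)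

namespace IsIsonormal

variable {Ω K : Type*} [MeasurableSpace Ω] [NormedAddCommGroup K] [InnerProductSpace ℝ K]
  {P : Measure Ω} [IsProbabilityMeasure P] {c : ℝ} {ℓ : K → Ω → ℝ}

lemma sub (hℓ : IsIsonormal P c ℓ) (u v : K) : ∀ᵐ ω ∂P, ℓ (u - v) ω = ℓ u ω - ℓ v ω := by
  filter_upwards [hℓ.add (u - v) v] with ω h1
  rw [sub_add_cancel] at h1
  linarith

lemma zero (hℓ : IsIsonormal P c ℓ) : ∀ᵐ ω ∂P, ℓ 0 ω = 0 := by
  filter_upwards [hℓ.smul 0 0] with ω h1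
  simpa using h1

lemma sum_smul (hℓ : IsIsonormal P c ℓ) {ι : Type*} (s : Finset ι) (r : ι → ℝ) (u : ι → K) :
    ∀ᵐ ω ∂P, ℓ (∑ j ∈ s, r j • u j) ω = ∑ j ∈ s, r j * ℓ (u j) ω := by
  classical
  induction s using Finset.induction_on with
  | empty => simpa using hℓ.zero
  | insert a s ha ih =>
    filter_upwards [ih, hℓ.add (r a • u a) (∑ j ∈ s, r j • u j), hℓ.smul (r a) (u a)]
      with ω h1 h2 h3
    rw [Finset.sum_insert ha, Finset.sum_insert ha, h2, h3, h1]

/-- The characteristic function at `t` is the defining formula at `t • u`. The moments used below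
are then those of a one-dimensional Gaussian. -/
lemma map_eq (hℓ : IsIsonormal P c ℓ) (hc : 0 < c) (u : K) :
    P.map (ℓ u) = gaussianReal 0 (c * ‖u‖ ^ 2).toNNReal := by
  have := Measure.isProbabilityMeasure_map (μ := P) (hℓ.measurable u).aemeasurable
  refine Measure.ext_of_charFun (funext fun t => ?_)
  rw [charFun_gaussianReal, charFun_apply_real,
    integral_map (hℓ.measurable u).aemeasurable (by fun_prop)]
  have h1 := hℓ.integral_cexp (t • u)
  have h2 : ∫ ω, Complex.exp (Complex.I * ((ℓ (t • u) ω : ℝ) : ℂ)) ∂P =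
      ∫ ω, Complex.exp ((t : ℂ) * ((ℓ u ω : ℝ) : ℂ) * Complex.I) ∂P := by
    refine integral_congr_ae ?_
    filter_upwards [hℓ.smul t u] with ω hω
    rw [hω, Complex.ofReal_mul, mul_comm]
  rw [← h2, h1, Complex.ofReal_exp, Real.coe_toNNReal _ (by positivity), norm_smul, mul_pow,
    Real.norm_eq_abs, sq_abs]
  congr 1
  push_cast
  ring

lemma memLp (hℓ : IsIsonormal P c ℓ) (hc : 0 < c) (u : K) {p : ℝ≥0∞} (hp : p ≠ ∞) :
    MemLp (ℓ u) p P := by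
  have h1 := memLp_id_gaussianReal' (μ := 0) (v := (c * ‖u‖ ^ 2).toNNReal) p hp
  rw [← hℓ.map_eq hc u, memLp_map_measure_iff (by fun_prop) (hℓ.measurable u).aemeasurable] at h1
  exact h1

lemma integrable (hℓ : IsIsonormal P c ℓ) (hc : 0 < c) (u : K) : Integrable (ℓ u) P :=
  memLp_one_iff_integrable.mp (hℓ.memLp hc u (by simp))

lemma integral_eq_zero (hℓ : IsIsonormal P c ℓ) (hc : 0 < c) (u : K) : ∫ ω, ℓ u ω ∂P = 0 := by
  have h1 := integral_id_gaussianReal (μ := 0) (v := (c * ‖u‖ ^ 2).toNNReal)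
  rw [← hℓ.map_eq hc u, integral_map (hℓ.measurable u).aemeasurable (by fun_prop)] at h1
  exact h1

lemma integral_sq (hℓ : IsIsonormal P c ℓ) (hc : 0 < c) (u : K) :
    ∫ ω, ℓ u ω ^ 2 ∂P = c * ‖u‖ ^ 2 := by
  have h1 := variance_id_gaussianReal (μ := 0) (v := (c * ‖u‖ ^ 2).toNNReal)
  rw [← hℓ.map_eq hc u, variance_id_map (hℓ.measurable u).aemeasurable,
    variance_of_integral_eq_zero (hℓ.measurable u).aemeasurable (hℓ.integral_eq_zero hc u),
    Real.coe_toNNReal _ (by positivity)] at h1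
  exact h1

/-- Nonnegativity of the variance of `|ℓ_u|`, that is, Cauchy-Schwarz. -/
lemma integral_abs_le (hℓ : IsIsonormal P c ℓ) (hc : 0 < c) (u : K) :
    ∫ ω, |ℓ u ω| ∂P ≤ √c * ‖u‖ := by
  have h1 := variance_nonneg |ℓ u| P
  rw [variance_eq_sub (hℓ.memLp hc u (by simp)).abs] at h1
  change 0 ≤ (∫ ω, |ℓ u ω| ^ 2 ∂P) - (∫ ω, |ℓ u ω| ∂P) ^ 2 at h1
  simp_rw [sq_abs] at h1
  rw [hℓ.integral_sq hc u] at h1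
  refine abs_le_of_sq_le_sq' ?_ (by positivity) |>.2
  rw [mul_pow, Real.sq_sqrt hc.le]
  linarith

/-- Pointwise `|exp(ix) - exp(iy)| ≤ min(2, |x - y|)`. The cap `2` makes it possible to integrate
this over indices against a finite measure having no moments. -/
lemma integral_norm_cexp_sub_le (hℓ : IsIsonormal P c ℓ) (hc : 0 < c) (u v : K) :
    ∫ ω, ‖Complex.exp (Complex.I * ((ℓ u ω : ℝ) : ℂ)) -
      Complex.exp (Complex.I * ((ℓ v ω : ℝ) : ℂ))‖ ∂P ≤ min 2 (√c * ‖u - v‖) := by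
  have hmeas : ∀ w, Measurable fun ω => Complex.exp (Complex.I * ((ℓ w ω : ℝ) : ℂ)) := fun w => by
    have := hℓ.measurable w
    fun_prop
  have hnorm : ∀ w ω, ‖Complex.exp (Complex.I * ((ℓ w ω : ℝ) : ℂ))‖ = 1 := fun w ω => by
    rw [mul_comm, Complex.norm_exp_ofReal_mul_I]
  have hint : Integrable (fun ω => ‖Complex.exp (Complex.I * ((ℓ u ω : ℝ) : ℂ)) -
      Complex.exp (Complex.I * ((ℓ v ω : ℝ) : ℂ))‖) P := by
    refine Integrable.of_bound ((hmeas u).sub (hmeas v)).norm.aestronglyMeasurable 2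
      (ae_of_all _ fun ω => ?_)
    rw [norm_norm]
    refine (norm_sub_le _ _).trans ?_
    rw [hnorm, hnorm]; norm_num
  refine le_min ?_ ?_
  · refine (integral_mono hint (integrable_const 2) fun ω => ?_).trans (by simp)
    refine (norm_sub_le _ _).trans ?_
    rw [hnorm, hnorm]; norm_num
  · refine le_trans ?_ (hℓ.integral_abs_le hc (u - v))
    refine integral_mono_ae hint (hℓ.integrable hc _).abs ?_
    filter_upwards [hℓ.sub u v] with ω hω
    rw [hω]
    have h1 : Complex.exp (Complex.I * ((ℓ u ω : ℝ) : ℂ)) -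
        Complex.exp (Complex.I * ((ℓ v ω : ℝ) : ℂ)) =
        Complex.exp (Complex.I * ((ℓ v ω : ℝ) : ℂ)) *
          (Complex.exp (Complex.I * ((ℓ u ω - ℓ v ω : ℝ) : ℂ)) - 1) := by
      rw [mul_sub, ← Complex.exp_add, mul_one]
      congr 2
      push_cast; ring
    rw [h1, norm_mul, hnorm, one_mul]
    exact Real.norm_exp_I_mul_ofReal_sub_one_le

/-- Every linear form of `(X, Y)` is some `ℓ_{a+b}` with `a ⟂ b`, so `|a + b|² = |a|² + |b|²` and
the joint characteristic function factors. -/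
lemma indepFun {V W : Type*} [NormedAddCommGroup V] [NormedSpace ℝ V] [MeasurableSpace V]
    [BorelSpace V] [SecondCountableTopology V] [CompleteSpace V] [NormedAddCommGroup W]
    [NormedSpace ℝ W] [MeasurableSpace W] [BorelSpace W] [SecondCountableTopology W]
    [CompleteSpace W] (hℓ : IsIsonormal P c ℓ) {U : Submodule ℝ K} {X : Ω → V} {Y : Ω → W}
    (hX : Measurable X) (hY : Measurable Y)
    (hXU : ∀ L : StrongDual ℝ V, ∃ a ∈ U, ∀ᵐ ω ∂P, L (X ω) = ℓ a ω)
    (hYU : ∀ L : StrongDual ℝ W, ∃ b ∈ Uᗮ, ∀ᵐ ω ∂P, L (Y ω) = ℓ b ω) : IndepFun X Y P := by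
  rw [indepFun_iff_charFunDual_prod hX.aemeasurable hY.aemeasurable]
  intro L
  obtain ⟨a, ha, hXa⟩ := hXU (L ∘L ContinuousLinearMap.inl ℝ V W)
  obtain ⟨b, hb, hYb⟩ := hYU (L ∘L ContinuousLinearMap.inr ℝ V W)
  rw [charFunDual_apply, charFunDual_apply, charFunDual_apply,
    integral_map (hX.prodMk hY).aemeasurable (by fun_prop),
    integral_map hX.aemeasurable (by fun_prop), integral_map hY.aemeasurable (by fun_prop)]
  have e1 : ∫ ω, Complex.exp (((L ∘L ContinuousLinearMap.inl ℝ V W) (X ω) : ℝ) * Complex.I) ∂P =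
      ((Real.exp (-c * ‖a‖ ^ 2 / 2) : ℝ) : ℂ) := by
    rw [← hℓ.integral_cexp]
    refine integral_congr_ae ?_
    filter_upwards [hXa] with ω hω
    rw [hω, mul_comm]
  have e2 : ∫ ω, Complex.exp (((L ∘L ContinuousLinearMap.inr ℝ V W) (Y ω) : ℝ) * Complex.I) ∂P =
      ((Real.exp (-c * ‖b‖ ^ 2 / 2) : ℝ) : ℂ) := by
    rw [← hℓ.integral_cexp]
    refine integral_congr_ae ?_
    filter_upwards [hYb] with ω hω
    rw [hω, mul_comm]
  have e3 : ∫ ω, Complex.exp ((L (X ω, Y ω) : ℝ) * Complex.I) ∂P =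
      ((Real.exp (-c * ‖a + b‖ ^ 2 / 2) : ℝ) : ℂ) := by
    rw [← hℓ.integral_cexp]
    refine integral_congr_ae ?_
    filter_upwards [hXa, hYb, hℓ.add a b] with ω h1 h2 h3
    have h4 : L (X ω, Y ω) = L (X ω, 0) + L (0, Y ω) := by rw [← map_add]; simp
    simp only [ContinuousLinearMap.comp_apply, ContinuousLinearMap.inl_apply,
      ContinuousLinearMap.inr_apply] at h1 h2
    rw [h4, h1, h2, h3, mul_comm]
  rw [e1, e2, e3, ← Complex.ofReal_mul, ← Real.exp_add, norm_add_sq_real,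
    (Submodule.mem_orthogonal _ _).mp hb a ha]
  congr 2
  ring

lemma indepFun_of_inner_eq_zero (hℓ : IsIsonormal P c ℓ) {a b : K} (hab : ⟪a, b⟫ = 0) :
    IndepFun (ℓ a) (ℓ b) P := by
  refine hℓ.indepFun (U := Submodule.span ℝ {a}) (hℓ.measurable a) (hℓ.measurable b)
    (fun L => ⟨L 1 • a, Submodule.smul_mem _ _ (Submodule.mem_span_singleton_self a), ?_⟩)
    (fun L => ⟨L 1 • b, Submodule.smul_mem _ _ ?_, ?_⟩)
  · filter_upwards [hℓ.smul (L 1) a] with ω hω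
    rw [hω]
    conv_lhs => rw [← mul_one (ℓ a ω), ← smul_eq_mul, map_smul, smul_eq_mul, mul_comm]
  · rw [Submodule.mem_orthogonal_singleton_iff_inner_right]; exact hab
  · filter_upwards [hℓ.smul (L 1) b] with ω hω
    rw [hω]
    conv_lhs => rw [← mul_one (ℓ b ω), ← smul_eq_mul, map_smul, smul_eq_mul, mul_comm]

lemma integral_cexp_mul (hℓ : IsIsonormal P c ℓ) (hc : 0 < c) (z : ℂ) (u : K) :
    ∫ ω, Complex.exp (z * ((ℓ u ω : ℝ) : ℂ)) ∂P =
      Complex.exp (c * ‖u‖ ^ 2 * z ^ 2 / 2) := by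
  have h1 := complexMGF_gaussianReal (hℓ.map_eq hc u) z
  rw [complexMGF] at h1
  rw [h1, Real.coe_toNNReal _ (by positivity)]
  congr 1
  push_cast; ring

lemma integrable_exp_mul (hℓ : IsIsonormal P c ℓ) (hc : 0 < c) (t : ℝ) (u : K) :
    Integrable (fun ω => Real.exp (t * ℓ u ω)) P := by
  have h1 := integrable_exp_mul_gaussianReal (μ := 0) (v := (c * ‖u‖ ^ 2).toNNReal) t
  rw [← hℓ.map_eq hc u] at h1
  exact h1.comp_measurable (hℓ.measurable u)

/-- The exponential moment `E exp(ℓ_a + i ℓ_b) = exp(c (|a|² - |b|² + 2i a·b) / 2)`. -/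
lemma integral_cexp_add_I_mul (hℓ : IsIsonormal P c ℓ) (hc : 0 < c) (a b : K) :
    ∫ ω, Complex.exp ((ℓ a ω : ℂ) + Complex.I * (ℓ b ω : ℂ)) ∂P =
      Complex.exp ((c : ℂ) / 2 * ((‖a‖ ^ 2 - ‖b‖ ^ 2 : ℝ) + 2 * Complex.I * (⟪a, b⟫ : ℝ))) := by
  -- Write `b = s a + b'` with `b' ⟂ a`, so that only the independent variables `ℓ_a` and `ℓ_{b'}`
  -- occur. For `a = 0` the division returns `s = 0`, which is the right value.
  set s : ℝ := ⟪a, b⟫ / ‖a‖ ^ 2 with hs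
  set b' : K := b - s • a with hb'
  have hsa : s * ‖a‖ ^ 2 = ⟪a, b⟫ := by
    by_cases ha : a = 0
    · simp [ha]
    · have : ‖a‖ ^ 2 ≠ 0 := by positivity
      rw [hs]; field_simp
  have hab' : ⟪a, b'⟫ = 0 := by
    rw [hb', inner_sub_right, real_inner_smul_right, real_inner_self_eq_norm_sq, hsa, sub_self]
  have hb : b = s • a + b' := by rw [hb']; abel
  have e1 : ∫ ω, Complex.exp ((ℓ a ω : ℂ) + Complex.I * (ℓ b ω : ℂ)) ∂P =
      ∫ ω, Complex.exp ((1 + Complex.I * s) * (ℓ a ω : ℂ)) *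
        Complex.exp (Complex.I * (ℓ b' ω : ℂ)) ∂P := by
    refine integral_congr_ae ?_
    filter_upwards [hℓ.smul s a, hℓ.add (s • a) b'] with ω h1 h2
    rw [hb, h2, h1, ← Complex.exp_add]
    congr 1
    push_cast; ring
  rw [e1, (hℓ.indepFun_of_inner_eq_zero hab').integral_fun_comp_mul_comp
    (f := fun x : ℝ => Complex.exp ((1 + Complex.I * s) * (x : ℂ)))
    (g := fun x : ℝ => Complex.exp (Complex.I * (x : ℂ)))
    (hℓ.measurable a).aemeasurable (hℓ.measurable b').aemeasurable
    (by fun_prop) (by fun_prop), hℓ.integral_cexp_mul hc, hℓ.integral_cexp_mul hc,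
    ← Complex.exp_add]
  congr 1
  have h3 : ‖b‖ ^ 2 = s ^ 2 * ‖a‖ ^ 2 + ‖b'‖ ^ 2 := by
    rw [hb, norm_add_sq_real, real_inner_smul_left, hab', norm_smul, mul_pow, Real.norm_eq_abs,
      sq_abs]
    ring
  rw [h3, ← hsa]
  push_cast
  linear_combination (c * ‖a‖ ^ 2 * s ^ 2 / 2 + c * ‖b'‖ ^ 2 / 2 : ℂ) * Complex.I_sq

end IsIsonormal

end WienerWeyl

namespace WienerWeyl

open ProbabilityTheory

variable {H B : Type*} [NormedAddCommGroup H] [InnerProductSpace ℝ H] [CompleteSpace H]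
  [TopologicalSpace.SeparableSpace H] [MeasurableSpace H] [BorelSpace H]
  [NormedAddCommGroup B] [NormedSpace ℝ B] [CompleteSpace B]
  [MeasurableSpace B] [BorelSpace B] {i : H →L[ℝ] B}

/-! ### The random variables `ℓ_u` -/

section Ell

lemma isIsonormal_functional (hi : IsAbstractWiener i) {h : ℝ} (hh : 0 < h) :
    IsIsonormal (wienerMeasure i h) h (fun (e : dualSubmodule i) x => functional i e x) where
  measurable e := (functional i e).continuous.measurable
  add e e' := ae_of_all _ fun x => by
    have := functional_add hi e.2 e'.2
    simp only [Submodule.coe_add, this, FunLike.coe_add, Pi.add_apply]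
  smul r e := ae_of_all _ fun x => by
    have := functional_smul hi e.2 r
    simp only [Submodule.coe_smul, this, FunLike.coe_smul, Pi.smul_apply, smul_eq_mul]
  integral_cexp e := integral_cexp_wienerMeasure hi hh (represents_functional e.2)

lemma memLp_two_functional (hi : IsAbstractWiener i) {h : ℝ} (hh : 0 < h) (e : dualSubmodule i) :
    MemLp (functional i e) 2 (wienerMeasure i h) := by
  have := isProbabilityMeasure_wienerMeasure hi hh
  exact (isIsonormal_functional hi hh).memLp hh e (by simp)

lemma norm_toLp_functional (hi : IsAbstractWiener i) {h : ℝ} (hh : 0 < h) (e : dualSubmodule i) :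
    ‖(memLp_two_functional hi hh e).toLp _‖ = √h * ‖e‖ := by
  have := isProbabilityMeasure_wienerMeasure hi hh
  have h1 := (isIsonormal_functional hi hh).integral_sq hh e
  have h2 : ‖(memLp_two_functional hi hh e).toLp _‖ ^ 2 = (√h * ‖e‖) ^ 2 := by
    rw [mul_pow, Real.sq_sqrt hh.le, ← h1, ← real_inner_self_eq_norm_sq, L2.inner_def]
    refine integral_congr_ae ?_
    filter_upwards [(memLp_two_functional hi hh e).coeFn_toLp] with x hx
    rw [hx, real_inner_self_eq_norm_sq, Real.norm_eq_abs, sq_abs]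
  exact (pow_left_inj₀ (norm_nonneg _) (by positivity) two_ne_zero).mp h2

/-- The inclusion `B' → L²(B, μ_{B,h})`. -/
noncomputable def functionalToLp (hi : IsAbstractWiener i) {h : ℝ} (hh : 0 < h) :
    dualSubmodule i →L[ℝ] Lp ℝ 2 (wienerMeasure i h) :=
  LinearMap.mkContinuous
    { toFun := fun e => (memLp_two_functional hi hh e).toLp _
      map_add' := fun e e' => by
        rw [← MemLp.toLp_add]
        exact MemLp.toLp_congr _ _ ((isIsonormal_functional hi hh).add e e')
      map_smul' := fun r e => by
        rw [RingHom.id_apply, ← MemLp.toLp_const_smul]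
        exact MemLp.toLp_congr _ _ ((isIsonormal_functional hi hh).smul r e) }
    (√h) fun e => (norm_toLp_functional hi hh e).le

/-- The continuous linear map `u ↦ ℓ_u` from `H` to `L²(B, μ_{B,h})`. -/
noncomputable def ellToLp (hi : IsAbstractWiener i) {h : ℝ} (hh : 0 < h) :
    H →L[ℝ] Lp ℝ 2 (wienerMeasure i h) :=
  (functionalToLp hi hh).extend (dualSubmodule i).subtypeL

lemma ellToLp_coe (hi : IsAbstractWiener i) {h : ℝ} (hh : 0 < h) (e : dualSubmodule i) :
    ellToLp hi hh (e : H) = (memLp_two_functional hi hh e).toLp _ := by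
  have h1 := ContinuousLinearMap.extend_eq (functionalToLp hi hh)
    (e := (dualSubmodule i).subtypeL)
    (by simpa [DenseRange] using dense_dualSubmodule hi)
    isometry_subtype_coe.isUniformInducing e
  exact h1

lemma isEll_of_ae_eq (hi : IsAbstractWiener i) {h : ℝ} (hh : 0 < h) (u : H) {φ : B → ℝ}
    (hφ : Measurable φ) (hu : φ =ᵐ[wienerMeasure i h] ellToLp hi hh u) : IsEll i h u φ where
  measurable := hφ
  memLp := (memLp_congr_ae hu).mpr (Lp.memLp _)
  tendsto v L hL hv := by
    have h1 : Tendsto (fun n => ellToLp hi hh (v n)) atTop (𝓝 (ellToLp hi hh u)) :=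
      ((ellToLp hi hh).continuous.tendsto u).comp hv
    rw [Lp.tendsto_Lp_iff_tendsto_eLpNorm'] at h1
    refine h1.congr fun n => eLpNorm_congr_ae ?_
    have h2 := ellToLp_coe hi hh ⟨v n, L n, hL n⟩
    rw [h2]
    filter_upwards [hu, (memLp_two_functional hi hh ⟨v n, L n, hL n⟩).coeFn_toLp] with x hx h3
    rw [Pi.sub_apply, h3, hx, (hL n).functional_eq hi]

/-- The continuous extension supplies one version. Any other version is an `L²` limit of the same
sequence of functionals, hence equal almost everywhere. -/
lemma ell_ae_eq_ellToLp (hi : IsAbstractWiener i) {h : ℝ} (hh : 0 < h) (u : H) :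
    Measurable (ell i h u) ∧ ell i h u =ᵐ[wienerMeasure i h] ellToLp hi hh u := by
  have hex : ∃ φ, IsEll i h u φ :=
    ⟨_, isEll_of_ae_eq hi hh u (Lp.stronglyMeasurable (ellToLp hi hh u)).measurable
      (EventuallyEq.refl _ _)⟩
  have hspec : IsEll i h u (ell i h u) := by
    rw [ell, dif_pos hex]; exact hex.choose_spec
  refine ⟨hspec.measurable, ?_⟩
  have h0 := isEll_of_ae_eq hi hh u (Lp.stronglyMeasurable (ellToLp hi hh u)).measurable
      (EventuallyEq.refl _ _)
  obtain ⟨v, hv, hvu⟩ := mem_closure_iff_seq_limit.mp ((dense_dualSubmodule hi) u)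
  have hL := fun n => represents_functional (hv n)
  have t1 := hspec.tendsto v _ hL hvu
  have t2 := h0.tendsto v _ hL hvu
  have hle : ∀ n, eLpNorm (fun x => ell i h u x - ellToLp hi hh u x) 2 (wienerMeasure i h) ≤
      eLpNorm (fun x => functional i (v n) x - ell i h u x) 2 (wienerMeasure i h) +
      eLpNorm (fun x => functional i (v n) x - ellToLp hi hh u x) 2 (wienerMeasure i h) := by
    intro n
    have e : (fun x => ell i h u x - ellToLp hi hh u x) =
        (fun x => functional i (v n) x - ellToLp hi hh u x) -
          fun x => functional i (v n) x - ell i h u x := by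
      ext x; simp
    rw [e, add_comm]
    have hm := (functional i (v n)).continuous.measurable
    exact eLpNorm_sub_le (hm.sub h0.measurable).aestronglyMeasurable
      (hm.sub hspec.measurable).aestronglyMeasurable (by norm_num)
  have h5 : eLpNorm (fun x => ell i h u x - ellToLp hi hh u x) 2 (wienerMeasure i h) = 0 := by
    have := ge_of_tendsto' (t1.add t2) hle
    simpa using this
  have h6 := (eLpNorm_eq_zero_iff (f := fun x => ell i h u x - ellToLp hi hh u x)
    (hspec.measurable.sub h0.measurable).aestronglyMeasurable (by norm_num)).mp h5
  filter_upwards [h6] with x hx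
  exact sub_eq_zero.mp hx

lemma measurable_ell (hi : IsAbstractWiener i) {h : ℝ} (hh : 0 < h) (u : H) :
    Measurable (ell i h u) := (ell_ae_eq_ellToLp hi hh u).1

lemma ell_ae_eq_functional (hi : IsAbstractWiener i) {h : ℝ} (hh : 0 < h) {e : H}
    (he : e ∈ dualSubmodule i) : ∀ᵐ x ∂(wienerMeasure i h), ell i h e x = functional i e x := by
  have h1 := (ell_ae_eq_ellToLp hi hh e).2
  rw [ellToLp_coe hi hh ⟨e, he⟩] at h1
  filter_upwards [h1, (memLp_two_functional hi hh ⟨e, he⟩).coeFn_toLp] with x h2 h3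
  rw [h2, h3]

/-- An almost surely convergent subsequence of an `L²` approximation. Through it the characteristic
functional and the shift formula pass from `B'` to `H`. -/
lemma exists_seq_tendsto_ell (hi : IsAbstractWiener i) {h : ℝ} (hh : 0 < h) (u : H) :
    ∃ v : ℕ → H, (∀ n, v n ∈ dualSubmodule i) ∧ Tendsto v atTop (𝓝 u) ∧
      ∀ᵐ x ∂(wienerMeasure i h), Tendsto (fun n => functional i (v n) x) atTop
        (𝓝 (ell i h u x)) := by
  obtain ⟨v, hv, hvu⟩ := mem_closure_iff_seq_limit.mp ((dense_dualSubmodule hi) u)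
  have h1 : Tendsto (fun n => ellToLp hi hh (v n)) atTop (𝓝 (ellToLp hi hh u)) :=
    ((ellToLp hi hh).continuous.tendsto u).comp hvu
  have h2 := tendstoInMeasure_of_tendsto_Lp h1
  obtain ⟨ns, hns, h3⟩ := h2.exists_seq_tendsto_ae
  refine ⟨fun n => v (ns n), fun n => hv _, hvu.comp hns.tendsto_atTop, ?_⟩
  have h4 : ∀ᵐ x ∂(wienerMeasure i h), ∀ n,
      ellToLp hi hh (v (ns n)) x = functional i (v (ns n)) x := by
    rw [ae_all_iff]
    intro n
    rw [ellToLp_coe hi hh ⟨v (ns n), hv _⟩]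
    exact (memLp_two_functional hi hh ⟨v (ns n), hv _⟩).coeFn_toLp
  filter_upwards [h3, h4, (ell_ae_eq_ellToLp hi hh u).2] with x h5 h6 h7
  rw [h7]
  exact h5.congr fun n => h6 n

lemma isIsonormal_ell (hi : IsAbstractWiener i) {h : ℝ} (hh : 0 < h) :
    IsIsonormal (wienerMeasure i h) h (ell i h) where
  measurable u := measurable_ell hi hh u
  add u v := by
    filter_upwards [(ell_ae_eq_ellToLp hi hh u).2, (ell_ae_eq_ellToLp hi hh v).2,
      (ell_ae_eq_ellToLp hi hh (u + v)).2,
      Lp.coeFn_add (ellToLp hi hh u) (ellToLp hi hh v)] with x h1 h2 h3 h4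
    rw [h1, h2, h3, map_add, h4, Pi.add_apply]
  smul r u := by
    filter_upwards [(ell_ae_eq_ellToLp hi hh u).2, (ell_ae_eq_ellToLp hi hh (r • u)).2,
      Lp.coeFn_smul r (ellToLp hi hh u)] with x h1 h2 h3
    rw [h1, h2, map_smul, h3, Pi.smul_apply, smul_eq_mul]
  integral_cexp u := by
    have := isProbabilityMeasure_wienerMeasure hi hh
    obtain ⟨v, hv, hvu, hlim⟩ := exists_seq_tendsto_ell hi hh u
    have t1 : Tendsto (fun n => ∫ x, Complex.exp (Complex.I * ((functional i (v n) x : ℝ) : ℂ))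
        ∂(wienerMeasure i h)) atTop
        (𝓝 (∫ x, Complex.exp (Complex.I * ((ell i h u x : ℝ) : ℂ)) ∂(wienerMeasure i h))) := by
      refine tendsto_integral_of_dominated_convergence (fun _ => 1) (fun n => ?_)
        (integrable_const _) (fun n => ae_of_all _ fun ω => ?_) ?_
      · exact (by fun_prop : Measurable _).aestronglyMeasurable
      · rw [mul_comm, Complex.norm_exp_ofReal_mul_I]
      · filter_upwards [hlim] with x hx
        have hc : Continuous fun t : ℝ => Complex.exp (Complex.I * (t : ℂ)) := by fun_prop
        exact (hc.tendsto _).comp hx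
    have t2 : Tendsto (fun n => ((Real.exp (-h * ‖v n‖ ^ 2 / 2) : ℝ) : ℂ)) atTop
        (𝓝 ((Real.exp (-h * ‖u‖ ^ 2 / 2) : ℝ) : ℂ)) := by
      have hc : Continuous fun w : H => ((Real.exp (-h * ‖w‖ ^ 2 / 2) : ℝ) : ℂ) := by fun_prop
      exact (hc.tendsto _).comp hvu
    refine tendsto_nhds_unique t1 (t2.congr fun n => ?_)
    exact (integral_cexp_wienerMeasure hi hh (represents_functional (hv n))).symm

end Ell

/-! ### Cameron-Martin shifts and convolution -/

section CameronMartin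

/-- Both sides have the same characteristic functional: on the right it is a complex moment `E
exp(ℓ_{y/h} + i ℓ_e)`, whose cross term `i⟪y, e⟫` is the phase produced by the translation. -/
lemma map_add_wienerMeasure (hi : IsAbstractWiener i) {h : ℝ} (hh : 0 < h) (y : H) :
    (wienerMeasure i h).map (fun x => x + i y) = (wienerMeasure i h).withDensity fun x =>
      ENNReal.ofReal (Real.exp (h⁻¹ * ell i h y x - ‖y‖ ^ 2 / (2 * h))) := by
  have := isProbabilityMeasure_wienerMeasure hi hh
  have := secondCountableTopology_of_isAbstractWiener hi
  have hI := isIsonormal_ell hi hh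
  have hm := measurable_ell hi hh y
  have hint : Integrable (fun x => Real.exp (h⁻¹ * ell i h y x - ‖y‖ ^ 2 / (2 * h)))
      (wienerMeasure i h) := by
    simp_rw [Real.exp_sub]
    exact (hI.integrable_exp_mul hh h⁻¹ y).div_const _
  have : IsFiniteMeasure ((wienerMeasure i h).withDensity fun x =>
      ENNReal.ofReal (Real.exp (h⁻¹ * ell i h y x - ‖y‖ ^ 2 / (2 * h)))) :=
    isFiniteMeasure_withDensity_ofReal hint.2
  have : IsProbabilityMeasure ((wienerMeasure i h).map (fun x => x + i y)) :=
    Measure.isProbabilityMeasure_map (by fun_prop)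
  refine Measure.ext_of_charFunDual (funext fun L => ?_)
  have hL := represents_dualRepr i L
  set e := dualRepr i L
  rw [charFunDual_map_add_const, charFunDual_apply, charFunDual_apply,
    integral_withDensity_eq_integral_toReal_smul (by fun_prop)
      (ae_of_all _ fun x => ENNReal.ofReal_lt_top)]
  have e1 := integral_cexp_wienerMeasure hi hh hL
  simp_rw [mul_comm Complex.I] at e1
  rw [e1]
  have e2 := hI.integral_cexp_add_I_mul hh (h⁻¹ • y) e
  have e3 : ∫ x, (ENNReal.ofReal (Real.exp (h⁻¹ * ell i h y x - ‖y‖ ^ 2 / (2 * h)))).toReal •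
      Complex.exp (((L x : ℝ) : ℂ) * Complex.I) ∂(wienerMeasure i h) =
      Complex.exp (-(‖y‖ ^ 2 / (2 * h) : ℝ)) * ∫ x, Complex.exp
        ((ell i h (h⁻¹ • y) x : ℂ) + Complex.I * (ell i h e x : ℂ)) ∂(wienerMeasure i h) := by
    rw [← integral_const_mul]
    refine integral_congr_ae ?_
    filter_upwards [ell_ae_eq_functional hi hh ⟨L, hL⟩, hI.smul h⁻¹ y] with x h1 h2
    rw [h1, h2, hL.functional_eq hi, ENNReal.toReal_ofReal (Real.exp_nonneg _),
      Complex.real_smul, Complex.ofReal_exp, ← Complex.exp_add, ← Complex.exp_add]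
    congr 1
    push_cast; ring
  rw [e3, e2, hL y, Complex.ofReal_exp, ← Complex.exp_add, ← Complex.exp_add]
  congr 1
  rw [norm_smul, mul_pow, real_inner_smul_left, Real.norm_eq_abs, sq_abs, real_inner_comm]
  have hh' : (h : ℂ) ≠ 0 := by exact_mod_cast hh.ne'
  push_cast
  field_simp
  ring

/-- Translations by vectors of `H` respect null sets, so almost everywhere identities between
versions may be evaluated at shifted points. -/
lemma quasiMeasurePreserving_add (hi : IsAbstractWiener i) {h : ℝ} (hh : 0 < h) (y : H) :
    Measure.QuasiMeasurePreserving (fun x => x + i y) (wienerMeasure i h) (wienerMeasure i h) := by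
  refine ⟨by fun_prop, ?_⟩
  rw [map_add_wienerMeasure hi hh y]
  exact withDensity_absolutelyContinuous _ _

/-- Exact for functionals in `B'`. The approximating sequence converges almost everywhere at `x`,
and also at `x + i y` by quasi-invariance. -/
lemma ell_add_ae_eq (hi : IsAbstractWiener i) {h : ℝ} (hh : 0 < h) (u y : H) :
    ∀ᵐ x ∂(wienerMeasure i h), ell i h u (x + i y) = ell i h u x + ⟪u, y⟫ := by
  obtain ⟨v, hv, hvu, hlim⟩ := exists_seq_tendsto_ell hi hh u
  filter_upwards [hlim, (quasiMeasurePreserving_add hi hh y).ae hlim] with x h1 h2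
  refine tendsto_nhds_unique h2 ?_
  have h3 : ∀ n, functional i (v n) (x + i y) = functional i (v n) x + ⟪v n, y⟫ := fun n => by
    rw [map_add, represents_functional (hv n) y]
  simp_rw [h3]
  exact h1.add (hvu.inner tendsto_const_nhds)

lemma map_add_prod_wienerMeasure (hi : IsAbstractWiener i) {s t : ℝ} (hs : 0 < s) (ht : 0 < t) :
    ((wienerMeasure i s).prod (wienerMeasure i t)).map (fun p => p.1 + p.2) =
      wienerMeasure i (s + t) := by
  have := isProbabilityMeasure_wienerMeasure hi hs
  have := isProbabilityMeasure_wienerMeasure hi ht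
  have := isProbabilityMeasure_wienerMeasure hi (add_pos hs ht)
  have := secondCountableTopology_of_isAbstractWiener hi
  change (wienerMeasure i s).conv (wienerMeasure i t) = _
  refine Measure.ext_of_charFunDual (funext fun L => ?_)
  have hL := represents_dualRepr i L
  have e := fun {r : ℝ} (hr : 0 < r) => integral_cexp_wienerMeasure hi hr hL
  simp_rw [mul_comm Complex.I] at e
  rw [charFunDual_conv, charFunDual_apply, charFunDual_apply, charFunDual_apply, e hs, e ht,
    e (add_pos hs ht), ← Complex.ofReal_mul, ← Real.exp_add]
  congr 2
  ring

end CameronMartin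

/-! ### The process on `B²` -/

section Product

lemma isProbabilityMeasure_wienerMeasure2 (hi : IsAbstractWiener i) {h : ℝ} (hh : 0 < h) :
    IsProbabilityMeasure (wienerMeasure2 i h) := by
  have := isProbabilityMeasure_wienerMeasure hi hh
  unfold wienerMeasure2
  infer_instance

lemma isIsonormal_ell2 (hi : IsAbstractWiener i) {h : ℝ} (hh : 0 < h) :
    IsIsonormal (wienerMeasure2 i h) h (ell2 i h) := by
  have := isProbabilityMeasure_wienerMeasure hi hh
  have hI := isIsonormal_ell hi hh
  have q1 : Measure.QuasiMeasurePreserving Prod.fst (wienerMeasure2 i h) (wienerMeasure i h) :=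
    Measure.quasiMeasurePreserving_fst
  have q2 : Measure.QuasiMeasurePreserving Prod.snd (wienerMeasure2 i h) (wienerMeasure i h) :=
    Measure.quasiMeasurePreserving_snd
  refine ⟨fun u => ?_, fun u v => ?_, fun r u => ?_, fun u => ?_⟩
  · have m1 := measurable_ell hi hh u.fst
    have m2 := measurable_ell hi hh u.snd
    unfold ell2
    fun_prop
  · filter_upwards [q1.ae (hI.add u.fst v.fst), q2.ae (hI.add u.snd v.snd)] with Z h1 h2
    simp only [ell2, WithLp.add_fst, WithLp.add_snd, h1, h2]
    ring
  · filter_upwards [q1.ae (hI.smul r u.fst), q2.ae (hI.smul r u.snd)] with Z h1 h2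
    simp only [ell2, WithLp.smul_fst, WithLp.smul_snd, h1, h2]
    ring
  · have e : ∀ Z : B × B, Complex.exp (Complex.I * ((ell2 i h u Z : ℝ) : ℂ)) =
        Complex.exp (Complex.I * ((ell i h u.fst Z.1 : ℝ) : ℂ)) *
          Complex.exp (Complex.I * ((ell i h u.snd Z.2 : ℝ) : ℂ)) := fun Z => by
      rw [← Complex.exp_add, ell2]
      congr 1
      push_cast; ring
    simp_rw [e]
    rw [wienerMeasure2, integral_prod_mul
      (fun x => Complex.exp (Complex.I * ((ell i h u.fst x : ℝ) : ℂ)))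
      (fun x => Complex.exp (Complex.I * ((ell i h u.snd x : ℝ) : ℂ))), hI.integral_cexp,
      hI.integral_cexp, ← Complex.ofReal_mul, ← Real.exp_add, WithLp.prod_norm_sq_eq_of_L2]
    congr 2
    ring

lemma quasiMeasurePreserving_add2 (hi : IsAbstractWiener i) {h : ℝ} (hh : 0 < h) (Y : H × H) :
    Measure.QuasiMeasurePreserving (fun Z : B × B => Z + (i Y.1, i Y.2)) (wienerMeasure2 i h)
      (wienerMeasure2 i h) := by
  have := isProbabilityMeasure_wienerMeasure hi hh
  have := secondCountableTopology_of_isAbstractWiener hi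
  have q1 := quasiMeasurePreserving_add hi hh Y.1
  have q2 := quasiMeasurePreserving_add hi hh Y.2
  refine ⟨by fun_prop, ?_⟩
  have e : (fun Z : B × B => Z + (i Y.1, i Y.2)) =
      Prod.map (fun x => x + i Y.1) (fun x => x + i Y.2) := by
    ext Z <;> simp
  rw [e, wienerMeasure2, ← Measure.map_prod_map _ _ q1.measurable q2.measurable]
  exact q1.absolutelyContinuous.prod q2.absolutelyContinuous

lemma ell2_add_ae_eq (hi : IsAbstractWiener i) {h : ℝ} (hh : 0 < h) (W : WithLp 2 (H × H))
    (Y : H × H) : ∀ᵐ Z ∂(wienerMeasure2 i h),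
      ell2 i h W (Z + (i Y.1, i Y.2)) = ell2 i h W Z + ⟪W, WithLp.toLp 2 Y⟫ := by
  have := isProbabilityMeasure_wienerMeasure hi hh
  have q1 : Measure.QuasiMeasurePreserving Prod.fst (wienerMeasure2 i h) (wienerMeasure i h) :=
    Measure.quasiMeasurePreserving_fst
  have q2 : Measure.QuasiMeasurePreserving Prod.snd (wienerMeasure2 i h) (wienerMeasure i h) :=
    Measure.quasiMeasurePreserving_snd
  filter_upwards [q1.ae (ell_add_ae_eq hi hh W.fst Y.1), q2.ae (ell_add_ae_eq hi hh W.snd Y.2)]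
    with Z h1 h2
  simp only [ell2, Prod.fst_add, Prod.snd_add, h1, h2, WithLp.prod_inner_apply]
  change _ = _ + (⟪W.fst, Y.1⟫ + ⟪W.snd, Y.2⟫)
  ring

end Product

end WienerWeyl

namespace WienerWeyl

open LineDeriv FourierTransform

/-! ### The Wigner transform of Schwartz functions -/

section Wigner

variable {E : Type*} [NormedAddCommGroup E] [InnerProductSpace ℝ E] [FiniteDimensional ℝ E]
  [MeasurableSpace E] [BorelSpace E]

/-- The Schwartz function `t ↦ s(z + t) conj(r(z - t))`. -/
noncomputable def crossCorr (s r : 𝓢(E, ℂ)) (z : E) : 𝓢(E, ℂ) :=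
  SchwartzMap.pairing (ContinuousLinearMap.mul ℂ ℂ) (SchwartzMap.compSubConstCLM ℂ (-z) s)
    (SchwartzMap.compSubConstCLM ℂ z (SchwartzMap.compCLMOfContinuousLinearEquiv ℂ
      (ContinuousLinearEquiv.neg ℝ)
      (SchwartzMap.postcompCLM (𝕜 := ℝ) (Complex.conjCLE : ℂ →L[ℝ] ℂ) r)))

lemma crossCorr_apply (s r : 𝓢(E, ℂ)) (z t : E) :
    crossCorr s r z t = s (z + t) * conj (r (z - t)) := by
  simp [crossCorr, SchwartzMap.compCLMOfContinuousLinearEquiv_apply, add_comm]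

/-- The Wigner transform `∫ exp(-(2i/h) ζ·t) s(z + t) conj(r(z - t)) dt`. -/
noncomputable def wignerTransform (h : ℝ) (s r : 𝓢(E, ℂ)) (z ζ : E) : ℂ :=
  ∫ t, Complex.exp (-(2 * Complex.I / (h : ℂ)) * ((⟪ζ, t⟫ : ℝ) : ℂ)) *
    (s (z + t) * conj (r (z - t)))

/-- The frequency `ζ / (πh)` turns `2π` into `2/h`. Fourier inversion and the rule for derivatives
become available in the variable `ζ`. -/
lemma wignerTransform_eq_fourier {h : ℝ} (hh : 0 < h) (s r : 𝓢(E, ℂ)) (z ζ : E) :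
    wignerTransform h s r z ζ = 𝓕 (crossCorr s r z) ((Real.pi * h)⁻¹ • ζ) := by
  rw [SchwartzMap.fourier_coe, Real.fourier_eq', wignerTransform]
  refine integral_congr_ae (ae_of_all _ fun t => ?_)
  simp only [crossCorr_apply, smul_eq_mul]
  congr 2
  rw [real_inner_smul_right, real_inner_comm]
  have h1 : (h : ℂ) ≠ 0 := by exact_mod_cast hh.ne'
  have h2 : (Real.pi : ℂ) ≠ 0 := by exact_mod_cast Real.pi_ne_zero
  push_cast
  field_simp

/-- Bound `s` by its supremum and `r` by its `L¹` norm, which is unchanged under `t ↦ z - t`. -/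
lemma norm_wignerTransform_le (h : ℝ) (s r : 𝓢(E, ℂ)) :
    ∃ C, ∀ z ζ, ‖wignerTransform h s r z ζ‖ ≤ C := by
  refine ⟨(SchwartzMap.seminorm ℝ 0 0 s) * ∫ t, ‖r t‖, fun z ζ => ?_⟩
  have h1 : ∀ t, ‖Complex.exp (-(2 * Complex.I / (h : ℂ)) * ((⟪ζ, t⟫ : ℝ) : ℂ))‖ = 1 := by
    intro t
    rw [Complex.norm_exp]
    have : (-(2 * Complex.I / (h : ℂ)) * ((⟪ζ, t⟫ : ℝ) : ℂ)) =
        ((-(2 / h) * ⟪ζ, t⟫ : ℝ) : ℂ) * Complex.I := by push_cast; ring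
    rw [this]
    simp
  refine (norm_integral_le_integral_norm _).trans ?_
  have e : ∫ t, ‖r t‖ = ∫ t, ‖r (z - t)‖ := (integral_sub_left_eq_self (fun t => ‖r t‖) _ z).symm
  rw [e, ← integral_const_mul]
  refine integral_mono_of_nonneg (ae_of_all _ fun t => norm_nonneg _) ?_ (ae_of_all _ fun t => ?_)
  · exact (r.integrable.norm.comp_sub_left z).const_mul _
  · simp only [norm_mul, h1, one_mul, RCLike.norm_conj]
    exact mul_le_mul_of_nonneg_right (s.norm_le_seminorm ℝ _) (norm_nonneg _)

/-- Multiplication of a Schwartz function by the linear form `x ↦ a·x`. -/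
noncomputable def coordMul (a : E) : 𝓢(E, ℂ) →L[ℝ] 𝓢(E, ℂ) :=
  SchwartzMap.smulLeftCLM ℂ fun x : E => inner ℝ x a

lemma coordMul_apply (a : E) (s : 𝓢(E, ℂ)) (x : E) :
    coordMul a s x = ((⟪a, x⟫ : ℝ) : ℂ) * s x := by
  rw [coordMul, SchwartzMap.smulLeftCLM_apply_apply (by fun_prop), Complex.real_smul,
    real_inner_comm]

lemma integrable_wigner_integrand (h : ℝ) (s r : 𝓢(E, ℂ)) (z ζ : E) :
    Integrable fun t => Complex.exp (-(2 * Complex.I / (h : ℂ)) * ((⟪ζ, t⟫ : ℝ) : ℂ)) *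
      (s (z + t) * conj (r (z - t))) := by
  have h0 := (crossCorr s r z).integrable (μ := volume)
  have hs := s.continuous
  have hr := r.continuous
  refine h0.norm.mono' (by fun_prop) (ae_of_all _ fun t => ?_)
  rw [crossCorr_apply]
  rw [norm_mul, Complex.norm_exp]
  have : (-(2 * Complex.I / (h : ℂ)) * ((⟪ζ, t⟫ : ℝ) : ℂ)) =
      ((-(2 / h) * ⟪ζ, t⟫ : ℝ) : ℂ) * Complex.I := by push_cast; ring
  rw [this]
  simp

/-- `a·z` is the half-sum of `a·(z + t)` and `a·(z - t)`, and each term is absorbed by one of the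
two functions. -/
lemma inner_mul_wignerTransform_left (h : ℝ) (s r : 𝓢(E, ℂ)) (a z ζ : E) :
    ((⟪a, z⟫ : ℝ) : ℂ) * wignerTransform h s r z ζ =
      (wignerTransform h (coordMul a s) r z ζ + wignerTransform h s (coordMul a r) z ζ) / 2 := by
  simp only [wignerTransform]
  rw [← integral_add (integrable_wigner_integrand h _ r z ζ)
    (integrable_wigner_integrand h s _ z ζ), ← integral_div, ← integral_const_mul]
  refine integral_congr_ae (ae_of_all _ fun t => ?_)
  simp only [coordMul_apply, map_mul, Complex.conj_ofReal, inner_add_right, inner_sub_right]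
  push_cast
  ring

lemma lineDeriv_crossCorr (s r : 𝓢(E, ℂ)) (z b : E) :
    ∂_{b} (crossCorr s r z) = crossCorr (∂_{b} s) r z - crossCorr s (∂_{b} r) z := by
  ext t
  have h1 : HasFDerivAt (fun t => s (z + t)) (fderiv ℝ s (z + t)) t := by
    have h := (s.hasFDerivAt (z + t)).comp t ((hasFDerivAt_id t).const_add z)
    rw [ContinuousLinearMap.comp_id] at h
    exact h
  have h2 : HasFDerivAt (fun t => conj (r (z - t)))
      (-((Complex.conjCLE : ℂ →L[ℝ] ℂ) ∘L fderiv ℝ r (z - t))) t := by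
    have h3 : HasFDerivAt (fun t => r (z - t)) (-(fderiv ℝ r (z - t))) t := by
      have h := (r.hasFDerivAt (z - t)).comp t ((hasFDerivAt_id t).const_sub z)
      rw [ContinuousLinearMap.comp_neg, ContinuousLinearMap.comp_id] at h
      exact h
    have h4 := (Complex.conjCLE : ℂ →L[ℝ] ℂ).hasFDerivAt.comp t h3
    rw [ContinuousLinearMap.comp_neg] at h4
    exact h4
  have h5 : HasFDerivAt (crossCorr s r z) _ t :=
    (h1.mul h2).congr_of_eventuallyEq (Eventually.of_forall fun t => crossCorr_apply s r z t)
  rw [SchwartzMap.lineDerivOp_apply_eq_fderiv, h5.fderiv, sub_apply,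
    crossCorr_apply, crossCorr_apply, SchwartzMap.lineDerivOp_apply_eq_fderiv,
    SchwartzMap.lineDerivOp_apply_eq_fderiv]
  simp
  ring

/-- Multiplication by the frequency is a `t`-derivative of `s(z + t) conj(r(z - t))`; the minus sign
comes from `z - t`. -/
lemma inner_mul_wignerTransform_right {h : ℝ} (hh : 0 < h) (s r : 𝓢(E, ℂ)) (b z ζ : E) :
    ((⟪b, ζ⟫ : ℝ) : ℂ) * wignerTransform h s r z ζ = (h : ℂ) / (2 * Complex.I) *
      (wignerTransform h (∂_{b} s) r z ζ - wignerTransform h s (∂_{b} r) z ζ) := by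
  simp only [wignerTransform_eq_fourier hh]
  have h1 := congrArg (fun f : 𝓢(E, ℂ) => f ((Real.pi * h)⁻¹ • ζ))
    (SchwartzMap.fourier_lineDerivOp_eq (crossCorr s r z) b)
  simp only [smul_apply] at h1
  rw [SchwartzMap.smulLeftCLM_apply_apply (by fun_prop), lineDeriv_crossCorr] at h1
  rw [sub_eq_add_neg, FourierAdd.fourier_add, FourierTransform.fourier_neg, ← sub_eq_add_neg,
    sub_apply] at h1
  rw [h1, real_inner_smul_left, real_inner_comm]
  have h1 : (h : ℂ) ≠ 0 := by exact_mod_cast hh.ne'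
  have h2 : (Real.pi : ℂ) ≠ 0 := by exact_mod_cast Real.pi_ne_zero
  have h3 := Complex.I_ne_zero
  rw [Complex.real_smul, smul_eq_mul]
  push_cast
  field_simp

lemma norm_le_sum_abs_inner (z : E) : ‖z‖ ≤ ∑ j, |⟪stdOrthonormalBasis ℝ E j, z⟫| := by
  conv_lhs => rw [← (stdOrthonormalBasis ℝ E).sum_repr' z]
  refine (norm_sum_le _ _).trans (Finset.sum_le_sum fun j _ => ?_)
  rw [norm_smul, OrthonormalBasis.norm_eq_one, mul_one, Real.norm_eq_abs]

/-- Each factor `z` or `ζ` is exchanged for a Wigner transform of other Schwartz functions, so the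
bound must be quantified over all `s` and `r` for the induction to close. -/
lemma pow_mul_wignerTransform_le {h : ℝ} (hh : 0 < h) (N M : ℕ) :
    ∀ s r : 𝓢(E, ℂ), ∃ C, ∀ z ζ, ‖z‖ ^ N * ‖ζ‖ ^ M * ‖wignerTransform h s r z ζ‖ ≤ C := by
  induction M with
  | zero =>
    induction N with
    | zero => simpa using norm_wignerTransform_le h
    | succ N ih =>
      intro s r
      choose C hC using ih
      refine ⟨∑ j, (C (coordMul (stdOrthonormalBasis ℝ E j) s) r +
        C s (coordMul (stdOrthonormalBasis ℝ E j) r)) / 2, fun z ζ => ?_⟩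
      calc ‖z‖ ^ (N + 1) * ‖ζ‖ ^ 0 * ‖wignerTransform h s r z ζ‖
          ≤ ‖z‖ ^ N * (∑ j, |⟪stdOrthonormalBasis ℝ E j, z⟫|) * ‖ζ‖ ^ 0 *
            ‖wignerTransform h s r z ζ‖ := by
            rw [pow_succ]; gcongr; exact norm_le_sum_abs_inner z
        _ = ∑ j, ‖z‖ ^ N * ‖ζ‖ ^ 0 *
            ‖((⟪stdOrthonormalBasis ℝ E j, z⟫ : ℝ) : ℂ) * wignerTransform h s r z ζ‖ := by
            rw [Finset.mul_sum, Finset.sum_mul, Finset.sum_mul]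
            refine Finset.sum_congr rfl fun j _ => ?_
            rw [norm_mul, Complex.norm_real, Real.norm_eq_abs]; ring
        _ ≤ _ := by
            refine Finset.sum_le_sum fun j _ => ?_
            rw [inner_mul_wignerTransform_left, norm_div, RCLike.norm_ofNat, mul_div_assoc']
            gcongr
            refine (mul_le_mul_of_nonneg_left (norm_add_le _ _) (by positivity)).trans ?_
            rw [mul_add]
            exact add_le_add (hC _ _ z ζ) (hC _ _ z ζ)
  | succ M ih =>
    intro s r
    choose C hC using ih
    refine ⟨∑ j, (h / 2) * (C (∂_{stdOrthonormalBasis ℝ E j} s) r +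
        C s (∂_{stdOrthonormalBasis ℝ E j} r)), fun z ζ => ?_⟩
    calc ‖z‖ ^ N * ‖ζ‖ ^ (M + 1) * ‖wignerTransform h s r z ζ‖
          ≤ ‖z‖ ^ N * (‖ζ‖ ^ M * (∑ j, |⟪stdOrthonormalBasis ℝ E j, ζ⟫|)) *
            ‖wignerTransform h s r z ζ‖ := by
            rw [pow_succ]; gcongr; exact norm_le_sum_abs_inner ζ
        _ = ∑ j, ‖z‖ ^ N * ‖ζ‖ ^ M *
            ‖((⟪stdOrthonormalBasis ℝ E j, ζ⟫ : ℝ) : ℂ) * wignerTransform h s r z ζ‖ := by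
            rw [Finset.mul_sum, Finset.mul_sum, Finset.sum_mul]
            refine Finset.sum_congr rfl fun j _ => ?_
            rw [norm_mul, Complex.norm_real, Real.norm_eq_abs]; ring
        _ ≤ _ := by
            refine Finset.sum_le_sum fun j _ => ?_
            have e : ‖(h : ℂ) / (2 * Complex.I)‖ = h / 2 := by
              simp [abs_of_pos hh]
            rw [inner_mul_wignerTransform_right hh, norm_mul, e, mul_left_comm]
            gcongr
            refine (mul_le_mul_of_nonneg_left (norm_sub_le _ _) (by positivity)).trans ?_
            rw [mul_add]
            exact add_le_add (hC _ _ z ζ) (hC _ _ z ζ)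

lemma stronglyMeasurable_wignerTransform (h : ℝ) (s r : 𝓢(E, ℂ)) :
    StronglyMeasurable fun p : E × E => wignerTransform h s r p.1 p.2 := by
  unfold wignerTransform
  have hs := s.continuous
  have hr := r.continuous
  have hc : Continuous fun q : (E × E) × E =>
      Complex.exp (-(2 * Complex.I / (h : ℂ)) * ((⟪q.1.2, q.2⟫ : ℝ) : ℂ)) *
      (s (q.1.1 + q.2) * conj (r (q.1.1 - q.2))) := by fun_prop
  exact hc.stronglyMeasurable.integral_prod_right'

lemma one_add_pow_le (a : ℝ) (ha : 0 ≤ a) (N : ℕ) : (1 + a) ^ N ≤ 2 ^ N * (1 + a ^ N) := by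
  rcases le_total a 1 with h | h
  · calc (1 + a) ^ N ≤ 2 ^ N := by gcongr; linarith
      _ ≤ _ := le_mul_of_one_le_right (by positivity) (by linarith [pow_nonneg ha N])
  · calc (1 + a) ^ N ≤ (2 * a) ^ N := by gcongr; linarith
      _ = 2 ^ N * a ^ N := mul_pow _ _ _
      _ ≤ _ := by gcongr; linarith

lemma integrable_wignerTransform {h : ℝ} (hh : 0 < h) (s r : 𝓢(E, ℂ)) :
    Integrable (fun p : E × E => wignerTransform h s r p.1 p.2) (volume.prod volume) := by
  -- An exponent larger than the dimension, so that `(1 + |x|)^(-N)` is integrable. The four bounds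
  -- dominate the product of the two weights.
  set N := Module.finrank ℝ E + 1 with hN
  obtain ⟨C1, h1⟩ := pow_mul_wignerTransform_le hh 0 0 s r
  obtain ⟨C2, h2⟩ := pow_mul_wignerTransform_le hh N 0 s r
  obtain ⟨C3, h3⟩ := pow_mul_wignerTransform_le hh 0 N s r
  obtain ⟨C4, h4⟩ := pow_mul_wignerTransform_le hh N N s r
  have hint : Integrable (fun x : E => (1 + ‖x‖) ^ (-(N : ℝ))) volume :=
    integrable_one_add_norm (by rw [hN]; push_cast; linarith)
  refine ((hint.mul_prod hint).const_mul (2 ^ N * 2 ^ N * (C1 + C2 + C3 + C4))).mono'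
    (stronglyMeasurable_wignerTransform h s r).aestronglyMeasurable (ae_of_all _ fun p => ?_)
  obtain ⟨z, ζ⟩ := p
  have e1 := one_add_pow_le ‖z‖ (norm_nonneg _) N
  have e2 := one_add_pow_le ‖ζ‖ (norm_nonneg _) N
  have h1 := h1 z ζ
  have h2 := h2 z ζ
  have h3 := h3 z ζ
  have h4 := h4 z ζ
  simp only [pow_zero, one_mul, mul_one] at h1 h2 h3
  rw [Real.rpow_neg (by positivity), Real.rpow_neg (by positivity), Real.rpow_natCast,
    Real.rpow_natCast, ← mul_inv, ← div_eq_mul_inv, le_div_iff₀ (by positivity)]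
  calc ‖wignerTransform h s r z ζ‖ * ((1 + ‖z‖) ^ N * (1 + ‖ζ‖) ^ N)
      ≤ ‖wignerTransform h s r z ζ‖ * ((2 ^ N * (1 + ‖z‖ ^ N)) * (2 ^ N * (1 + ‖ζ‖ ^ N))) := by
        gcongr
    _ = 2 ^ N * 2 ^ N * (‖wignerTransform h s r z ζ‖ + ‖z‖ ^ N * ‖wignerTransform h s r z ζ‖ +
        ‖ζ‖ ^ N * ‖wignerTransform h s r z ζ‖ +
        ‖z‖ ^ N * ‖ζ‖ ^ N * ‖wignerTransform h s r z ζ‖) := by ring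
    _ ≤ _ := by gcongr

/-- Fourier inversion for the Wigner transform. -/
lemma integral_cexp_mul_wignerTransform {h : ℝ} (hh : 0 < h) (s r : 𝓢(E, ℂ)) (z ξ : E) :
    ∫ ζ, Complex.exp (Complex.I * ((⟪ξ, ζ⟫ : ℝ) : ℂ)) * wignerTransform h s r z ζ =
      (((Real.pi * h) ^ Module.finrank ℝ E : ℝ) : ℂ) *
        (s (z + (h / 2) • ξ) * conj (r (z - (h / 2) • ξ))) := by
  have hp : 0 < Real.pi * h := by positivity
  have h0 : 𝓕⁻ (𝓕 (crossCorr s r z)) ((h / 2) • ξ) = crossCorr s r z ((h / 2) • ξ) := by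
    rw [FourierTransform.fourierInv_fourier_eq]
  rw [SchwartzMap.fourierInv_coe, Real.fourierInv_eq', crossCorr_apply] at h0
  rw [← h0]
  -- The dilation by `πh` undoes the frequency scaling and produces the factor `(πh)^dim`.
  have h1 := Measure.integral_comp_inv_smul volume (fun v : E =>
    Complex.exp (((2 * Real.pi * ⟪v, (h / 2) • ξ⟫ : ℝ) : ℂ) * Complex.I) •
      𝓕 (crossCorr s r z) v) (Real.pi * h)
  rw [abs_of_pos (by positivity), Complex.real_smul] at h1
  rw [← h1]
  refine integral_congr_ae (ae_of_all _ fun ζ => ?_)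
  simp only [wignerTransform_eq_fourier hh, smul_eq_mul]
  congr 2
  rw [real_inner_smul_left, real_inner_smul_right, real_inner_comm]
  have h1 : (h : ℂ) ≠ 0 := by exact_mod_cast hh.ne'
  have h2 : (Real.pi : ℂ) ≠ 0 := by exact_mod_cast Real.pi_ne_zero
  push_cast
  field_simp

lemma integral_wignerTransform {h : ℝ} (hh : 0 < h) (s r : 𝓢(E, ℂ)) (z : E) :
    ∫ ζ, wignerTransform h s r z ζ =
      (((Real.pi * h) ^ Module.finrank ℝ E : ℝ) : ℂ) * (s z * conj (r z)) := by
  simpa using integral_cexp_mul_wignerTransform hh s r z 0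

end Wigner

end WienerWeyl

namespace WienerWeyl

open LineDeriv FourierTransform

/-! ### From Gaussian to Lebesgue: finite-dimensional Weyl forms -/

section GaussianWigner

variable {E : Type*} [NormedAddCommGroup E] [InnerProductSpace ℝ E] [FiniteDimensional ℝ E]
  [MeasurableSpace E] [BorelSpace E]

/-- The normalizing constant of `gammaMap`. -/
noncomputable def gammaConst (E : Type*) [NormedAddCommGroup E] [InnerProductSpace ℝ E]
    (h : ℝ) : ℝ :=
  (Real.pi * h) ^ (-(Module.finrank ℝ E : ℝ) / 4)

lemma gammaConst_pos {h : ℝ} (hh : 0 < h) : 0 < gammaConst E h := by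
  unfold gammaConst; positivity

/-- Two Gaussian densities contribute `gammaConst ^ 4`, which cancels the factor of Fourier
inversion. -/
lemma gammaConst_pow_four_mul {h : ℝ} (hh : 0 < h) :
    gammaConst E h ^ 4 * (Real.pi * h) ^ Module.finrank ℝ E = 1 := by
  have hp : 0 < Real.pi * h := by positivity
  rw [gammaConst, ← Real.rpow_natCast, ← Real.rpow_natCast, ← Real.rpow_mul hp.le,
    ← Real.rpow_add hp]
  norm_num

/-- At parameter `h/2` the density is the square of the weight in `gammaMap`; this makes `gammaMap`
preserve scalar products. -/
lemma gaussDensity_half {h : ℝ} (hh : 0 < h) (x : E) :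
    gaussDensity E (h / 2) x = gammaConst E h ^ 2 * Real.exp (-‖x‖ ^ 2 / h) := by
  have hp : 0 < Real.pi * h := by positivity
  have e : gammaConst E h ^ 2 = (Real.pi * h) ^ (-(Module.finrank ℝ E : ℝ) / 2) := by
    rw [gammaConst, ← Real.rpow_natCast, ← Real.rpow_mul hp.le]
    congr 1
    push_cast
    ring
  rw [gaussDensity, e]
  congr 2
  · ring
  · ring

lemma gaussDensity_half_mul {h : ℝ} (hh : 0 < h) {φ ψ : E → ℂ} {s r : 𝓢(E, ℂ)}
    (hs : ∀ x, s x = gammaMap h φ x) (hr : ∀ x, r x = gammaMap h ψ x) (x : E) :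
    gaussDensity E (h / 2) x • (φ x * conj (ψ x)) = s x * conj (r x) := by
  rw [hs, hr, gaussDensity_half hh, gammaMap, gammaMap, ← gammaConst]
  have e : Real.exp (-‖x‖ ^ 2 / h) =
      Real.exp (-‖x‖ ^ 2 / (2 * h)) * Real.exp (-‖x‖ ^ 2 / (2 * h)) := by
    rw [← Real.exp_add]; congr 1; field_simp; ring
  rw [e, Complex.real_smul]
  simp only [map_mul, Complex.conj_ofReal]
  push_cast
  ring

lemma integral_mul_conj_gaussMeasure {h : ℝ} (hh : 0 < h) {φ ψ : E → ℂ} {s r : 𝓢(E, ℂ)}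
    (hs : ∀ x, s x = gammaMap h φ x) (hr : ∀ x, r x = gammaMap h ψ x) :
    ∫ x, φ x * conj (ψ x) ∂(gaussMeasure E (h / 2)) = ∫ x, s x * conj (r x) := by
  rw [integral_gaussMeasure (by positivity)]
  exact integral_congr_ae (ae_of_all _ fun x => gaussDensity_half_mul hh hs hr x)

lemma eq_of_gammaMap {h : ℝ} (hh : 0 < h) {φ : E → ℂ} {s : 𝓢(E, ℂ)}
    (hs : ∀ x, s x = gammaMap h φ x) (x : E) :
    φ x = ((gammaConst E h)⁻¹ : ℝ) * ((Real.exp (‖x‖ ^ 2 / (2 * h)) : ℝ) : ℂ) * s x := by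
  have h1 := (gammaConst_pos (E := E) hh).ne'
  rw [hs, gammaMap, ← gammaConst, neg_div, Real.exp_neg]
  have h2 := (Real.exp_pos (‖x‖ ^ 2 / (2 * h))).ne'
  have h1' : ((gammaConst E h : ℝ) : ℂ) ≠ 0 := by exact_mod_cast h1
  have h2' : ((Real.exp (‖x‖ ^ 2 / (2 * h)) : ℝ) : ℂ) ≠ 0 := by exact_mod_cast h2
  push_cast [-Complex.ofReal_exp]
  field_simp

lemma contDiff_of_mem_schwartzGauss {h : ℝ} (hh : 0 < h) {φ : E → ℂ}
    (hφ : φ ∈ schwartzGauss E h) : ContDiff ℝ 1 φ := by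
  obtain ⟨s, hs⟩ := hφ
  rw [funext (eq_of_gammaMap hh hs)]
  have h1 : ContDiff ℝ 1 (s : E → ℂ) := s.smooth 1
  have h2 : ContDiff ℝ 1 fun x : E => ((Real.exp (‖x‖ ^ 2 / (2 * h)) : ℝ) : ℂ) :=
    Complex.ofRealCLM.contDiff.comp (((contDiff_norm_sq ℝ).div_const _).exp)
  exact (contDiff_const.mul h2).mul h1

lemma memLp_of_mem_schwartzGauss {h : ℝ} (hh : 0 < h) {φ : E → ℂ}
    (hφ : φ ∈ schwartzGauss E h) : MemLp φ 2 (gaussMeasure E (h / 2)) := by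
  have hc := (contDiff_of_mem_schwartzGauss hh hφ).continuous
  obtain ⟨s, hs⟩ := hφ
  rw [memLp_two_iff_integrable_sq_norm hc.aestronglyMeasurable,
    integrable_gaussMeasure_iff (by positivity)]
  have h1 : Integrable (fun x => ‖s x‖ ^ 2) volume :=
    (memLp_two_iff_integrable_sq_norm s.continuous.aestronglyMeasurable).1 (s.memLp 2 volume)
  refine h1.congr (ae_of_all _ fun x => ?_)
  have h2 := congrArg norm (gaussDensity_half_mul hh hs hs x)
  simp only [norm_smul, norm_mul, RCLike.norm_conj, Real.norm_eq_abs,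
    abs_of_nonneg (gaussDensity_nonneg (half_pos hh) x)] at h2
  simp only [smul_eq_mul]
  rw [sq, sq, h2]

/-- The parallelogram identity `|z + t|² + |z - t|² = 2|z|² + 2|t|²` turns the Gaussian weight in
`t` into the two weights of `gammaMap`, leaving `exp(|z|²/h)`. -/
lemma wignerHat_eq {h : ℝ} (hh : 0 < h) {φ ψ : E → ℂ} {s r : 𝓢(E, ℂ)}
    (hs : ∀ x, s x = gammaMap h φ x) (hr : ∀ x, r x = gammaMap h ψ x) (z ζ : E) :
    wignerHat h φ ψ z ζ = ((Real.exp (‖z‖ ^ 2 / h) * Real.exp (‖ζ‖ ^ 2 / h) : ℝ) : ℂ) *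
      wignerTransform h s r z ζ := by
  rw [wignerHat, integral_gaussMeasure (by positivity), wignerTransform, mul_comm (Real.exp _),
    Complex.ofReal_mul, mul_assoc, ← integral_const_mul ((Real.exp (‖z‖ ^ 2 / h) : ℝ) : ℂ)]
  congr 1
  refine integral_congr_ae (ae_of_all _ fun t => ?_)
  simp only
  rw [hs, hr, gaussDensity_half hh, gammaMap, gammaMap, ← gammaConst]
  have e : Real.exp (-‖t‖ ^ 2 / h) = Real.exp (‖z‖ ^ 2 / h) *
      (Real.exp (-‖z + t‖ ^ 2 / (2 * h)) * Real.exp (-‖z - t‖ ^ 2 / (2 * h))) := by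
    rw [← Real.exp_add, ← Real.exp_add]
    congr 1
    rw [norm_add_sq_real, norm_sub_sq_real]
    field_simp
    ring
  rw [e, Complex.real_smul]
  simp only [map_mul, Complex.conj_ofReal]
  push_cast
  ring

lemma measurable_wignerHat {h : ℝ} (hh : 0 < h) {φ ψ : E → ℂ} (hφ : φ ∈ schwartzGauss E h)
    (hψ : ψ ∈ schwartzGauss E h) : Measurable fun p : E × E => wignerHat h φ ψ p.1 p.2 := by
  obtain ⟨s, hs⟩ := hφ
  obtain ⟨r, hr⟩ := hψ
  simp only [wignerHat_eq hh hs hr]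
  refine Measurable.mul (Continuous.measurable (by fun_prop))
    (stronglyMeasurable_wignerTransform h s r).measurable

lemma gaussMeasure_prod {h : ℝ} (hh : 0 < h) :
    (gaussMeasure E (h / 2)).prod (gaussMeasure E (h / 2)) =
      (volume.prod volume : Measure (E × E)).withDensity
        fun p => ENNReal.ofReal (gaussDensity E (h / 2) p.1 * gaussDensity E (h / 2) p.2) := by
  have hm : Measurable fun x : E => ENNReal.ofReal (gaussDensity E (h / 2) x) :=
    (continuous_gaussDensity (E := E) (h / 2)).measurable.ennreal_ofReal
  have h0 : gaussMeasure E (h / 2) =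
      volume.withDensity fun x => ENNReal.ofReal (gaussDensity E (h / 2) x) := rfl
  rw [h0, prod_withDensity hm hm]
  simp only [ENNReal.ofReal_mul (gaussDensity_nonneg (half_pos hh) _)]

/-- The densities of `μ_{E,h/2}` in `z` and `ζ` cancel the growing exponentials, so Gaussian
integrals of the Wigner-Gauss function are Lebesgue integrals of a rapidly decreasing function. -/
lemma density_smul_wignerHat {h : ℝ} (hh : 0 < h) {φ ψ : E → ℂ} {s r : 𝓢(E, ℂ)}
    (hs : ∀ x, s x = gammaMap h φ x) (hr : ∀ x, r x = gammaMap h ψ x) (Φ : E × E → ℂ)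
    (p : E × E) :
    (gaussDensity E (h / 2) p.1 * gaussDensity E (h / 2) p.2) •
        (Φ p * wignerHat h φ ψ p.1 p.2) =
      ((gammaConst E h ^ 4 : ℝ) : ℂ) * (Φ p * wignerTransform h s r p.1 p.2) := by
  rw [wignerHat_eq hh hs hr, gaussDensity_half hh, gaussDensity_half hh, Complex.real_smul,
    neg_div, neg_div, Real.exp_neg, Real.exp_neg]
  have h1 := (Real.exp_pos (‖p.1‖ ^ 2 / h)).ne'
  have h2 := (Real.exp_pos (‖p.2‖ ^ 2 / h)).ne'
  have h1' : ((Real.exp (‖p.1‖ ^ 2 / h) : ℝ) : ℂ) ≠ 0 := by exact_mod_cast h1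
  have h2' : ((Real.exp (‖p.2‖ ^ 2 / h) : ℝ) : ℂ) ≠ 0 := by exact_mod_cast h2
  push_cast [-Complex.ofReal_exp]
  field_simp

lemma integrable_mul_wignerHat_iff {h : ℝ} (hh : 0 < h) {φ ψ : E → ℂ} {s r : 𝓢(E, ℂ)}
    (hs : ∀ x, s x = gammaMap h φ x) (hr : ∀ x, r x = gammaMap h ψ x) (Φ : E × E → ℂ) :
    Integrable (fun p => Φ p * wignerHat h φ ψ p.1 p.2)
        ((gaussMeasure E (h / 2)).prod (gaussMeasure E (h / 2))) ↔
      Integrable (fun p => Φ p * wignerTransform h s r p.1 p.2)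
        (volume.prod volume : Measure (E × E)) := by
  rw [gaussMeasure_prod hh, integrable_withDensity_iff_integrable_smul₀'
    (by
      have := continuous_gaussDensity (E := E) (h / 2)
      exact (Continuous.measurable (by fun_prop)).ennreal_ofReal.aemeasurable) (ae_of_all _ fun _ => ENNReal.ofReal_lt_top)]
  have e : (fun p : E × E => (ENNReal.ofReal (gaussDensity E (h / 2) p.1 *
      gaussDensity E (h / 2) p.2)).toReal • (Φ p * wignerHat h φ ψ p.1 p.2)) =
      fun p => ((gammaConst E h ^ 4 : ℝ) : ℂ) * (Φ p * wignerTransform h s r p.1 p.2) := by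
    funext p
    rw [ENNReal.toReal_ofReal (mul_nonneg (gaussDensity_nonneg (half_pos hh) _)
      (gaussDensity_nonneg (half_pos hh) _)), density_smul_wignerHat hh hs hr]
  rw [e, integrable_const_mul_iff]
  exact IsUnit.mk0 _ (by exact_mod_cast (pow_pos (gammaConst_pos (E := E) hh) 4).ne')

lemma integral_mul_wignerHat {h : ℝ} (hh : 0 < h) {φ ψ : E → ℂ} {s r : 𝓢(E, ℂ)}
    (hs : ∀ x, s x = gammaMap h φ x) (hr : ∀ x, r x = gammaMap h ψ x) (Φ : E × E → ℂ) :
    ∫ p, Φ p * wignerHat h φ ψ p.1 p.2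
        ∂((gaussMeasure E (h / 2)).prod (gaussMeasure E (h / 2))) =
      ((gammaConst E h ^ 4 : ℝ) : ℂ) *
        ∫ p, Φ p * wignerTransform h s r p.1 p.2 ∂(volume.prod volume : Measure (E × E)) := by
  have hc := continuous_gaussDensity (E := E) (h / 2)
  rw [gaussMeasure_prod hh, integral_withDensity_eq_integral_toReal_smul
    (Continuous.measurable (by fun_prop)).ennreal_ofReal
    (ae_of_all _ fun _ => ENNReal.ofReal_lt_top), ← integral_const_mul]
  refine integral_congr_ae (ae_of_all _ fun p => ?_)
  simp only
  rw [ENNReal.toReal_ofReal (mul_nonneg (gaussDensity_nonneg (half_pos hh) _)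
      (gaussDensity_nonneg (half_pos hh) _)), density_smul_wignerHat hh hs hr]

lemma integrable_wignerHat {h : ℝ} (hh : 0 < h) {φ ψ : E → ℂ} (hφ : φ ∈ schwartzGauss E h)
    (hψ : ψ ∈ schwartzGauss E h) : Integrable (fun p : E × E => wignerHat h φ ψ p.1 p.2)
      ((gaussMeasure E (h / 2)).prod (gaussMeasure E (h / 2))) := by
  obtain ⟨s, hs⟩ := hφ
  obtain ⟨r, hr⟩ := hψ
  have h1 := (integrable_mul_wignerHat_iff hh hs hr fun _ => 1).2
    (by simpa using integrable_wignerTransform hh s r)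
  simpa using h1

lemma integrable_linear_mul_wignerTransform {h : ℝ} (hh : 0 < h) (s r : 𝓢(E, ℂ)) (a b : E) :
    Integrable (fun p : E × E => ((⟪a, p.1⟫ : ℝ) : ℂ) * wignerTransform h s r p.1 p.2)
        (volume.prod volume) ∧
      Integrable (fun p : E × E => ((⟪b, p.2⟫ : ℝ) : ℂ) * wignerTransform h s r p.1 p.2)
        (volume.prod volume) := by
  simp only [inner_mul_wignerTransform_left, inner_mul_wignerTransform_right hh]
  exact ⟨((integrable_wignerTransform hh _ _).add (integrable_wignerTransform hh _ _)).div_const _,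
    ((integrable_wignerTransform hh _ _).sub (integrable_wignerTransform hh _ _)).const_mul _⟩

lemma integral_lineDeriv_mul_conj (s r : 𝓢(E, ℂ)) (b : E) :
    ∫ x, s x * conj (∂_{b} r x) = -∫ x, ∂_{b} s x * conj (r x) := by
  set r' := SchwartzMap.postcompCLM (𝕜 := ℝ) (Complex.conjCLE : ℂ →L[ℝ] ℂ) r
  have h1 : ∀ x, ∂_{b} r' x = conj (∂_{b} r x) := by
    intro x
    have h2 : HasFDerivAt r' ((Complex.conjCLE : ℂ →L[ℝ] ℂ) ∘L fderiv ℝ r x) x :=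
      (Complex.conjCLE : ℂ →L[ℝ] ℂ).hasFDerivAt.comp x (r.hasFDerivAt x)
    rw [SchwartzMap.lineDerivOp_apply_eq_fderiv, h2.fderiv,
      SchwartzMap.lineDerivOp_apply_eq_fderiv]
    simp
  simp only [← h1]
  exact SchwartzMap.integral_mul_lineDerivOp_right_eq_neg_left s r' b

lemma integrable_schwartz_mul_conj (s r : 𝓢(E, ℂ)) : Integrable fun x => s x * conj (r x) := by
  have hs := s.memLp 2 volume
  have hr := r.memLp 2 volume
  exact hs.integrable_mul (hr.star)

/-- The Weyl form of a linear symbol in finite dimension, in terms of Schwartz functions. -/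
lemma integral_linear_mul_wignerTransform {h : ℝ} (hh : 0 < h) (s r : 𝓢(E, ℂ)) (a b : E) :
    ((gammaConst E h ^ 4 : ℝ) : ℂ) * ∫ p : E × E,
        ((⟪a, p.1⟫ + ⟪b, p.2⟫ : ℝ) : ℂ) * wignerTransform h s r p.1 p.2 ∂(volume.prod volume) =
      ∫ x, (((⟪a, x⟫ : ℝ) : ℂ) * s x + (h : ℂ) / Complex.I * ∂_{b} s x) * conj (r x) := by
  obtain ⟨i1, i2⟩ := integrable_linear_mul_wignerTransform hh s r a b
  have hD : ((gammaConst E h ^ 4 : ℝ) : ℂ) * (((Real.pi * h) ^ Module.finrank ℝ E : ℝ) : ℂ) = 1 := by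
    rw [← Complex.ofReal_mul, gammaConst_pow_four_mul hh, Complex.ofReal_one]
  have hV : ∀ s r : 𝓢(E, ℂ), ∫ p : E × E, wignerTransform h s r p.1 p.2 ∂(volume.prod volume) =
      (((Real.pi * h) ^ Module.finrank ℝ E : ℝ) : ℂ) * ∫ x, s x * conj (r x) := by
    intro s r
    rw [integral_prod _ (integrable_wignerTransform hh s r), ← integral_const_mul]
    simp only [integral_wignerTransform hh]
  have e1 : ∀ p : E × E, ((⟪a, p.1⟫ + ⟪b, p.2⟫ : ℝ) : ℂ) * wignerTransform h s r p.1 p.2 =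
      ((⟪a, p.1⟫ : ℝ) : ℂ) * wignerTransform h s r p.1 p.2 +
      ((⟪b, p.2⟫ : ℝ) : ℂ) * wignerTransform h s r p.1 p.2 := by
    intro p; push_cast; ring
  simp only [e1]
  rw [integral_add i1 i2]
  simp only [inner_mul_wignerTransform_left, inner_mul_wignerTransform_right hh]
  rw [integral_div, integral_add (integrable_wignerTransform hh _ _)
    (integrable_wignerTransform hh _ _), integral_const_mul,
    integral_sub (integrable_wignerTransform hh _ _) (integrable_wignerTransform hh _ _)]
  simp only [hV]
  -- Integration by parts makes the two derivative terms equal; the two halves coming from `a·z` are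
  -- equal by symmetry of a real multiplier (`e3`). Both halves of the form are thus doubled.
  rw [integral_lineDeriv_mul_conj]
  have e2 : ∀ x, (((⟪a, x⟫ : ℝ) : ℂ) * s x + (h : ℂ) / Complex.I * ∂_{b} s x) * conj (r x) =
      coordMul a s x * conj (r x) + (h : ℂ) / Complex.I * (∂_{b} s x * conj (r x)) := by
    intro x; rw [coordMul_apply]; ring
  simp only [e2]
  rw [integral_add (integrable_schwartz_mul_conj _ _)
    ((integrable_schwartz_mul_conj _ _).const_mul _), integral_const_mul]
  have e3 : ∫ x, s x * conj (coordMul a r x) = ∫ x, coordMul a s x * conj (r x) := by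
    refine integral_congr_ae (ae_of_all _ fun x => ?_)
    simp only [coordMul_apply, map_mul, Complex.conj_ofReal]
    ring
  have e4 : (h : ℂ) / (2 * Complex.I) = h / Complex.I / 2 := by ring
  rw [e3, e4]
  linear_combination ((∫ x, coordMul a s x * conj (r x)) + (h : ℂ) / Complex.I *
    ∫ x, ∂_{b} s x * conj (r x)) * hD

/-- The Segal field in finite dimension corresponds, through `gammaMap`, to a Schwartz function. -/
lemma gammaMap_segal {h : ℝ} (hh : 0 < h) {φ : E → ℂ} {s : 𝓢(E, ℂ)}
    (hs : ∀ x, s x = gammaMap h φ x) (a b x : E) :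
    ((⟪a, x⟫ : ℝ) : ℂ) * s x + (h : ℂ) / Complex.I * ∂_{b} s x =
      gammaMap h (fun x => (((⟪a, x⟫ : ℝ) : ℂ) + Complex.I * ((⟪b, x⟫ : ℝ) : ℂ)) * φ x +
        (h : ℂ) / Complex.I * fderiv ℝ φ x b) x := by
  have hφ : HasFDerivAt φ (fderiv ℝ φ x) x :=
    ((contDiff_of_mem_schwartzGauss hh ⟨s, hs⟩).differentiable one_ne_zero x).hasFDerivAt
  -- The derivative of the weight along `b` contributes `(h/i)(-b·x/h) = i b·x`, the imaginary part
  -- of the multiplier in the Segal field.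
  have h1 : HasFDerivAt (fun x : E => Real.exp (-‖x‖ ^ 2 / (2 * h)))
      (Real.exp (-‖x‖ ^ 2 / (2 * h)) • ((2 * h)⁻¹ • (-((2 : ℕ) • innerSL ℝ x)) : E →L[ℝ] ℝ)) x := by
    have h2 := ((hasStrictFDerivAt_norm_sq x).hasFDerivAt.neg.const_mul (2 * h)⁻¹).exp
    simp only [inv_mul_eq_div] at h2
    exact h2
  have h2 := Complex.ofRealCLM.hasFDerivAt.comp x h1
  have h3 := (hφ.const_mul ((gammaConst E h : ℝ) : ℂ)).mul h2
  have h4 : HasFDerivAt s _ x := h3.congr_of_eventuallyEq (Eventually.of_forall hs)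
  rw [SchwartzMap.lineDerivOp_apply_eq_fderiv, h4.fderiv, hs, gammaMap, gammaMap, ← gammaConst]
  have h0 : (h : ℂ) ≠ 0 := by exact_mod_cast hh.ne'
  simp only [ContinuousLinearMap.add_apply, ContinuousLinearMap.smul_apply,
    ContinuousLinearMap.comp_apply, ContinuousLinearMap.neg_apply, innerSL_apply_apply,
    Complex.ofRealCLM_apply, smul_eq_mul, nsmul_eq_mul, Function.comp_apply]
  rw [real_inner_comm b x]
  push_cast [-Complex.ofReal_exp]
  have hI := Complex.I_ne_zero
  field_simp
  ring_nf
  simp only [Complex.I_sq]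
  ring

lemma segal_mem_schwartzGauss {h : ℝ} (hh : 0 < h) {φ : E → ℂ} (hφ : φ ∈ schwartzGauss E h)
    (a b : E) : (fun x => (((⟪a, x⟫ : ℝ) : ℂ) + Complex.I * ((⟪b, x⟫ : ℝ) : ℂ)) * φ x +
        (h : ℂ) / Complex.I * fderiv ℝ φ x b) ∈ schwartzGauss E h := by
  obtain ⟨s, hs⟩ := hφ
  refine ⟨coordMul a s + ((h : ℂ) / Complex.I) • ∂_{b} s, fun x => ?_⟩
  rw [← gammaMap_segal hh hs, ← coordMul_apply]
  rfl

lemma integral_linear_mul_wignerHat {h : ℝ} (hh : 0 < h) {φ ψ : E → ℂ}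
    (hφ : φ ∈ schwartzGauss E h) (hψ : ψ ∈ schwartzGauss E h) (a b : E) :
    Integrable (fun p : E × E => ((⟪a, p.1⟫ + ⟪b, p.2⟫ : ℝ) : ℂ) * wignerHat h φ ψ p.1 p.2)
        ((gaussMeasure E (h / 2)).prod (gaussMeasure E (h / 2))) ∧
      ∫ p : E × E, ((⟪a, p.1⟫ + ⟪b, p.2⟫ : ℝ) : ℂ) * wignerHat h φ ψ p.1 p.2
          ∂((gaussMeasure E (h / 2)).prod (gaussMeasure E (h / 2))) =
        ∫ x, ((((⟪a, x⟫ : ℝ) : ℂ) + Complex.I * ((⟪b, x⟫ : ℝ) : ℂ)) * φ x +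
          (h : ℂ) / Complex.I * fderiv ℝ φ x b) * conj (ψ x) ∂(gaussMeasure E (h / 2)) := by
  obtain ⟨s, hs⟩ := hφ
  obtain ⟨r, hr⟩ := hψ
  constructor
  · rw [integrable_mul_wignerHat_iff hh hs hr
      (fun p : E × E => ((⟪a, p.1⟫ + ⟪b, p.2⟫ : ℝ) : ℂ))]
    obtain ⟨i1, i2⟩ := integrable_linear_mul_wignerTransform hh s r a b
    refine (i1.add i2).congr (ae_of_all _ fun p => ?_)
    simp only [Pi.add_apply]
    push_cast
    ring
  · rw [integral_mul_wignerHat hh hs hr (fun p : E × E => ((⟪a, p.1⟫ + ⟪b, p.2⟫ : ℝ) : ℂ)),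
      integral_linear_mul_wignerTransform hh]
    rw [integral_mul_conj_gaussMeasure hh (φ := fun x => (((⟪a, x⟫ : ℝ) : ℂ) +
      Complex.I * ((⟪b, x⟫ : ℝ) : ℂ)) * φ x + (h : ℂ) / Complex.I * fderiv ℝ φ x b)
      (s := coordMul a s + ((h : ℂ) / Complex.I) • ∂_{b} s) (r := r) (fun x => ?_) hr]
    · refine integral_congr_ae (ae_of_all _ fun x => ?_)
      simp only [add_apply, smul_apply, coordMul_apply, smul_eq_mul]
    · rw [← gammaMap_segal hh hs, ← coordMul_apply]
      rfl

/-- The Weyl form of a plane wave in finite dimension. -/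
lemma integral_cexp_mul_wignerHat {h : ℝ} (hh : 0 < h) {φ ψ : E → ℂ}
    (hφ : φ ∈ schwartzGauss E h) (hψ : ψ ∈ schwartzGauss E h) (x ξ : E) :
    ∫ p : E × E, Complex.exp (Complex.I * ((⟪x, p.1⟫ + ⟪ξ, p.2⟫ : ℝ) : ℂ)) *
        wignerHat h φ ψ p.1 p.2 ∂((gaussMeasure E (h / 2)).prod (gaussMeasure E (h / 2))) =
      ∫ u, Complex.exp (-((h / 2 * ‖ξ‖ ^ 2 : ℝ) : ℂ) + Complex.I * ((h / 2 * ⟪x, ξ⟫ : ℝ) : ℂ) +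
        Complex.I * (((⟪x, u⟫ : ℝ) : ℂ) + Complex.I * ((⟪ξ, u⟫ : ℝ) : ℂ))) * φ (u + h • ξ) *
        conj (ψ u) ∂(gaussMeasure E (h / 2)) := by
  obtain ⟨s, hs⟩ := hφ
  obtain ⟨r, hr⟩ := hψ
  rw [integral_mul_wignerHat hh hs hr
    (fun p : E × E => Complex.exp (Complex.I * ((⟪x, p.1⟫ + ⟪ξ, p.2⟫ : ℝ) : ℂ)))]
  have hint : Integrable (fun p : E × E => Complex.exp (Complex.I *
      ((⟪x, p.1⟫ + ⟪ξ, p.2⟫ : ℝ) : ℂ)) * wignerTransform h s r p.1 p.2) (volume.prod volume) := by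
    refine (integrable_wignerTransform hh s r).bdd_mul (c := 1)
      (Continuous.aestronglyMeasurable (by fun_prop)) (ae_of_all _ fun p => ?_)
    rw [mul_comm, Complex.norm_exp_ofReal_mul_I]
  rw [integral_prod _ hint]
  have e1 : ∀ z : E, ∫ ζ : E, Complex.exp (Complex.I * ((⟪x, z⟫ + ⟪ξ, ζ⟫ : ℝ) : ℂ)) *
      wignerTransform h s r z ζ = (((Real.pi * h) ^ Module.finrank ℝ E : ℝ) : ℂ) *
      (Complex.exp (Complex.I * ((⟪x, z⟫ : ℝ) : ℂ)) *
        (s (z + (h / 2) • ξ) * conj (r (z - (h / 2) • ξ)))) := by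
    intro z
    rw [mul_left_comm, ← integral_cexp_mul_wignerTransform hh, ← integral_const_mul]
    refine integral_congr_ae (ae_of_all _ fun ζ => ?_)
    simp only
    rw [← mul_assoc, ← Complex.exp_add]
    congr 2
    push_cast
    ring
  simp only [e1]
  -- Recentring by `(h/2)ξ` puts the second function at `u` and the first at `u + hξ`, as in the
  -- Weyl operator.
  rw [integral_const_mul, ← mul_assoc, ← Complex.ofReal_mul, gammaConst_pow_four_mul hh,
    Complex.ofReal_one, one_mul, ← integral_add_right_eq_self _ ((h / 2) • ξ),
    integral_gaussMeasure (by positivity)]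
  refine integral_congr_ae (ae_of_all _ fun u => ?_)
  simp only [add_sub_cancel_right]
  rw [add_assoc, ← add_smul, add_halves, hs, hr, gaussDensity_half hh, gammaMap, gammaMap,
    ← gammaConst, Complex.real_smul]
  simp only [map_mul, Complex.conj_ofReal]
  have e2 : Complex.exp (-((h / 2 * ‖ξ‖ ^ 2 : ℝ) : ℂ) + Complex.I * ((h / 2 * ⟪x, ξ⟫ : ℝ) : ℂ) +
        Complex.I * (((⟪x, u⟫ : ℝ) : ℂ) + Complex.I * ((⟪ξ, u⟫ : ℝ) : ℂ))) =
      Complex.exp (Complex.I * ((⟪x, u + (h / 2) • ξ⟫ : ℝ) : ℂ)) *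
        ((Real.exp (-(h / 2 * ‖ξ‖ ^ 2) - ⟪ξ, u⟫) : ℝ) : ℂ) := by
    rw [Complex.ofReal_exp, ← Complex.exp_add]
    congr 1
    rw [inner_add_right, real_inner_smul_right]
    push_cast
    linear_combination (((⟪ξ, u⟫ : ℝ) : ℂ)) * Complex.I_sq
  -- The shift of the Gaussian weight produces the real part of the exponent of the Weyl operator.
  have e3 : Real.exp (-‖u + h • ξ‖ ^ 2 / (2 * h)) * Real.exp (-‖u‖ ^ 2 / (2 * h)) =
      Real.exp (-‖u‖ ^ 2 / h) * Real.exp (-(h / 2 * ‖ξ‖ ^ 2) - ⟪ξ, u⟫) := by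
    rw [← Real.exp_add, ← Real.exp_add]
    congr 1
    rw [norm_add_sq_real, norm_smul, real_inner_smul_right, mul_pow, Real.norm_eq_abs, sq_abs,
      real_inner_comm]
    field_simp
    ring
  rw [e2]
  have e4 := congrArg (fun t : ℝ => (t : ℂ)) e3
  simp only [Complex.ofReal_mul] at e4
  push_cast [-Complex.ofReal_exp]
  linear_combination (Complex.exp (Complex.I * ((⟪x, u + (h / 2) • ξ⟫ : ℝ) : ℂ)) *
    ((gammaConst E h : ℝ) : ℂ) ^ 2 * φ (u + h • ξ) * conj (ψ u)) * e4

end GaussianWigner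

end WienerWeyl

namespace WienerWeyl

/-! ### Gaussians and exterior products of Schwartz functions -/

section SchwartzProducts

open scoped ContDiff Nat

/-- `x^m ≤ m! eˣ` at `x = 1 + t`, then completion of the square in `t - c t²`. -/
lemma one_add_pow_mul_exp_le {c : ℝ} (hc : 0 < c) (m : ℕ) {t : ℝ} (ht : 0 ≤ t) :
    (1 + t) ^ m * Real.exp (-(c * t ^ 2)) ≤ m ! * Real.exp (1 + 1 / (4 * c)) := by
  have h1 := Real.pow_div_factorial_le_exp (1 + t) (by linarith) m
  rw [div_le_iff₀ (by positivity)] at h1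
  have h2 : 1 + t + -(c * t ^ 2) ≤ 1 + 1 / (4 * c) := by
    have : 0 ≤ c * (t - 1 / (2 * c)) ^ 2 := by positivity
    have e : c * (t - 1 / (2 * c)) ^ 2 = c * t ^ 2 - t + 1 / (4 * c) := by field_simp; ring
    linarith
  calc (1 + t) ^ m * Real.exp (-(c * t ^ 2))
      ≤ Real.exp (1 + t) * m ! * Real.exp (-(c * t ^ 2)) := by gcongr
    _ = m ! * Real.exp (1 + t + -(c * t ^ 2)) := by rw [Real.exp_add (1 + t)]; ring
    _ ≤ _ := by gcongr

/-- The Gaussian `x ↦ exp(-c‖x‖²)` as a Schwartz function. -/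
noncomputable def schwartzGaussian (G : Type*) [NormedAddCommGroup G] [InnerProductSpace ℝ G]
    {c : ℝ} (hc : 0 < c) : 𝓢(G, ℝ) where
  toFun x := Real.exp (-(c * ‖x‖ ^ 2))
  smooth' := ((contDiff_const.mul (contDiff_norm_sq ℝ)).neg).exp
  decay' := by
    intro k n
    have hf : Function.HasTemperateGrowth fun x : G => -(c * ‖x‖ ^ 2) := by
      have h1 := Function.hasTemperateGrowth_norm_sq (H := G)
      fun_prop
    obtain ⟨l, C, hC, hb⟩ := hf.norm_iteratedFDeriv_le_uniform n
    refine ⟨n ! * (1 + C) ^ n * ((k + l * n)! * Real.exp (1 + 1 / (4 * c))), fun x => ?_⟩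
    have hx := norm_nonneg x
    -- Faà di Bruno bound: every derivative of `exp` is `exp`, and the exponent has temperate
    -- growth. The constant `1 + C` makes the base at least `1`, so that it is bounded by its `i`-th
    -- power.
    have h1 := norm_iteratedFDeriv_comp_le (n := n) (N := ∞) Real.contDiff_exp hf.1
      (by exact_mod_cast le_top) x (C := Real.exp (-(c * ‖x‖ ^ 2))) (D := (1 + C) * (1 + ‖x‖) ^ l)
      (fun i _ => by
        rw [norm_iteratedFDeriv_eq_norm_iteratedDeriv, iteratedDeriv_eq_iterate,
          Real.iter_deriv_exp, Real.norm_eq_abs, Real.abs_exp])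
      (fun i hi1 hin => by
        have h2 : (1 : ℝ) ≤ (1 + C) * (1 + ‖x‖) ^ l :=
          one_le_mul_of_one_le_of_one_le (by linarith) (one_le_pow₀ (by linarith))
        calc _ ≤ C * (1 + ‖x‖) ^ l := hb i hin x
          _ ≤ (1 + C) * (1 + ‖x‖) ^ l := by gcongr; linarith
          _ ≤ _ := le_self_pow₀ h2 (by omega))
    calc ‖x‖ ^ k * _ ≤ (1 + ‖x‖) ^ k * (n ! * Real.exp (-(c * ‖x‖ ^ 2)) *
          ((1 + C) * (1 + ‖x‖) ^ l) ^ n) := by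
          gcongr
          · linarith
          · exact h1
      _ = n ! * (1 + C) ^ n * ((1 + ‖x‖) ^ (k + l * n) * Real.exp (-(c * ‖x‖ ^ 2))) := by
          rw [mul_pow, pow_add, pow_mul]; ring
      _ ≤ _ := by
          exact mul_le_mul_of_nonneg_left (one_add_pow_mul_exp_le hc _ hx) (by positivity)

variable {E E' G : Type*} [NormedAddCommGroup E] [NormedSpace ℝ E] [NormedAddCommGroup E']
  [NormedSpace ℝ E'] [NormedAddCommGroup G] [NormedSpace ℝ G]

lemma exists_bound_iteratedFDeriv_comp (s : 𝓢(E, ℂ)) (π : E' →L[ℝ] E) (k n : ℕ) :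
    ∃ C, 0 ≤ C ∧ ∀ x, (1 + ‖π x‖) ^ k * ‖iteratedFDeriv ℝ n (s ∘ π) x‖ ≤ C := by
  refine ⟨‖π‖ ^ n * (2 ^ k * (Finset.Iic (k, n)).sup (fun m => SchwartzMap.seminorm ℝ m.1 m.2) s),
    by positivity, fun x => ?_⟩
  have h1 := SchwartzMap.one_add_le_sup_seminorm_apply (𝕜 := ℝ) (m := (k, n)) le_rfl le_rfl s (π x)
  rw [π.iteratedFDeriv_comp_right (s.smooth ⊤) x (by exact_mod_cast le_top)]
  have h2 := ContinuousMultilinearMap.norm_compContinuousLinearMap_le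
    (iteratedFDeriv ℝ n s (π x)) fun _ : Fin n => π
  rw [Finset.prod_const, Finset.card_univ, Fintype.card_fin] at h2
  calc _ ≤ (1 + ‖π x‖) ^ k * (‖iteratedFDeriv ℝ n s (π x)‖ * ‖π‖ ^ n) := by gcongr
    _ = ‖π‖ ^ n * ((1 + ‖π x‖) ^ k * ‖iteratedFDeriv ℝ n s (π x)‖) := by ring
    _ ≤ _ := by gcongr

/-- The exterior product of Schwartz functions along a decomposition of the source. -/
lemma exists_schwartzMap_mul_comp (s : 𝓢(E, ℂ)) (g : 𝓢(G, ℂ)) (π : E' →L[ℝ] E) (q : E' →L[ℝ] G)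
    (hn : ∀ x, ‖x‖ ≤ ‖π x‖ + ‖q x‖) : ∃ F : 𝓢(E', ℂ), ∀ x, F x = s (π x) * g (q x) := by
  have hs : ContDiff ℝ ∞ (s ∘ π) := (s.smooth ⊤).comp π.contDiff
  have hg : ContDiff ℝ ∞ (g ∘ q) := (g.smooth ⊤).comp q.contDiff
  refine ⟨⟨fun x => (s ∘ π) x * (g ∘ q) x, hs.mul hg, fun k n => ?_⟩, fun x => rfl⟩
  choose A hA0 hA using fun n => exists_bound_iteratedFDeriv_comp s π k n
  choose A' hA0' hA' using fun n => exists_bound_iteratedFDeriv_comp g q k n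
  refine ⟨∑ j ∈ Finset.range (n + 1), (n.choose j : ℝ) * (A j * A' (n - j)), fun x => ?_⟩
  have h1 := norm_iteratedFDeriv_mul_le hs hg x (n := n) (by exact_mod_cast le_top)
  have hx : ‖x‖ ^ k ≤ (1 + ‖π x‖) ^ k * (1 + ‖q x‖) ^ k := by
    rw [← mul_pow]
    gcongr
    nlinarith [hn x, mul_nonneg (norm_nonneg (π x)) (norm_nonneg (q x))]
  calc _ ≤ ((1 + ‖π x‖) ^ k * (1 + ‖q x‖) ^ k) * ∑ j ∈ Finset.range (n + 1), (n.choose j : ℝ) *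
        ‖iteratedFDeriv ℝ j (s ∘ π) x‖ * ‖iteratedFDeriv ℝ (n - j) (g ∘ q) x‖ := by gcongr
    _ = ∑ j ∈ Finset.range (n + 1), (n.choose j : ℝ) *
        (((1 + ‖π x‖) ^ k * ‖iteratedFDeriv ℝ j (s ∘ π) x‖) *
          ((1 + ‖q x‖) ^ k * ‖iteratedFDeriv ℝ (n - j) (g ∘ q) x‖)) := by
        rw [Finset.mul_sum]
        refine Finset.sum_congr rfl fun j _ => by ring
    _ ≤ _ := by
        gcongr with j _
        · exact hA0 j
        · exact hA j x
        · exact hA' _ x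

end SchwartzProducts

/-! ### Change of base space for cylindrical functions -/

section SchwartzGauss

/-- The Gaussian weight factors along `π` and `q`. The factor in `q` supplies the decay in the
directions on which `φ ∘ π` does not depend; this is what allows a common `E` for two test
functions. -/
lemma comp_mem_schwartzGauss {E E' G : Type*} [NormedAddCommGroup E] [InnerProductSpace ℝ E]
    [FiniteDimensional ℝ E] [MeasurableSpace E] [BorelSpace E]
    [NormedAddCommGroup E'] [InnerProductSpace ℝ E'] [FiniteDimensional ℝ E'] [MeasurableSpace E']
    [BorelSpace E'] [NormedAddCommGroup G] [InnerProductSpace ℝ G]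
    (π : E' →L[ℝ] E) (q : E' →L[ℝ] G) (hn : ∀ x, ‖x‖ ^ 2 = ‖π x‖ ^ 2 + ‖q x‖ ^ 2)
    {h : ℝ} (hh : 0 < h) {φ : E → ℂ} (hφ : φ ∈ schwartzGauss E h) :
    φ ∘ π ∈ schwartzGauss E' h := by
  obtain ⟨s, hs⟩ := hφ
  have hc : 0 < 1 / (2 * h) := by positivity
  obtain ⟨F, hF⟩ := exists_schwartzMap_mul_comp s
    (SchwartzMap.postcompCLM (𝕜 := ℝ) Complex.ofRealCLM (schwartzGaussian G hc)) π q (fun x => by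
      have := hn x
      nlinarith [norm_nonneg x, norm_nonneg (π x), norm_nonneg (q x),
        mul_nonneg (norm_nonneg (π x)) (norm_nonneg (q x))])
  refine ⟨((gammaConst E' h * (gammaConst E h)⁻¹ : ℝ) : ℂ) • F, fun x => ?_⟩
  have hE : ((gammaConst E h : ℝ) : ℂ) ≠ 0 := by exact_mod_cast (gammaConst_pos (E := E) hh).ne'
  have e1 : (SchwartzMap.postcompCLM (𝕜 := ℝ) Complex.ofRealCLM (schwartzGaussian G hc)) (q x) =
      ((Real.exp (-(1 / (2 * h) * ‖q x‖ ^ 2)) : ℝ) : ℂ) := rfl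
  have e2 : Real.exp (-‖x‖ ^ 2 / (2 * h)) =
      Real.exp (-‖π x‖ ^ 2 / (2 * h)) * Real.exp (-(1 / (2 * h) * ‖q x‖ ^ 2)) := by
    rw [← Real.exp_add, hn]
    congr 1
    ring
  rw [smul_apply, hF, e1, hs, gammaMap, gammaMap, ← gammaConst, ← gammaConst, e2, smul_eq_mul]
  push_cast [-Complex.ofReal_exp]
  simp only [Function.comp_apply]
  field_simp

variable {E : Type*} [NormedAddCommGroup E] [InnerProductSpace ℝ E] [FiniteDimensional ℝ E]
  [MeasurableSpace E] [BorelSpace E]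

lemma add_mem_schwartzGauss {h : ℝ} {φ ψ : E → ℂ} (hφ : φ ∈ schwartzGauss E h)
    (hψ : ψ ∈ schwartzGauss E h) : φ + ψ ∈ schwartzGauss E h := by
  obtain ⟨s, hs⟩ := hφ
  obtain ⟨r, hr⟩ := hψ
  refine ⟨s + r, fun x => ?_⟩
  rw [add_apply, hs, hr, gammaMap, gammaMap, gammaMap, Pi.add_apply]
  ring

lemma smul_mem_schwartzGauss {h : ℝ} (c : ℂ) {φ : E → ℂ} (hφ : φ ∈ schwartzGauss E h) :
    c • φ ∈ schwartzGauss E h := by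
  obtain ⟨s, hs⟩ := hφ
  refine ⟨c • s, fun x => ?_⟩
  rw [smul_apply, hs, gammaMap, gammaMap, Pi.smul_apply, smul_eq_mul, smul_eq_mul]
  ring

end SchwartzGauss

/-! ### The test space -/

section TestSpace

variable {H B : Type*} [NormedAddCommGroup H] [InnerProductSpace ℝ H] [CompleteSpace H]
  [TopologicalSpace.SeparableSpace H] [MeasurableSpace H] [BorelSpace H]
  [NormedAddCommGroup B] [NormedSpace ℝ B] [CompleteSpace B]
  [MeasurableSpace B] [BorelSpace B] {i : H →L[ℝ] B} {h : ℝ} {f g : B → ℂ}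

lemma projB_of_le (hi : IsAbstractWiener i) {E E' : Submodule ℝ H} [FiniteDimensional ℝ E]
    [FiniteDimensional ℝ E'] (hE' : InDual i E') (hle : E ≤ E') (x : B) :
    projB i E x = E.orthogonalProjectionOnto (projB i E' x : H) := by
  refine ext_inner_left ℝ fun v => ?_
  rw [inner_projB hi (fun e he => hE' e (hle he)), Submodule.inner_orthogonalProjectionOnto_eq_of_mem_left]
  exact (inner_projB hi hE' ⟨v, hle v.2⟩ x).symm

lemma exists_rep_of_le (hi : IsAbstractWiener i) (hh : 0 < h) {E E' : Submodule ℝ H}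
    [FiniteDimensional ℝ E] [FiniteDimensional ℝ E'] (hE' : InDual i E') (hle : E ≤ E')
    {φ : E → ℂ} (hφ : φ ∈ schwartzGauss E h) :
    ∃ φ' ∈ schwartzGauss E' h, φ ∘ projB i E = φ' ∘ projB i E' := by
  refine ⟨φ ∘ (E.orthogonalProjectionOnto ∘L E'.subtypeL),
    comp_mem_schwartzGauss _ (Eᗮ.orthogonalProjectionOnto ∘L E'.subtypeL) (fun x => ?_) hh hφ,
    funext fun x => ?_⟩
  · have h1 := Submodule.norm_sq_eq_add_norm_sq_projection (x : H) E
    rw [Submodule.coe_norm, h1]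
    rfl
  · simp only [Function.comp_apply]
    rw [projB_of_le hi hE' hle]
    rfl

lemma inDual_sup {E E' : Submodule ℝ H} (hE : InDual i E) (hE' : InDual i E') :
    InDual i (E ⊔ E') := by
  rw [inDual_iff_le] at *
  exact sup_le hE hE'

lemma nonempty_commonRep (hi : IsAbstractWiener i) (hh : 0 < h) (hf : f ∈ testSpace i h)
    (hg : g ∈ testSpace i h) : Nonempty (CommonRep i h f g) := by
  obtain ⟨E, hEf, φ, hE, hφ, rfl⟩ := hf
  obtain ⟨E', hEf', ψ, hE', hψ, rfl⟩ := hg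
  obtain ⟨φ', hφ', e1⟩ := exists_rep_of_le hi hh (inDual_sup hE hE') le_sup_left hφ
  obtain ⟨ψ', hψ', e2⟩ := exists_rep_of_le hi hh (inDual_sup hE hE') le_sup_right hψ
  exact ⟨⟨E ⊔ E', inferInstance, inDual_sup hE hE', φ', ψ', hφ', hψ', e1, e2⟩⟩

/-- `testSpace` as a linear subspace. -/
def testSubmodule (hi : IsAbstractWiener i) (hh : 0 < h) : Submodule ℂ (B → ℂ) where
  carrier := testSpace i h
  zero_mem' := by
    refine ⟨⊥, inferInstance, 0, fun e he => ?_, ⟨0, fun x => ?_⟩, rfl⟩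
    · exact ⟨0, fun x => by simp [(Submodule.mem_bot ℝ).1 he]⟩
    · simp [gammaMap]
  add_mem' := by
    intro f g hf hg
    obtain ⟨r⟩ := nonempty_commonRep hi hh hf hg
    refine ⟨r.E, r.finDim, r.φ + r.ψ, r.inDual,
      haveI := r.finDim; add_mem_schwartzGauss r.φ_mem r.ψ_mem, ?_⟩
    have h1 := r.eq_left
    have h2 := r.eq_right
    funext x
    rw [Pi.add_apply, congrFun h1, congrFun h2]
    rfl
  smul_mem' := by
    rintro c f ⟨E, hEf, φ, hE, hφ, rfl⟩
    exact ⟨E, hEf, c • φ, hE, smul_mem_schwartzGauss c hφ, rfl⟩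

lemma measurePreserving_projB (hi : IsAbstractWiener i) {t : ℝ} (ht : 0 < t) {E : Submodule ℝ H}
    [FiniteDimensional ℝ E] (hE : InDual i E) :
    MeasurePreserving (projB i E) (wienerMeasure i t) (gaussMeasure E t) :=
  ⟨(projB i E).continuous.measurable, (isWienerMeasure_wienerMeasure hi ht).map_projB E hE⟩

lemma memLp_of_mem_testSpace (hi : IsAbstractWiener i) (hh : 0 < h) (hf : f ∈ testSpace i h) :
    MemLp f 2 (wienerMeasure i (h / 2)) := by
  obtain ⟨E, hEf, φ, hE, hφ, rfl⟩ := hf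
  exact (memLp_of_mem_schwartzGauss hh hφ).comp_measurePreserving
    (measurePreserving_projB hi (half_pos hh) hE)

lemma continuous_of_mem_testSpace (hh : 0 < h) (hf : f ∈ testSpace i h) : Continuous f := by
  obtain ⟨E, hEf, φ, hE, hφ, rfl⟩ := hf
  exact (contDiff_of_mem_schwartzGauss hh hφ).continuous.comp (projB i E).continuous

end TestSpace

end WienerWeyl

namespace WienerWeyl

/-! ### Exhausting sequences of finite-dimensional subspaces -/

section Exhaustion

variable {K : Type*} [NormedAddCommGroup K] [InnerProductSpace ℝ K]

/-- Spans of initial segments of a sequence dense in `D`. The freedom in `D` permits subspaces of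
`B' × B'`. -/
lemma exists_exhausting [TopologicalSpace.SeparableSpace K] {D : Submodule ℝ K}
    (hD : Dense (D : Set K)) :
    ∃ E : ℕ → Submodule ℝ K, (∀ n, FiniteDimensional ℝ (E n)) ∧ Monotone E ∧ (∀ n, E n ≤ D) ∧
      Dense (⋃ n, (E n : Set K)) := by
  have := UniformSpace.secondCountable_of_separable K
  set v : ℕ → K := fun n => (TopologicalSpace.denseSeq D n : K) with hv
  refine ⟨fun n => Submodule.span ℝ (v '' Set.Iic n), fun n => ?_, fun m n hmn => ?_, fun n => ?_,
    ?_⟩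
  · exact FiniteDimensional.span_of_finite ℝ ((Set.finite_Iic n).image v)
  · exact Submodule.span_mono (Set.image_mono (Set.Iic_subset_Iic.2 hmn))
  · rw [Submodule.span_le]
    rintro _ ⟨k, -, rfl⟩
    exact Subtype.coe_prop _
  · have h1 : DenseRange v :=
      hD.denseRange_val.comp (TopologicalSpace.denseRange_denseSeq D) continuous_subtype_val
    refine h1.mono ?_
    rintro _ ⟨n, rfl⟩
    exact Set.mem_iUnion.2 ⟨n, Submodule.subset_span ⟨n, Set.self_mem_Iic, rfl⟩⟩

lemma tendsto_starProjection_of_dense [CompleteSpace K] {E : ℕ → Submodule ℝ K}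
    [∀ n, FiniteDimensional ℝ (E n)] (hE : Monotone E) (hd : Dense (⋃ n, (E n : Set K))) (x : K) :
    Tendsto (fun n => (E n).starProjection x) atTop (𝓝 x) := by
  refine Submodule.starProjection_tendsto_self E hE x ?_
  rw [top_le_iff, ← Submodule.dense_iff_topologicalClosure_eq_top]
  refine hd.mono (Set.iUnion_subset fun n => ?_)
  exact SetLike.coe_subset_coe.2 (le_iSup E n)

lemma starProjection_eq_sum (E : Submodule ℝ K) [FiniteDimensional ℝ E] (x : K) :
    E.starProjection x = ∑ j, ⟪x, (stdOrthonormalBasis ℝ E j : K)⟫ •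
      (stdOrthonormalBasis ℝ E j : K) := by
  have h1 := (stdOrthonormalBasis ℝ E).sum_repr' (E.orthogonalProjectionOnto x)
  have h2 := congrArg (fun y : E => (y : K)) h1
  simp only [Submodule.coe_sum, Submodule.coe_smul] at h2
  rw [Submodule.starProjection_apply, ← h2]
  refine Finset.sum_congr rfl fun j _ => ?_
  rw [Submodule.inner_orthogonalProjectionOnto_eq_of_mem_left, real_inner_comm]

end Exhaustion

/-! ### Stochastic extensions and admissibility -/

section StochasticExtension

variable {H B : Type*} [NormedAddCommGroup H] [InnerProductSpace ℝ H] [CompleteSpace H]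
  [TopologicalSpace.SeparableSpace H] [MeasurableSpace H] [BorelSpace H]
  [NormedAddCommGroup B] [NormedSpace ℝ B] [CompleteSpace B]
  [MeasurableSpace B] [BorelSpace B] {i : H →L[ℝ] B} {t h : ℝ}

lemma measurable_projTilde (hi : IsAbstractWiener i) (ht : 0 < t)
    (E : Submodule ℝ (WithLp 2 (H × H))) [FiniteDimensional ℝ E] :
    Measurable (projTilde i t E) := by
  have := UniformSpace.secondCountable_of_separable H
  have h1 : ∀ u, Measurable (ell2 i t u) := by
    have := isProbabilityMeasure_wienerMeasure hi ht
    exact (isIsonormal_ell2 hi ht).measurable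
  unfold projTilde
  simp only [WithLp.ofLp_sum, WithLp.ofLp_smul]
  exact Finset.measurable_sum _ fun j _ => (h1 _).smul_const _

/-- By almost sure linearity, composing a linear form with `π̃_E` projects its index onto `E`.
Stochastic extension thereby becomes the convergence of projections in `H²`. -/
lemma inner_projTilde (hi : IsAbstractWiener i) (ht : 0 < t)
    (E : Submodule ℝ (WithLp 2 (H × H))) [FiniteDimensional ℝ E] (W : WithLp 2 (H × H)) :
    ∀ᵐ Z ∂(wienerMeasure2 i t), ⟪W, WithLp.toLp 2 (projTilde i t E Z)⟫ =
      ell2 i t (E.starProjection W) Z := by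
  have := isProbabilityMeasure_wienerMeasure2 hi ht
  filter_upwards [(isIsonormal_ell2 hi ht).sum_smul Finset.univ
    (fun j => ⟪W, (stdOrthonormalBasis ℝ E j : WithLp 2 (H × H))⟫)
    (fun j => (stdOrthonormalBasis ℝ E j : WithLp 2 (H × H)))] with Z hZ
  rw [starProjection_eq_sum, hZ, projTilde, WithLp.toLp_ofLp, inner_sum]
  refine Finset.sum_congr rfl fun j _ => ?_
  rw [real_inner_smul_right, mul_comm]

lemma inner_add_inner (X Y : H × H) :
    ⟪X.1, Y.1⟫ + ⟪X.2, Y.2⟫ = ⟪WithLp.toLp 2 X, WithLp.toLp 2 Y⟫ := by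
  rw [WithLp.prod_inner_apply]

/-- Limits in probability are unique once one exhausting sequence exists; assertions about every
extension reduce to a single one. -/
lemma IsStochExt.ae_eq {F : H × H → ℂ} {Ft Ft' : B × B → ℂ} (h1 : IsStochExt i t F Ft)
    (h2 : IsStochExt i t F Ft') : Ft =ᵐ[wienerMeasure2 i t] Ft' := by
  obtain ⟨E, hf, hm, -, hd⟩ := exists_exhausting (K := WithLp 2 (H × H)) (D := ⊤) (by simp)
  exact tendstoInMeasure_ae_unique (h1.tendsto E hm hd) (h2.tendsto E hm hd)

/-- The error `ℓ` of `P_E W - W` has `L¹` norm at most `√t |P_E W - W|`, which tends to zero. -/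
lemma isStochExt_linearSymbol (hi : IsAbstractWiener i) (ht : 0 < t) (a b : H) :
    IsStochExt i t (linearSymbol a b) fun Z => (ell2 i t (WithLp.toLp 2 (a, b)) Z : ℂ) := by
  have := isProbabilityMeasure_wienerMeasure2 hi ht
  have hI := isIsonormal_ell2 hi ht
  have hF : Measurable (linearSymbol a b) := by
    have h1 : Measurable fun X : H × H => (⟪a, X.1⟫ : ℝ) :=
      (innerSL ℝ a).continuous.measurable.comp measurable_fst
    have h2 : Measurable fun X : H × H => (⟪b, X.2⟫ : ℝ) :=
      (innerSL ℝ b).continuous.measurable.comp measurable_snd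
    exact Complex.measurable_ofReal.comp (h1.add h2)
  refine ⟨hF, Complex.measurable_ofReal.comp (hI.measurable _), fun E _ hm hd => ?_⟩
  set W : WithLp 2 (H × H) := WithLp.toLp 2 (a, b)
  refine tendstoInMeasure_of_tendsto_eLpNorm one_ne_zero (fun n =>
    (hF.comp (measurable_projTilde hi ht (E n))).aestronglyMeasurable)
    (Complex.measurable_ofReal.comp (hI.measurable _)).aestronglyMeasurable ?_
  have hb : ∀ n, eLpNorm ((fun Z => linearSymbol a b (projTilde i t (E n) Z)) -
      fun Z => (ell2 i t W Z : ℂ)) 1 (wienerMeasure2 i t) ≤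
      ENNReal.ofReal (√t * ‖(E n).starProjection W - W‖) := by
    intro n
    have e : ((fun Z => linearSymbol a b (projTilde i t (E n) Z)) - fun Z => (ell2 i t W Z : ℂ))
        =ᵐ[wienerMeasure2 i t] fun Z => (ell2 i t ((E n).starProjection W - W) Z : ℂ) := by
      filter_upwards [inner_projTilde hi ht (E n) W, hI.sub ((E n).starProjection W) W] with Z h1 h2
      rw [Pi.sub_apply, h2, ← h1, linearSymbol,
        inner_add_inner (a, b) (projTilde i t (E n) Z)]
      push_cast
      rfl
    rw [eLpNorm_congr_ae e, eLpNorm_one_eq_lintegral_enorm,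
      ← ofReal_integral_norm_eq_lintegral_enorm (hI.integrable ht _).ofReal]
    refine ENNReal.ofReal_le_ofReal ?_
    simpa using hI.integral_abs_le ht ((E n).starProjection W - W)
  refine tendsto_of_tendsto_of_tendsto_of_le_of_le tendsto_const_nhds ?_ (fun _ => bot_le) hb
  have h1 := (tendsto_starProjection_of_dense hm hd W).sub_const W
  rw [sub_self] at h1
  simpa using ENNReal.tendsto_ofReal (h1.norm.const_mul √t)

lemma isWeylSymbol_of_eLpNorm_le {F : B × B → ℂ} (hF : AEStronglyMeasurable F (wienerMeasure2 i (h / 2)))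
    {C : ℝ} {m : ℕ} (hC : ∀ Y : H × H, eLpNorm (fun Z : B × B => F (Z + (i Y.1, i Y.2))) 1
      (wienerMeasure2 i (h / 2)) ≤ ENNReal.ofReal (C * (1 + ‖WithLp.toLp 2 Y‖) ^ m)) :
    IsWeylSymbol i h F := by
  refine ⟨⟨hF, ?_⟩, m, ?_⟩
  · have h0 := hC 0
    simp only [Prod.fst_zero, Prod.snd_zero, map_zero, Prod.mk_zero_zero, add_zero] at h0
    exact h0.trans_lt ENNReal.ofReal_lt_top
  · refine lt_of_le_of_lt (iSup_le fun Y => ?_) (ENNReal.ofReal_lt_top (r := C))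
    refine ENNReal.div_le_of_le_mul ((hC Y).trans ?_)
    have hp : 0 ≤ (1 + ‖WithLp.toLp 2 Y‖) ^ m := by positivity
    rw [ENNReal.ofReal_mul' hp]

/-- A shift by `Y` adds the constant `⟪W, Y⟫`, so the `L¹` norm grows linearly and `m = 1` suffices.
-/
lemma isWeylSymbol_of_ae_eq_ell2 (hi : IsAbstractWiener i) (hh : 0 < h) (W : WithLp 2 (H × H))
    {F : B × B → ℂ} (hF : F =ᵐ[wienerMeasure2 i (h / 2)] fun Z => (ell2 i (h / 2) W Z : ℂ)) :
    IsWeylSymbol i h F := by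
  have hh' : 0 < h / 2 := half_pos hh
  have := isProbabilityMeasure_wienerMeasure2 hi hh'
  have hI := isIsonormal_ell2 hi hh'
  have hint : ∀ c : ℝ, Integrable (fun Z => ((ell2 i (h / 2) W Z + c : ℝ) : ℂ))
      (wienerMeasure2 i (h / 2)) := fun c => ((hI.integrable hh' W).add (integrable_const c)).ofReal
  refine isWeylSymbol_of_eLpNorm_le (C := √(h / 2) * ‖W‖ + ‖W‖) (m := 1) ?_ fun Y => ?_
  · refine AEStronglyMeasurable.congr ?_ hF.symm
    exact (Complex.measurable_ofReal.comp (hI.measurable _)).aestronglyMeasurable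
  · set c : ℝ := ⟪W, WithLp.toLp 2 Y⟫ with hc
    have e : (fun Z : B × B => F (Z + (i Y.1, i Y.2))) =ᵐ[wienerMeasure2 i (h / 2)]
        fun Z => ((ell2 i (h / 2) W Z + c : ℝ) : ℂ) := by
      filter_upwards [(quasiMeasurePreserving_add2 hi hh' Y).ae hF, ell2_add_ae_eq hi hh' W Y]
        with Z h1 h2
      rw [h1, h2]
    rw [eLpNorm_congr_ae e, eLpNorm_one_eq_lintegral_enorm,
      ← ofReal_integral_norm_eq_lintegral_enorm (hint c)]
    refine ENNReal.ofReal_le_ofReal ?_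
    have hcb : |c| ≤ ‖W‖ * ‖WithLp.toLp 2 Y‖ := abs_real_inner_le_norm _ _
    calc ∫ Z, ‖((ell2 i (h / 2) W Z + c : ℝ) : ℂ)‖ ∂(wienerMeasure2 i (h / 2))
        ≤ ∫ Z, (|ell2 i (h / 2) W Z| + |c|) ∂(wienerMeasure2 i (h / 2)) := by
          refine integral_mono (hint c).norm
            ((hI.integrable hh' W).abs.add (integrable_const _)) fun Z => ?_
          simp only [Complex.norm_real, Real.norm_eq_abs]
          exact abs_add_le _ _
      _ = (∫ Z, |ell2 i (h / 2) W Z| ∂(wienerMeasure2 i (h / 2))) + |c| := by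
          rw [integral_add (hI.integrable hh' W).abs (integrable_const _)]
          simp
      _ ≤ √(h / 2) * ‖W‖ + ‖W‖ * ‖WithLp.toLp 2 Y‖ := add_le_add (hI.integral_abs_le hh' W) hcb
      _ ≤ _ := by
          have : 0 ≤ √(h / 2) * ‖W‖ * ‖WithLp.toLp 2 Y‖ := by positivity
          nlinarith [norm_nonneg W]

/-- An almost sure bound survives shifts by quasi-invariance, so `m = 0` suffices. -/
lemma isWeylSymbol_of_ae_bound (hi : IsAbstractWiener i) (hh : 0 < h) {F : B × B → ℂ}
    (hF : AEStronglyMeasurable F (wienerMeasure2 i (h / 2))) {C : ℝ}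
    (hC : ∀ᵐ Z ∂(wienerMeasure2 i (h / 2)), ‖F Z‖ ≤ C) : IsWeylSymbol i h F := by
  have hh' : 0 < h / 2 := half_pos hh
  have := isProbabilityMeasure_wienerMeasure2 hi hh'
  refine isWeylSymbol_of_eLpNorm_le hF (C := C) (m := 0) fun Y => ?_
  have h1 := (quasiMeasurePreserving_add2 hi hh' Y).ae hC
  simpa using eLpNorm_le_of_ae_bound (p := 1) h1

end StochasticExtension

end WienerWeyl

namespace WienerWeyl

open ProbabilityTheory

/-! ### Forms on cylindrical functions: splitting off the directions orthogonal to `E` -/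

section Cylinder

variable {H B : Type*} [NormedAddCommGroup H] [InnerProductSpace ℝ H] [CompleteSpace H]
  [TopologicalSpace.SeparableSpace H] [MeasurableSpace H] [BorelSpace H]
  [NormedAddCommGroup B] [NormedSpace ℝ B] [CompleteSpace B]
  [MeasurableSpace B] [BorelSpace B] {i : H →L[ℝ] B} {t h : ℝ}
  {E : Submodule ℝ H} [FiniteDimensional ℝ E]

lemma measurePreserving_projB_prod (hi : IsAbstractWiener i) (ht : 0 < t) (hE : InDual i E) :
    MeasurePreserving (Prod.map (projB i E) (projB i E)) (wienerMeasure2 i t)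
      ((gaussMeasure E t).prod (gaussMeasure E t)) := by
  have := isProbabilityMeasure_wienerMeasure hi ht
  have := isProbabilityMeasure_gaussMeasure (E := E) ht
  exact (measurePreserving_projB hi ht hE).prod (measurePreserving_projB hi ht hE)

lemma inner_orthogonalProjectionOnto_projB (hi : IsAbstractWiener i) (ht : 0 < t) (hE : InDual i E)
    (a : H) : ∀ᵐ x ∂(wienerMeasure i t),
      ell i t (E.starProjection a) x = ⟪E.orthogonalProjectionOnto a, projB i E x⟫ := by
  filter_upwards [ell_ae_eq_functional hi ht (hE _ (E.starProjection_apply_mem a))] with x hx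
  rw [hx, inner_projB hi hE]
  rfl

/-- The basic splitting: a function of `P_E` plus a variable indexed by `Eᗮ`, hence independent of
`P_E`. -/
lemma ell_ae_eq_add (hi : IsAbstractWiener i) (ht : 0 < t) (hE : InDual i E) (a : H) :
    ∀ᵐ x ∂(wienerMeasure i t), ell i t a x =
      ⟪E.orthogonalProjectionOnto a, projB i E x⟫ + ell i t (a - E.starProjection a) x := by
  have := isProbabilityMeasure_wienerMeasure hi ht
  filter_upwards [inner_orthogonalProjectionOnto_projB hi ht hE a,
    (isIsonormal_ell hi ht).sub a (E.starProjection a)] with x h1 h2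
  rw [h2, ← h1]
  ring

lemma ell2_ae_eq_add (hi : IsAbstractWiener i) (ht : 0 < t) (hE : InDual i E)
    (W : WithLp 2 (H × H)) :
    ∀ᵐ Z ∂(wienerMeasure2 i t), ell2 i t W Z =
      (⟪E.orthogonalProjectionOnto W.fst, projB i E Z.1⟫ +
        ⟪E.orthogonalProjectionOnto W.snd, projB i E Z.2⟫) +
      ell2 i t (WithLp.toLp 2 (W.fst - E.starProjection W.fst, W.snd - E.starProjection W.snd))
        Z := by
  have := isProbabilityMeasure_wienerMeasure hi ht
  have q1 : Measure.QuasiMeasurePreserving Prod.fst (wienerMeasure2 i t) (wienerMeasure i t) :=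
    Measure.quasiMeasurePreserving_fst
  have q2 : Measure.QuasiMeasurePreserving Prod.snd (wienerMeasure2 i t) (wienerMeasure i t) :=
    Measure.quasiMeasurePreserving_snd
  filter_upwards [q1.ae (ell_ae_eq_add hi ht hE W.fst), q2.ae (ell_ae_eq_add hi ht hE W.snd)]
    with Z h1 h2
  simp only [ell2, h1, h2, WithLp.toLp_fst, WithLp.toLp_snd]
  ring

/-- The pairs of vectors of `E`. -/
def pairSubmodule (E : Submodule ℝ H) : Submodule ℝ (WithLp 2 (H × H)) where
  carrier := {W | W.fst ∈ E ∧ W.snd ∈ E}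
  zero_mem' := ⟨E.zero_mem, E.zero_mem⟩
  add_mem' h1 h2 := ⟨E.add_mem h1.1 h2.1, E.add_mem h1.2 h2.2⟩
  smul_mem' r _ h1 := ⟨E.smul_mem r h1.1, E.smul_mem r h1.2⟩

/-- Independence from the pair is needed because `ℓ_{a+ib}` involves both variables, which may be
correlated with each other. -/
lemma indepFun_projB (hi : IsAbstractWiener i) (ht : 0 < t) (hE : InDual i E) {a b : H}
    (ha : a ∈ Eᗮ) (hb : b ∈ Eᗮ) :
    IndepFun (projB i E) (fun u => (ell i t a u, ell i t b u)) (wienerMeasure i t) := by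
  have := isProbabilityMeasure_wienerMeasure hi ht
  have hI := isIsonormal_ell hi ht
  refine hI.indepFun (U := E) (projB i E).continuous.measurable
    ((hI.measurable a).prodMk (hI.measurable b)) (fun L => ?_) (fun L => ?_)
  · set v := (InnerProductSpace.toDual ℝ E).symm L with hv
    refine ⟨v, v.2, ?_⟩
    filter_upwards [ell_ae_eq_functional hi ht (hE _ v.2)] with x hx
    rw [hx, ← inner_projB hi hE, hv, InnerProductSpace.toDual_symm_apply]
  · refine ⟨L (1, 0) • a + L (0, 1) • b, add_mem (Submodule.smul_mem _ _ ha)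
      (Submodule.smul_mem _ _ hb), ?_⟩
    filter_upwards [hI.add (L (1, 0) • a) (L (0, 1) • b), hI.smul (L (1, 0)) a,
      hI.smul (L (0, 1)) b] with x h1 h2 h3
    rw [h1, h2, h3]
    have e : ((ell i t a x, ell i t b x) : ℝ × ℝ) =
        ell i t a x • ((1, 0) : ℝ × ℝ) + ell i t b x • ((0, 1) : ℝ × ℝ) := by simp
    rw [e, map_add, map_smul, map_smul, smul_eq_mul, smul_eq_mul]
    ring

lemma indepFun_projB_prod (hi : IsAbstractWiener i) (ht : 0 < t) (hE : InDual i E)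
    {W : WithLp 2 (H × H)} (ha : W.fst ∈ Eᗮ) (hb : W.snd ∈ Eᗮ) :
    IndepFun (Prod.map (projB i E) (projB i E)) (ell2 i t W) (wienerMeasure2 i t) := by
  have := isProbabilityMeasure_wienerMeasure hi ht
  have := isProbabilityMeasure_wienerMeasure2 hi ht
  have hI := isIsonormal_ell2 hi ht
  have q1 : Measure.QuasiMeasurePreserving Prod.fst (wienerMeasure2 i t) (wienerMeasure i t) :=
    Measure.quasiMeasurePreserving_fst
  have q2 : Measure.QuasiMeasurePreserving Prod.snd (wienerMeasure2 i t) (wienerMeasure i t) :=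
    Measure.quasiMeasurePreserving_snd
  refine hI.indepFun (U := pairSubmodule E)
    (measurePreserving_projB_prod hi ht hE).measurable (hI.measurable W) (fun L => ?_)
    (fun L => ⟨L 1 • W, Submodule.smul_mem _ _ ?_, ?_⟩)
  · set v := (InnerProductSpace.toDual ℝ E).symm (L ∘L ContinuousLinearMap.inl ℝ E E) with hv
    set w := (InnerProductSpace.toDual ℝ E).symm (L ∘L ContinuousLinearMap.inr ℝ E E) with hw
    refine ⟨WithLp.toLp 2 ((v : H), (w : H)), ⟨v.2, w.2⟩, ?_⟩
    filter_upwards [q1.ae (ell_ae_eq_functional hi ht (hE _ v.2)),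
      q2.ae (ell_ae_eq_functional hi ht (hE _ w.2))] with Z h1 h2
    simp only [ell2, WithLp.toLp_fst, WithLp.toLp_snd]
    rw [h1, h2, ← inner_projB hi hE, ← inner_projB hi hE, hv, hw,
      InnerProductSpace.toDual_symm_apply, InnerProductSpace.toDual_symm_apply,
      ContinuousLinearMap.comp_apply, ContinuousLinearMap.comp_apply, ← map_add]
    simp [Prod.map]
  · rw [Submodule.mem_orthogonal]
    rintro u ⟨hu1, hu2⟩
    rw [WithLp.prod_inner_apply]
    change ⟪u.fst, W.fst⟫ + ⟪u.snd, W.snd⟫ = 0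
    rw [(Submodule.mem_orthogonal _ _).1 ha _ hu1, (Submodule.mem_orthogonal _ _).1 hb _ hu2,
      add_zero]
  · filter_upwards [hI.smul (L 1) W] with ω hω
    rw [hω]
    conv_lhs => rw [← mul_one (ell2 i t W ω), ← smul_eq_mul, map_smul, smul_eq_mul, mul_comm]

variable {φ ψ : E → ℂ}

lemma integrable_wigner_comp (hi : IsAbstractWiener i) (hh : 0 < h) (hE : InDual i E)
    (hφ : φ ∈ schwartzGauss E h) (hψ : ψ ∈ schwartzGauss E h) :
    Integrable (fun Z : B × B => wignerHat h φ ψ (projB i E Z.1) (projB i E Z.2))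
      (wienerMeasure2 i (h / 2)) :=
  (measurePreserving_projB_prod hi (half_pos hh) hE).integrable_comp_of_integrable
    (integrable_wignerHat hh hφ hψ)

lemma integral_prod_comp {F : E × E → ℂ} (hi : IsAbstractWiener i) (ht : 0 < t) (hE : InDual i E)
    (hF : AEStronglyMeasurable F ((gaussMeasure E t).prod (gaussMeasure E t))) :
    ∫ Z, F (Prod.map (projB i E) (projB i E) Z) ∂(wienerMeasure2 i t) =
      ∫ p, F p ∂((gaussMeasure E t).prod (gaussMeasure E t)) := by
  have h1 := measurePreserving_projB_prod hi ht hE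
  rw [← h1.map_eq] at hF ⊢
  exact (integral_map h1.measurable.aemeasurable hF).symm

lemma integral_comp_projB {F : E → ℂ} (hi : IsAbstractWiener i) (ht : 0 < t) (hE : InDual i E)
    (hF : AEStronglyMeasurable F (gaussMeasure E t)) :
    ∫ u, F (projB i E u) ∂(wienerMeasure i t) = ∫ p, F p ∂(gaussMeasure E t) := by
  have h1 := measurePreserving_projB hi ht hE
  rw [← h1.map_eq] at hF ⊢
  exact (integral_map h1.measurable.aemeasurable hF).symm

/-- The Weyl form of `ℓ_W`, reduced to the finite-dimensional space `E`. -/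
lemma integral_ell2_mul_wigner (hi : IsAbstractWiener i) (hh : 0 < h) (hE : InDual i E)
    (hφ : φ ∈ schwartzGauss E h) (hψ : ψ ∈ schwartzGauss E h) (W : WithLp 2 (H × H)) :
    Integrable (fun Z : B × B => (ell2 i (h / 2) W Z : ℂ) *
        wignerHat h φ ψ (projB i E Z.1) (projB i E Z.2)) (wienerMeasure2 i (h / 2)) ∧
      ∫ Z : B × B, (ell2 i (h / 2) W Z : ℂ) * wignerHat h φ ψ (projB i E Z.1) (projB i E Z.2)
          ∂(wienerMeasure2 i (h / 2)) =
        ∫ x, ((((⟪E.orthogonalProjectionOnto W.fst, x⟫ : ℝ) : ℂ) + Complex.I *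
            ((⟪E.orthogonalProjectionOnto W.snd, x⟫ : ℝ) : ℂ)) * φ x +
          (h : ℂ) / Complex.I * fderiv ℝ φ x (E.orthogonalProjectionOnto W.snd)) * conj (ψ x)
            ∂(gaussMeasure E (h / 2)) := by
  have hh' := half_pos hh
  have := isProbabilityMeasure_wienerMeasure2 hi hh'
  have hI := isIsonormal_ell2 hi hh'
  set W' : WithLp 2 (H × H) :=
    WithLp.toLp 2 (W.fst - E.starProjection W.fst, W.snd - E.starProjection W.snd) with hW'
  obtain ⟨j1, j2⟩ := integral_linear_mul_wignerHat hh hφ hψ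
    (E.orthogonalProjectionOnto W.fst) (E.orthogonalProjectionOnto W.snd)
  have hmp := measurePreserving_projB_prod hi hh' hE
  have hind : IndepFun (Prod.map (projB i E) (projB i E)) (ell2 i (h / 2) W')
      (wienerMeasure2 i (h / 2)) :=
    indepFun_projB_prod hi hh' hE (Submodule.sub_starProjection_mem_orthogonal _)
      (Submodule.sub_starProjection_mem_orthogonal _)
  have hmw := measurable_wignerHat hh hφ hψ
  have hind2 : IndepFun (fun Z : B × B => wignerHat h φ ψ (projB i E Z.1) (projB i E Z.2))
      (fun Z => (ell2 i (h / 2) W' Z : ℂ)) (wienerMeasure2 i (h / 2)) :=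
    hind.comp (φ := fun p : E × E => wignerHat h φ ψ p.1 p.2) (ψ := fun x : ℝ => (x : ℂ)) hmw
      Complex.measurable_ofReal
  have hiw := integrable_wigner_comp hi hh hE hφ hψ
  have hil : Integrable (fun Z => (ell2 i (h / 2) W' Z : ℂ)) (wienerMeasure2 i (h / 2)) :=
    (hI.integrable hh' W').ofReal
  have k1 := hmp.integrable_comp_of_integrable j1
  have k2 := hind2.integrable_mul hiw hil
  have e : (fun Z : B × B => (ell2 i (h / 2) W Z : ℂ) *
      wignerHat h φ ψ (projB i E Z.1) (projB i E Z.2)) =ᵐ[wienerMeasure2 i (h / 2)]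
      fun Z => ((⟪E.orthogonalProjectionOnto W.fst, projB i E Z.1⟫ +
        ⟪E.orthogonalProjectionOnto W.snd, projB i E Z.2⟫ : ℝ) : ℂ) *
          wignerHat h φ ψ (projB i E Z.1) (projB i E Z.2) +
        wignerHat h φ ψ (projB i E Z.1) (projB i E Z.2) * (ell2 i (h / 2) W' Z : ℂ) := by
    filter_upwards [ell2_ae_eq_add hi hh' hE W] with Z hZ
    rw [hZ]
    push_cast
    ring
  refine ⟨(k1.add k2).congr e.symm, ?_⟩
  -- The independent remainder is centred and therefore drops out of the form.
  have h0 : ∫ Z, (ell2 i (h / 2) W' Z : ℂ) ∂(wienerMeasure2 i (h / 2)) = 0 := by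
    rw [integral_complex_ofReal, hI.integral_eq_zero hh', Complex.ofReal_zero]
  rw [integral_congr_ae e]
  have h1 := integral_prod_comp hi hh' hE j1.aestronglyMeasurable
  have h2 := hind2.integral_mul_eq_mul_integral hiw.aestronglyMeasurable hil.aestronglyMeasurable
  simp only [Pi.mul_apply] at h2
  refine (integral_add k1 k2).trans ?_
  simp only [Pi.mul_apply]
  rw [h2, h0, mul_zero, add_zero, ← j2, ← h1]
  rfl

lemma fderiv_comp_projB (hi : IsAbstractWiener i) (hh : 0 < h) (hE : InDual i E)
    (hφ : φ ∈ schwartzGauss E h) (u : B) (b : H) :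
    lineDeriv ℝ (φ ∘ projB i E) u (i b) =
      fderiv ℝ φ (projB i E u) (E.orthogonalProjectionOnto b) := by
  have h1 : HasFDerivAt φ (fderiv ℝ φ (projB i E u)) (projB i E u) :=
    ((contDiff_of_mem_schwartzGauss hh hφ).differentiable one_ne_zero _).hasFDerivAt
  have h2 := h1.comp u (projB i E).hasFDerivAt
  rw [(h2.hasLineDerivAt (i b)).lineDeriv, ContinuousLinearMap.comp_apply,
    projB_apply_coe hi hE]

set_option maxHeartbeats 400000 in
/-- The Segal field applied to a cylindrical function. -/
lemma segalField_comp_projB (hi : IsAbstractWiener i) (hh : 0 < h) (hE : InDual i E)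
    (hφ : φ ∈ schwartzGauss E h) (hψ : ψ ∈ schwartzGauss E h) (a b : H) :
    MemLp (segalField i h a b (φ ∘ projB i E)) 2 (wienerMeasure i (h / 2)) ∧
      l2Inner i h (segalField i h a b (φ ∘ projB i E)) (ψ ∘ projB i E) =
        ∫ x, ((((⟪E.orthogonalProjectionOnto a, x⟫ : ℝ) : ℂ) + Complex.I *
            ((⟪E.orthogonalProjectionOnto b, x⟫ : ℝ) : ℂ)) * φ x +
          (h : ℂ) / Complex.I * fderiv ℝ φ x (E.orthogonalProjectionOnto b)) * conj (ψ x)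
            ∂(gaussMeasure E (h / 2)) := by
  have hh' := half_pos hh
  have := isProbabilityMeasure_wienerMeasure hi hh'
  have hI := isIsonormal_ell hi hh'
  set a' := a - E.starProjection a
  set b' := b - E.starProjection b
  have hmp := measurePreserving_projB hi hh' hE
  set Φ : E → ℂ := fun x => (((⟪E.orthogonalProjectionOnto a, x⟫ : ℝ) : ℂ) + Complex.I *
            ((⟪E.orthogonalProjectionOnto b, x⟫ : ℝ) : ℂ)) * φ x +
          (h : ℂ) / Complex.I * fderiv ℝ φ x (E.orthogonalProjectionOnto b) with hΦ
  have hΦm : Φ ∈ schwartzGauss E h := segal_mem_schwartzGauss hh hφ _ _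
  have hind := indepFun_projB hi hh' hE (Submodule.sub_starProjection_mem_orthogonal a)
    (Submodule.sub_starProjection_mem_orthogonal (K := E) b)
  have hmφ := (contDiff_of_mem_schwartzGauss hh hφ).continuous
  have hmψ := (contDiff_of_mem_schwartzGauss hh hψ).continuous
  -- The part of `ℓ_{a+ib}` orthogonal to `E`: centred and independent of `P_E`, it vanishes from
  -- the scalar product with a cylindrical function.
  set Λ : B → ℂ := fun u => (ell i (h / 2) a' u : ℂ) + Complex.I * (ell i (h / 2) b' u : ℂ) with hΛ
  have e : segalField i h a b (φ ∘ projB i E) =ᵐ[wienerMeasure i (h / 2)]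
      (Φ ∘ projB i E) + fun u => φ (projB i E u) * Λ u := by
    filter_upwards [ell_ae_eq_add hi hh' hE a, ell_ae_eq_add hi hh' hE b] with u h1 h2
    rw [segalField, fderiv_comp_projB hi hh hE hφ, ellC, h1, h2]
    simp only [Pi.add_apply, Function.comp_apply, hΦ, hΛ]
    push_cast
    ring
  have m1 : MemLp (fun u => (ell i (h / 2) a' u : ℂ)) 2 (wienerMeasure i (h / 2)) :=
    (hI.memLp hh' a' ENNReal.ofNat_ne_top).ofReal
  have m2 : MemLp (fun u => Complex.I * (ell i (h / 2) b' u : ℂ)) 2 (wienerMeasure i (h / 2)) :=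
    MemLp.const_mul (hI.memLp hh' b' ENNReal.ofNat_ne_top).ofReal _
  have hΛ2 : MemLp Λ 2 (wienerMeasure i (h / 2)) := m1.add m2
  have hΛ0 : ∫ u, Λ u ∂(wienerMeasure i (h / 2)) = 0 := by
    rw [hΛ, integral_add (m1.integrable one_le_two) (m2.integrable one_le_two),
      integral_const_mul, integral_complex_ofReal, integral_complex_ofReal,
      hI.integral_eq_zero hh', hI.integral_eq_zero hh']
    simp
  have hφ2 := (memLp_of_mem_schwartzGauss hh hφ).comp_measurePreserving hmp
  have hψ2 := (memLp_of_mem_schwartzGauss hh hψ).comp_measurePreserving hmp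
  have hΦ2 := (memLp_of_mem_schwartzGauss hh hΦm).comp_measurePreserving hmp
  -- A product of two `L²` functions need not be in `L²`; here independence of the squared moduli
  -- makes it so.
  have hprod : MemLp (fun u => φ (projB i E u) * Λ u) 2 (wienerMeasure i (h / 2)) := by
    refine (memLp_two_iff_integrable_sq_norm
      (hφ2.aestronglyMeasurable.mul hΛ2.aestronglyMeasurable)).2 ?_
    have hind2 : IndepFun (fun u => ‖φ (projB i E u)‖ ^ 2) (fun u => ‖Λ u‖ ^ 2)
        (wienerMeasure i (h / 2)) :=
      hind.comp (φ := fun x => ‖φ x‖ ^ 2)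
        (ψ := fun p : ℝ × ℝ => ‖(p.1 : ℂ) + Complex.I * (p.2 : ℂ)‖ ^ 2)
        (Continuous.measurable (by fun_prop)) (Continuous.measurable (by fun_prop))
    have h1 := hind2.integrable_mul
      ((memLp_two_iff_integrable_sq_norm hφ2.aestronglyMeasurable).1 hφ2)
      ((memLp_two_iff_integrable_sq_norm hΛ2.aestronglyMeasurable).1 hΛ2)
    refine h1.congr (ae_of_all _ fun u => ?_)
    simp only [Pi.mul_apply, Function.comp_apply, norm_mul, mul_pow]
  refine ⟨MemLp.ae_eq e.symm (hΦ2.add hprod), ?_⟩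
  have hind3 : IndepFun (fun u => φ (projB i E u) * conj (ψ (projB i E u))) Λ
      (wienerMeasure i (h / 2)) :=
    hind.comp (φ := fun x => φ x * conj (ψ x))
      (ψ := fun p : ℝ × ℝ => (p.1 : ℂ) + Complex.I * (p.2 : ℂ))
      (Continuous.measurable (by fun_prop)) (Continuous.measurable (by fun_prop))
  have k0 : Integrable (fun u => φ (projB i E u) * conj (ψ (projB i E u)))
      (wienerMeasure i (h / 2)) := hφ2.integrable_mul hψ2.star
  have k1 : Integrable (fun u => Φ (projB i E u) * conj (ψ (projB i E u)))
      (wienerMeasure i (h / 2)) := hΦ2.integrable_mul hψ2.star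
  have kΛ : Integrable Λ (wienerMeasure i (h / 2)) := hΛ2.integrable one_le_two
  have k2 : Integrable (fun u => (φ (projB i E u) * conj (ψ (projB i E u))) * Λ u)
      (wienerMeasure i (h / 2)) := hind3.integrable_mul k0 kΛ
  have e2 : (fun u => segalField i h a b (φ ∘ projB i E) u * conj ((ψ ∘ projB i E) u))
      =ᵐ[wienerMeasure i (h / 2)] fun u => Φ (projB i E u) * conj (ψ (projB i E u)) +
        (φ (projB i E u) * conj (ψ (projB i E u))) * Λ u := by
    filter_upwards [e] with u hu
    rw [hu]
    simp only [Pi.add_apply, Function.comp_apply]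
    ring
  have h2 := hind3.integral_mul_eq_mul_integral k0.aestronglyMeasurable kΛ.aestronglyMeasurable
  simp only [Pi.mul_apply] at h2
  have hmΦ := (contDiff_of_mem_schwartzGauss hh hΦm).continuous
  rw [l2Inner, integral_congr_ae e2, integral_add k1 k2, h2, hΛ0, mul_zero, add_zero]
  exact integral_comp_projB (F := fun x => Φ x * conj (ψ x)) hi hh' hE
    (Continuous.aestronglyMeasurable (by fun_prop))

/-- The plane wave factors along the splitting, and its orthogonal part contributes only a
characteristic function. -/
lemma integral_cexp_ell2_mul_wigner_eq (hi : IsAbstractWiener i) (hh : 0 < h) (hE : InDual i E)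
    (hφ : φ ∈ schwartzGauss E h) (hψ : ψ ∈ schwartzGauss E h) (W : WithLp 2 (H × H)) :
    ∫ Z : B × B, Complex.exp (Complex.I * (ell2 i (h / 2) W Z : ℂ)) *
        wignerHat h φ ψ (projB i E Z.1) (projB i E Z.2) ∂(wienerMeasure2 i (h / 2)) =
      (∫ p : E × E, Complex.exp (Complex.I * ((⟪E.orthogonalProjectionOnto W.fst, p.1⟫ +
        ⟪E.orthogonalProjectionOnto W.snd, p.2⟫ : ℝ) : ℂ)) * wignerHat h φ ψ p.1 p.2
          ∂((gaussMeasure E (h / 2)).prod (gaussMeasure E (h / 2)))) *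
        ((Real.exp (-(h / 2) * ‖(WithLp.toLp 2 (W.fst - E.starProjection W.fst,
          W.snd - E.starProjection W.snd) : WithLp 2 (H × H))‖ ^ 2 / 2) : ℝ) : ℂ) := by
  have hh' := half_pos hh
  have := isProbabilityMeasure_wienerMeasure2 hi hh'
  have hI2 := isIsonormal_ell2 hi hh'
  set W' : WithLp 2 (H × H) :=
    WithLp.toLp 2 (W.fst - E.starProjection W.fst, W.snd - E.starProjection W.snd) with hW'
  have hmw := measurable_wignerHat hh hφ hψ
  have hind : IndepFun (Prod.map (projB i E) (projB i E)) (ell2 i (h / 2) W')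
      (wienerMeasure2 i (h / 2)) :=
    indepFun_projB_prod hi hh' hE (Submodule.sub_starProjection_mem_orthogonal _)
      (Submodule.sub_starProjection_mem_orthogonal _)
  have hm2 := (measurePreserving_projB_prod hi hh' hE).measurable
  rw [← hI2.integral_cexp,
    ← integral_prod_comp hi hh' hE (Measurable.aestronglyMeasurable (by fun_prop)),
    ← hind.integral_fun_comp_mul_comp
    (f := fun p : E × E => Complex.exp (Complex.I * ((⟪E.orthogonalProjectionOnto W.fst, p.1⟫ +
      ⟪E.orthogonalProjectionOnto W.snd, p.2⟫ : ℝ) : ℂ)) * wignerHat h φ ψ p.1 p.2)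
    (g := fun x : ℝ => Complex.exp (Complex.I * (x : ℂ)))
    hm2.aemeasurable (hI2.measurable _).aemeasurable
    (Measurable.aestronglyMeasurable (by fun_prop))
    (Measurable.aestronglyMeasurable (by fun_prop))]
  refine integral_congr_ae ?_
  filter_upwards [ell2_ae_eq_add hi hh' hE W] with Z hZ
  rw [hZ]
  simp only [Prod.map]
  rw [mul_right_comm, ← Complex.exp_add]
  congr 2
  push_cast
  ring

/-- The versions `ℓ_W` have no pointwise regularity in `W`. Continuity is visible after
factorisation: dominated convergence in the finite-dimensional factor, an explicit Gaussian in the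
other. -/
lemma continuous_integral_cexp_ell2_mul_wigner (hi : IsAbstractWiener i) (hh : 0 < h)
    (hE : InDual i E) (hφ : φ ∈ schwartzGauss E h) (hψ : ψ ∈ schwartzGauss E h) :
    Continuous fun W : WithLp 2 (H × H) =>
      ∫ Z : B × B, Complex.exp (Complex.I * (ell2 i (h / 2) W Z : ℂ)) *
        wignerHat h φ ψ (projB i E Z.1) (projB i E Z.2) ∂(wienerMeasure2 i (h / 2)) := by
  simp only [integral_cexp_ell2_mul_wigner_eq hi hh hE hφ hψ]
  have hint := integrable_wignerHat hh hφ hψ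
  have hmw := measurable_wignerHat hh hφ hψ
  have hc : Continuous fun q : E × E => ∫ p : E × E,
      Complex.exp (Complex.I * ((⟪q.1, p.1⟫ + ⟪q.2, p.2⟫ : ℝ) : ℂ)) * wignerHat h φ ψ p.1 p.2
        ∂((gaussMeasure E (h / 2)).prod (gaussMeasure E (h / 2))) := by
    refine continuous_of_dominated (fun q => Measurable.aestronglyMeasurable (by fun_prop))
      (fun q => ae_of_all _ fun p => ?_) hint.norm (ae_of_all _ fun p => by fun_prop)
    rw [norm_mul, mul_comm Complex.I, Complex.norm_exp_ofReal_mul_I, one_mul]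
  have h1 : Continuous fun W : WithLp 2 (H × H) => W.fst := WithLp.continuous_fst ..
  have h2 : Continuous fun W : WithLp 2 (H × H) => W.snd := WithLp.continuous_snd ..
  refine (hc.comp (f := fun W : WithLp 2 (H × H) => (E.orthogonalProjectionOnto W.fst,
    E.orthogonalProjectionOnto W.snd)) (by fun_prop)).mul ?_
  have h3 : Continuous fun W : WithLp 2 (H × H) => (WithLp.toLp 2 (W.fst - E.starProjection W.fst,
      W.snd - E.starProjection W.snd) : WithLp 2 (H × H)) :=
    (WithLp.prod_continuous_toLp 2 H H).comp (by fun_prop)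
  fun_prop

/-- The Weyl form of the plane wave `exp(i ℓ_W)`. -/
lemma integral_cexp_ell2_mul_wigner (hi : IsAbstractWiener i) (hh : 0 < h) (hE : InDual i E)
    (hφ : φ ∈ schwartzGauss E h) (hψ : ψ ∈ schwartzGauss E h) (W : WithLp 2 (H × H)) :
    ∫ Z : B × B, Complex.exp (Complex.I * (ell2 i (h / 2) W Z : ℂ)) *
        wignerHat h φ ψ (projB i E Z.1) (projB i E Z.2) ∂(wienerMeasure2 i (h / 2)) =
      l2Inner i h (weylU i h W.fst W.snd (φ ∘ projB i E)) (ψ ∘ projB i E) := by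
  have hh' := half_pos hh
  have := isProbabilityMeasure_wienerMeasure hi hh'
  have hI := isIsonormal_ell hi hh'
  set a := W.fst with ha
  set b := W.snd with hb
  set a₀ := E.orthogonalProjectionOnto a with ha₀
  set b₀ := E.orthogonalProjectionOnto b with hb₀
  set a' := a - E.starProjection a with ha'
  set b' := b - E.starProjection b with hb'
  set W' : WithLp 2 (H × H) := WithLp.toLp 2 (a', b') with hW'
  have hmφ := (contDiff_of_mem_schwartzGauss hh hφ).continuous
  have hmψ := (contDiff_of_mem_schwartzGauss hh hψ).continuous
  have hind' := indepFun_projB hi hh' hE (Submodule.sub_starProjection_mem_orthogonal a)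
    (Submodule.sub_starProjection_mem_orthogonal (K := E) b)
  have hm1 := (measurePreserving_projB hi hh' hE).measurable
  have e1 : ∫ Z : B × B, Complex.exp (Complex.I * (ell2 i (h / 2) W Z : ℂ)) *
        wignerHat h φ ψ (projB i E Z.1) (projB i E Z.2) ∂(wienerMeasure2 i (h / 2)) =
      (∫ u, Complex.exp (-((h / 2 * ‖b₀‖ ^ 2 : ℝ) : ℂ) + Complex.I * ((h / 2 * ⟪a₀, b₀⟫ : ℝ) : ℂ) +
        Complex.I * (((⟪a₀, u⟫ : ℝ) : ℂ) + Complex.I * ((⟪b₀, u⟫ : ℝ) : ℂ))) * φ (u + h • b₀) *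
        conj (ψ u) ∂(gaussMeasure E (h / 2))) *
        ((Real.exp (-(h / 2) * ‖W'‖ ^ 2 / 2) : ℝ) : ℂ) := by
    rw [← integral_cexp_mul_wignerHat hh hφ hψ, integral_cexp_ell2_mul_wigner_eq hi hh hE hφ hψ]
  -- `i(ℓ_{a'} + i ℓ_{b'}) = ℓ_{-b'} + i ℓ_{a'}` brings the remainder to the form of the complex
  -- moment.
  have e2 : ∫ u, Complex.exp ((ell i (h / 2) (-b') u : ℂ) + Complex.I * (ell i (h / 2) a' u : ℂ))
      ∂(wienerMeasure i (h / 2)) =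
      ∫ u, Complex.exp (Complex.I * ((ell i (h / 2) a' u : ℂ) +
        Complex.I * (ell i (h / 2) b' u : ℂ))) ∂(wienerMeasure i (h / 2)) := by
    refine integral_congr_ae ?_
    filter_upwards [hI.smul (-1) b'] with u hu
    rw [neg_one_smul] at hu
    rw [hu]
    congr 1
    push_cast
    linear_combination -(ell i (h / 2) b' u : ℂ) * Complex.I_sq
  rw [hI.integral_cexp_add_I_mul hh'] at e2
  have e3 : l2Inner i h (weylU i h a b (φ ∘ projB i E)) (ψ ∘ projB i E) =
      (∫ u, Complex.exp (Complex.I * (((⟪a₀, u⟫ : ℝ) : ℂ) + Complex.I * ((⟪b₀, u⟫ : ℝ) : ℂ))) *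
        φ (u + h • b₀) * conj (ψ u) ∂(gaussMeasure E (h / 2))) *
      (∫ u, Complex.exp (Complex.I * ((ell i (h / 2) a' u : ℂ) +
        Complex.I * (ell i (h / 2) b' u : ℂ))) ∂(wienerMeasure i (h / 2))) *
      Complex.exp (-((h / 2 * ‖b‖ ^ 2 : ℝ) : ℂ) + Complex.I * ((h / 2 * ⟪a, b⟫ : ℝ) : ℂ)) := by
    rw [← integral_comp_projB hi hh' hE (Continuous.aestronglyMeasurable (by fun_prop)),
      ← hind'.integral_fun_comp_mul_comp
      (f := fun u : E => Complex.exp (Complex.I * (((⟪a₀, u⟫ : ℝ) : ℂ) +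
        Complex.I * ((⟪b₀, u⟫ : ℝ) : ℂ))) * φ (u + h • b₀) * conj (ψ u))
      (g := fun p : ℝ × ℝ => Complex.exp (Complex.I * ((p.1 : ℂ) + Complex.I * (p.2 : ℂ))))
      hm1.aemeasurable ((hI.measurable _).prodMk (hI.measurable _)).aemeasurable
      (Continuous.aestronglyMeasurable (by fun_prop))
      (Continuous.aestronglyMeasurable (by fun_prop)), ← integral_mul_const, l2Inner]
    refine integral_congr_ae ?_
    filter_upwards [ell_ae_eq_add hi hh' hE a, ell_ae_eq_add hi hh' hE b] with u h1 h2
    simp only [weylU, ellC, Function.comp_apply]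
    rw [h1, h2, map_add, map_smul, projB_apply_coe hi hE, ← ha₀, ← hb₀, ← ha', ← hb']
    have e4 : Complex.exp (-((h / 2 * ‖b‖ ^ 2 : ℝ) : ℂ) + Complex.I * ((h / 2 * ⟪a, b⟫ : ℝ) : ℂ) +
        Complex.I * (((⟪a₀, projB i E u⟫ + ell i (h / 2) a' u : ℝ) : ℂ) +
          Complex.I * ((⟪b₀, projB i E u⟫ + ell i (h / 2) b' u : ℝ) : ℂ))) =
        Complex.exp (Complex.I * (((⟪a₀, projB i E u⟫ : ℝ) : ℂ) +
          Complex.I * ((⟪b₀, projB i E u⟫ : ℝ) : ℂ))) *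
        Complex.exp (Complex.I * ((ell i (h / 2) a' u : ℂ) +
          Complex.I * (ell i (h / 2) b' u : ℂ))) *
        Complex.exp (-((h / 2 * ‖b‖ ^ 2 : ℝ) : ℂ) + Complex.I * ((h / 2 * ⟪a, b⟫ : ℝ) : ℂ)) := by
      rw [← Complex.exp_add, ← Complex.exp_add]
      congr 1
      push_cast
      ring
    rw [e4]
    ring
  rw [e1, e3, ← e2]
  have e5 : ∫ u, Complex.exp (-((h / 2 * ‖b₀‖ ^ 2 : ℝ) : ℂ) +
        Complex.I * ((h / 2 * ⟪a₀, b₀⟫ : ℝ) : ℂ) +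
        Complex.I * (((⟪a₀, u⟫ : ℝ) : ℂ) + Complex.I * ((⟪b₀, u⟫ : ℝ) : ℂ))) * φ (u + h • b₀) *
        conj (ψ u) ∂(gaussMeasure E (h / 2)) =
      Complex.exp (-((h / 2 * ‖b₀‖ ^ 2 : ℝ) : ℂ) + Complex.I * ((h / 2 * ⟪a₀, b₀⟫ : ℝ) : ℂ)) *
      ∫ u, Complex.exp (Complex.I * (((⟪a₀, u⟫ : ℝ) : ℂ) + Complex.I * ((⟪b₀, u⟫ : ℝ) : ℂ))) *
        φ (u + h • b₀) * conj (ψ u) ∂(gaussMeasure E (h / 2)) := by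
    rw [← integral_const_mul]
    refine integral_congr_ae (ae_of_all _ fun u => ?_)
    simp only
    rw [Complex.exp_add]
    ring
  rw [e5, mul_assoc, mul_comm (Complex.exp _), mul_assoc, mul_assoc]
  congr 1
  rw [Complex.ofReal_exp, ← Complex.exp_add, ← Complex.exp_add]
  congr 1
  -- Matching of constants: the moment supplies `(h/4)(|b'|² - |a'|²) - (ih/2) a'·b'`. Added to the
  -- orthogonal part `-(h/2)|b'|² + (ih/2) a'·b'` of the prefactor, it leaves `-(h/4)(|a'|² +
  -- |b'|²)`, the exponent on the Wigner side.
  have hab : ⟪a, b⟫ = ⟪a₀, b₀⟫ + ⟪a', b'⟫ := by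
    have o1 : ⟪(a₀ : H), b'⟫ = 0 :=
      (Submodule.mem_orthogonal _ _).1 (Submodule.sub_starProjection_mem_orthogonal b) _ a₀.2
    have o2 : ⟪a', (b₀ : H)⟫ = 0 := by
      rw [real_inner_comm]
      exact (Submodule.mem_orthogonal _ _).1 (Submodule.sub_starProjection_mem_orthogonal a) _ b₀.2
    have d1 : a = (a₀ : H) + a' := by rw [ha']; change a = E.starProjection a + _; abel
    have d2 : b = (b₀ : H) + b' := by rw [hb']; change b = E.starProjection b + _; abel
    conv_lhs => rw [d1, d2]
    rw [inner_add_left, inner_add_right, inner_add_right, o1, o2, Submodule.coe_inner]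
    ring
  have hbb : ‖b‖ ^ 2 = ‖b₀‖ ^ 2 + ‖b'‖ ^ 2 := by
    have o1 : ⟪(b₀ : H), b'⟫ = 0 :=
      (Submodule.mem_orthogonal _ _).1 (Submodule.sub_starProjection_mem_orthogonal b) _ b₀.2
    have d2 : b = (b₀ : H) + b' := by rw [hb']; change b = E.starProjection b + _; abel
    conv_lhs => rw [d2]
    rw [norm_add_sq_real, o1, Submodule.coe_norm]
    ring
  have hWW : ‖W'‖ ^ 2 = ‖a'‖ ^ 2 + ‖b'‖ ^ 2 := WithLp.prod_norm_sq_eq_of_L2 _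
  rw [hab, hbb, hWW, norm_neg, inner_neg_left, real_inner_comm b' a']
  push_cast
  ring

end Cylinder

end WienerWeyl

namespace WienerWeyl

/-! ### Superpositions of plane waves -/

section FourierSymbol

variable {H : Type*} [NormedAddCommGroup H] [InnerProductSpace ℝ H]
  [SecondCountableTopology H] [MeasurableSpace H] [BorelSpace H]

/-- The plane wave on `H²` with frequency `X`. -/
noncomputable def planeWave (X Y : H × H) : ℂ :=
  Complex.exp (Complex.I * ((⟪X.1, Y.1⟫ + ⟪X.2, Y.2⟫ : ℝ) : ℂ))

lemma norm_planeWave (X Y : H × H) : ‖planeWave X Y‖ = 1 := by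
  rw [planeWave, mul_comm, Complex.norm_exp_ofReal_mul_I]

lemma continuous_planeWave : Continuous fun p : (H × H) × (H × H) => planeWave p.1 p.2 := by
  unfold planeWave; fun_prop

/-- The Fourier transform of the measure `θ m`. -/
noncomputable def fourierSymbol (m : Measure (H × H)) (θ : H × H → ℂ) (Y : H × H) : ℂ :=
  ∫ X, planeWave X Y * θ X ∂m

variable {m : Measure (H × H)} [IsFiniteMeasure m] {θ : H × H → ℂ}

lemma integrable_planeWave_mul (hθ : Integrable θ m) (Y : H × H) :
    Integrable (fun X => planeWave X Y * θ X) m := by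
  refine hθ.bdd_mul (c := 1) ?_ (ae_of_all _ fun X => (norm_planeWave X Y).le)
  exact (continuous_planeWave.comp (Continuous.prodMk_left Y)).aestronglyMeasurable

lemma norm_fourierSymbol_le (Y : H × H) : ‖fourierSymbol m θ Y‖ ≤ ∫ X, ‖θ X‖ ∂m := by
  refine (norm_integral_le_integral_norm _).trans_eq ?_
  simp only [norm_mul, norm_planeWave, one_mul]

lemma measurable_fourierSymbol (hm : Measurable θ) : Measurable (fourierSymbol m θ) := by
  have h1 : StronglyMeasurable fun p : (H × H) × (H × H) => planeWave p.2 p.1 * θ p.2 :=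
    (Measurable.mul ((continuous_planeWave.comp continuous_swap).measurable)
      (hm.comp measurable_snd)).stronglyMeasurable
  exact h1.integral_prod_right'.measurable

variable {Ω : Type*} [MeasurableSpace Ω] {P : Measure Ω} [IsProbabilityMeasure P]

lemma measurable_planeWave_comp {S : Ω → H × H} (hS : Measurable S) :
    Measurable fun p : Ω × (H × H) => planeWave p.2 (S p.1) :=
  continuous_planeWave.measurable.comp (measurable_snd.prodMk (hS.comp measurable_fst))

lemma integral_fourierSymbol_mul (hθ : Integrable θ m) {S : Ω → H × H}
    (hS : Measurable S) {w : Ω → ℂ} (hw : Integrable w P) :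
    ∫ ω, fourierSymbol m θ (S ω) * w ω ∂P =
      ∫ X, (∫ ω, planeWave X (S ω) * w ω ∂P) * θ X ∂m := by
  have hint : Integrable (fun p : Ω × (H × H) => planeWave p.2 (S p.1) * (w p.1 * θ p.2))
      (P.prod m) := by
    refine (hw.mul_prod hθ).bdd_mul (c := 1)
      (measurable_planeWave_comp hS).aestronglyMeasurable
      (ae_of_all _ fun p => (norm_planeWave _ _).le)
  have h1 := integral_integral_swap (f := fun ω X => planeWave X (S ω) * (w ω * θ X)) hint
  calc _ = ∫ ω, ∫ X, planeWave X (S ω) * (w ω * θ X) ∂m ∂P := by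
        refine integral_congr_ae (ae_of_all _ fun ω => ?_)
        simp only [fourierSymbol]
        rw [← integral_mul_const]
        exact integral_congr_ae (ae_of_all _ fun X => by simp only; ring)
    _ = _ := h1
    _ = _ := by
        refine integral_congr_ae (ae_of_all _ fun X => ?_)
        simp only
        rw [← integral_mul_const]
        exact integral_congr_ae (ae_of_all _ fun X => by simp only; ring)

/-- An almost sure limit of a Fourier transform composed with random variables: it is bounded,
and its pairings with integrable functions are obtained from those of the plane waves. -/
lemma integral_mul_of_ae_tendsto (hm : Measurable θ) (hθ : Integrable θ m)
    {S : ℕ → Ω → H × H} (hS : ∀ n, Measurable (S n)) {G : Ω → ℂ}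
    (hae : ∀ᵐ ω ∂P, Tendsto (fun n => fourierSymbol m θ (S n ω)) atTop (𝓝 (G ω))) :
    (∀ᵐ ω ∂P, ‖G ω‖ ≤ ∫ X, ‖θ X‖ ∂m) ∧
      ∀ (w : Ω → ℂ) (κ : H × H → ℂ), Integrable w P →
        (∀ X, Tendsto (fun n => ∫ ω, planeWave X (S n ω) * w ω ∂P) atTop (𝓝 (κ X))) →
        Integrable (fun ω => G ω * w ω) P ∧ ∫ ω, G ω * w ω ∂P = ∫ X, κ X * θ X ∂m := by
  have hb : ∀ᵐ ω ∂P, ‖G ω‖ ≤ ∫ X, ‖θ X‖ ∂m := by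
    filter_upwards [hae] with ω hω
    exact le_of_tendsto hω.norm (Eventually.of_forall fun k => norm_fourierSymbol_le _)
  have hmeas : ∀ n, Measurable fun ω => fourierSymbol m θ (S n ω) := fun n =>
    (measurable_fourierSymbol hm).comp (hS n)
  have hGm : AEStronglyMeasurable G P :=
    aestronglyMeasurable_of_tendsto_ae atTop (fun k => (hmeas k).aestronglyMeasurable) hae
  refine ⟨hb, fun w κ hw hκ => ⟨hw.bdd_mul hGm hb, ?_⟩⟩
  have l1 : Tendsto (fun k => ∫ ω, fourierSymbol m θ (S k ω) * w ω ∂P) atTop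
      (𝓝 (∫ ω, G ω * w ω ∂P)) := by
    refine tendsto_integral_of_dominated_convergence (fun ω => (∫ X, ‖θ X‖ ∂m) * ‖w ω‖)
      (fun k => (hmeas _).aestronglyMeasurable.mul hw.aestronglyMeasurable)
      (hw.norm.const_mul _) (fun k => ae_of_all _ fun ω => ?_) ?_
    · rw [norm_mul]
      gcongr
      exact norm_fourierSymbol_le _
    · filter_upwards [hae] with ω hω
      exact hω.mul_const _
  have l2 : Tendsto (fun k => ∫ X, (∫ ω, planeWave X (S k ω) * w ω ∂P) * θ X ∂m) atTop
      (𝓝 (∫ X, κ X * θ X ∂m)) := by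
    refine tendsto_integral_of_dominated_convergence (fun X => (∫ ω, ‖w ω‖ ∂P) * ‖θ X‖)
      (fun k => ?_) (hθ.norm.const_mul _) (fun k => ae_of_all _ fun X => ?_)
      (ae_of_all _ fun X => ?_)
    · refine AEStronglyMeasurable.mul ?_ hθ.aestronglyMeasurable
      refine AEStronglyMeasurable.integral_prod_right' (μ := m) (ν := P)
        (f := fun p : (H × H) × Ω => planeWave p.1 (S k p.2) * w p.2) ?_
      refine AEStronglyMeasurable.mul ?_ hw.aestronglyMeasurable.comp_snd
      exact ((measurable_planeWave_comp (hS k)).comp measurable_swap).aestronglyMeasurable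
    · rw [norm_mul]
      gcongr
      refine (norm_integral_le_integral_norm _).trans_eq ?_
      simp only [norm_mul, norm_planeWave, one_mul]
    · exact (hκ X).mul_const _
  simp only [integral_fourierSymbol_mul hθ (hS _) hw] at l1
  exact tendsto_nhds_unique l1 l2

/-- Fubini transfers an `L¹` estimate for plane waves to their superposition; the cap `2` keeps `δ`
integrable against `|θ|`. -/
lemma integral_norm_fourierSymbol_sub_le (hθ : Integrable θ m)
    {S S' : Ω → H × H} (hS : Measurable S) (hS' : Measurable S') {δ : H × H → ℝ}
    (hδm : Measurable δ) (hδ2 : ∀ X, δ X ≤ 2)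
    (hδ : ∀ X, ∫ ω, ‖planeWave X (S ω) - planeWave X (S' ω)‖ ∂P ≤ δ X) :
    ∫ ω, ‖fourierSymbol m θ (S ω) - fourierSymbol m θ (S' ω)‖ ∂P ≤ ∫ X, δ X * ‖θ X‖ ∂m := by
  have hδ0 : ∀ X, 0 ≤ δ X := fun X => (integral_nonneg fun _ => norm_nonneg _).trans (hδ X)
  have hint : Integrable (fun p : Ω × (H × H) =>
      ‖planeWave p.2 (S p.1) - planeWave p.2 (S' p.1)‖ * ‖θ p.2‖) (P.prod m) := by
    refine (hθ.norm.comp_snd P).bdd_mul (c := 2)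
      ((measurable_planeWave_comp hS).sub (measurable_planeWave_comp hS')).norm.aestronglyMeasurable
      (ae_of_all _ fun p => ?_)
    rw [norm_norm]
    refine (norm_sub_le _ _).trans ?_
    rw [norm_planeWave, norm_planeWave]
    norm_num
  calc _ ≤ ∫ ω, ∫ X, ‖planeWave X (S ω) - planeWave X (S' ω)‖ * ‖θ X‖ ∂m ∂P := by
        refine integral_mono_of_nonneg (ae_of_all _ fun _ => norm_nonneg _)
          hint.integral_prod_left (ae_of_all _ fun ω => ?_)
        simp only [fourierSymbol]
        rw [← integral_sub (integrable_planeWave_mul hθ _) (integrable_planeWave_mul hθ _)]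
        refine (norm_integral_le_integral_norm _).trans_eq ?_
        simp only [← sub_mul, norm_mul]
    _ = ∫ X, ∫ ω, ‖planeWave X (S ω) - planeWave X (S' ω)‖ * ‖θ X‖ ∂P ∂m :=
        integral_integral_swap hint
    _ ≤ _ := by
        refine integral_mono hint.integral_prod_right
          (hθ.norm.bdd_mul (c := 2) hδm.aestronglyMeasurable (ae_of_all _ fun X => ?_))
          fun X => ?_
        · rw [Real.norm_eq_abs, abs_of_nonneg (hδ0 X)]
          exact hδ2 X
        · simp only
          rw [integral_mul_const]
          exact mul_le_mul_of_nonneg_right (hδ X) (norm_nonneg _)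

end FourierSymbol

end WienerWeyl

namespace WienerWeyl

/-! ### Stochastic extension of a Fourier transform -/

section FourierExtension

variable {H B : Type*} [NormedAddCommGroup H] [InnerProductSpace ℝ H] [CompleteSpace H]
  [TopologicalSpace.SeparableSpace H] [MeasurableSpace H] [BorelSpace H]
  [NormedAddCommGroup B] [NormedSpace ℝ B] [CompleteSpace B]
  [MeasurableSpace B] [BorelSpace B] {i : H →L[ℝ] B} {t h : ℝ}

/-- The Wigner-Gauss function is computed in one chosen representation. Working in that same
representation makes a comparison between representations unnecessary. -/
lemma exists_wignerGauss_eq (hi : IsAbstractWiener i) (hh : 0 < h) {f g : B → ℂ}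
    (hf : f ∈ testSpace i h) (hg : g ∈ testSpace i h) :
    ∃ (E : Submodule ℝ H) (_ : FiniteDimensional ℝ E) (φ ψ : E → ℂ), InDual i E ∧
      φ ∈ schwartzGauss E h ∧ ψ ∈ schwartzGauss E h ∧ f = φ ∘ projB i E ∧ g = ψ ∘ projB i E ∧
      wignerGauss i h f g = fun Z => wignerHat h φ ψ (projB i E Z.1) (projB i E Z.2) := by
  have hr := nonempty_commonRep hi hh hf hg
  set r := Classical.choice hr with hr'
  refine ⟨r.E, r.finDim, r.φ, r.ψ, r.inDual, r.φ_mem, r.ψ_mem, r.eq_left, r.eq_right, ?_⟩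
  rw [wignerGauss, dif_pos hr]
  rfl

lemma integrable_wignerGauss (hi : IsAbstractWiener i) (hh : 0 < h) {f g : B → ℂ}
    (hf : f ∈ testSpace i h) (hg : g ∈ testSpace i h) :
    Integrable (wignerGauss i h f g) (wienerMeasure2 i (h / 2)) := by
  obtain ⟨E, _, φ, ψ, hE, hφ, hψ, -, -, hW⟩ := exists_wignerGauss_eq hi hh hf hg
  rw [hW]
  exact integrable_wigner_comp hi hh hE hφ hψ

lemma integral_cexp_ell2_mul_wignerGauss (hi : IsAbstractWiener i) (hh : 0 < h) {f g : B → ℂ}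
    (hf : f ∈ testSpace i h) (hg : g ∈ testSpace i h) (W : WithLp 2 (H × H)) :
    ∫ Z, Complex.exp (Complex.I * (ell2 i (h / 2) W Z : ℂ)) * wignerGauss i h f g Z
        ∂(wienerMeasure2 i (h / 2)) = l2Inner i h (weylU i h W.fst W.snd f) g := by
  obtain ⟨E, _, φ, ψ, hE, hφ, hψ, rfl, rfl, hW⟩ := exists_wignerGauss_eq hi hh hf hg
  rw [hW]
  exact integral_cexp_ell2_mul_wigner hi hh hE hφ hψ W

/-- Continuity is read on the Wigner side, where the dependence on `W` is explicit. -/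
lemma continuous_l2Inner_weylU (hi : IsAbstractWiener i) (hh : 0 < h) {f g : B → ℂ}
    (hf : f ∈ testSpace i h) (hg : g ∈ testSpace i h) :
    Continuous fun W : WithLp 2 (H × H) => l2Inner i h (weylU i h W.fst W.snd f) g := by
  simp only [← integral_cexp_ell2_mul_wignerGauss hi hh hf hg]
  obtain ⟨E, _, φ, ψ, hE, hφ, hψ, -, -, hW⟩ := exists_wignerGauss_eq hi hh hf hg
  rw [hW]
  exact continuous_integral_cexp_ell2_mul_wigner hi hh hE hφ hψ

lemma continuous_l2Inner_weylU_prod (hi : IsAbstractWiener i) (hh : 0 < h) {f g : B → ℂ}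
    (hf : f ∈ testSpace i h) (hg : g ∈ testSpace i h) :
    Continuous fun X : H × H => l2Inner i h (weylU i h X.1 X.2 f) g :=
  (continuous_l2Inner_weylU hi hh hf hg).comp (WithLp.prod_continuous_toLp 2 H H)

lemma norm_l2Inner_weylU_le (hi : IsAbstractWiener i) (hh : 0 < h) {f g : B → ℂ}
    (hf : f ∈ testSpace i h) (hg : g ∈ testSpace i h) (X : H × H) :
    ‖l2Inner i h (weylU i h X.1 X.2 f) g‖ ≤
      ∫ Z, ‖wignerGauss i h f g Z‖ ∂(wienerMeasure2 i (h / 2)) := by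
  have h0 := integral_cexp_ell2_mul_wignerGauss hi hh hf hg (WithLp.toLp 2 X)
  change _ = l2Inner i h (weylU i h X.1 X.2 f) g at h0
  rw [← h0]
  refine (norm_integral_le_integral_norm _).trans_eq ?_
  refine integral_congr_ae (ae_of_all _ fun Z => ?_)
  simp only
  rw [norm_mul, mul_comm Complex.I, Complex.norm_exp_ofReal_mul_I, one_mul]

/-- `E ⊂ B' × B'` finite-dimensional: the projection `B² → E ⊂ H²`. -/
noncomputable def projPair (i : H →L[ℝ] B) (E : Submodule ℝ (WithLp 2 (H × H)))
    [FiniteDimensional ℝ E] (Z : B × B) : H × H :=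
  ∑ j, (functional i (stdOrthonormalBasis ℝ E j : WithLp 2 (H × H)).fst Z.1 +
    functional i (stdOrthonormalBasis ℝ E j : WithLp 2 (H × H)).snd Z.2) •
      WithLp.ofLp (stdOrthonormalBasis ℝ E j : WithLp 2 (H × H))

lemma continuous_projPair (E : Submodule ℝ (WithLp 2 (H × H))) [FiniteDimensional ℝ E] :
    Continuous (projPair i E) := by
  unfold projPair
  fun_prop

lemma projPair_add (E : Submodule ℝ (WithLp 2 (H × H))) [FiniteDimensional ℝ E] (Z Y : B × B) :
    projPair i E (Z + Y) = projPair i E Z + projPair i E Y := by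
  simp only [projPair, Prod.fst_add, Prod.snd_add, map_add, ← Finset.sum_add_distrib, ← add_smul]
  refine Finset.sum_congr rfl fun j _ => ?_
  congr 1
  ring

/-- On subspaces of `B' × B'` the projection has a version defined everywhere, additive and
independent of the variance parameter. It can thus be used under several measures that need not
share null sets, and evaluated at sums of points. -/
lemma projTilde_ae_eq_projPair (hi : IsAbstractWiener i) (ht : 0 < t)
    {E : Submodule ℝ (WithLp 2 (H × H))} [FiniteDimensional ℝ E]
    (hE : E ≤ pairSubmodule (dualSubmodule i)) :
    projTilde i t E =ᵐ[wienerMeasure2 i t] projPair i E := by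
  have := isProbabilityMeasure_wienerMeasure hi ht
  have q1 : Measure.QuasiMeasurePreserving Prod.fst (wienerMeasure2 i t) (wienerMeasure i t) :=
    Measure.quasiMeasurePreserving_fst
  have q2 : Measure.QuasiMeasurePreserving Prod.snd (wienerMeasure2 i t) (wienerMeasure i t) :=
    Measure.quasiMeasurePreserving_snd
  have h1 : ∀ᵐ Z ∂(wienerMeasure2 i t), ∀ j,
      ell i t (stdOrthonormalBasis ℝ E j : WithLp 2 (H × H)).fst Z.1 =
        functional i (stdOrthonormalBasis ℝ E j : WithLp 2 (H × H)).fst Z.1 :=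
    ae_all_iff.2 fun j => q1.ae (ell_ae_eq_functional hi ht (hE (Subtype.coe_prop _)).1)
  have h2 : ∀ᵐ Z ∂(wienerMeasure2 i t), ∀ j,
      ell i t (stdOrthonormalBasis ℝ E j : WithLp 2 (H × H)).snd Z.2 =
        functional i (stdOrthonormalBasis ℝ E j : WithLp 2 (H × H)).snd Z.2 :=
    ae_all_iff.2 fun j => q2.ae (ell_ae_eq_functional hi ht (hE (Subtype.coe_prop _)).2)
  filter_upwards [h1, h2] with Z h1 h2
  simp only [projTilde, projPair, WithLp.ofLp_sum, WithLp.ofLp_smul, ell2, h1, h2]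

lemma dense_pairSubmodule {D : Submodule ℝ H} (hD : Dense (D : Set H)) :
    Dense (pairSubmodule D : Set (WithLp 2 (H × H))) :=
  (hD.prod hD).preimage (WithLp.homeomorphProd 2 H H).isOpenMap

lemma planeWave_projTilde (hi : IsAbstractWiener i) (ht : 0 < t)
    (E : Submodule ℝ (WithLp 2 (H × H))) [FiniteDimensional ℝ E] (X : H × H) :
    ∀ᵐ Z ∂(wienerMeasure2 i t), planeWave X (projTilde i t E Z) =
      Complex.exp (Complex.I * (ell2 i t (E.starProjection (WithLp.toLp 2 X)) Z : ℂ)) := by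
  filter_upwards [inner_projTilde hi ht E (WithLp.toLp 2 X)] with Z hZ
  rw [planeWave, inner_add_inner, hZ]

/-- The defect of the projection onto `E` for the Fourier transform of `θ m`. -/
noncomputable def projDefect (m : Measure (H × H)) (θ : H × H → ℂ) (t : ℝ)
    (E : Submodule ℝ (WithLp 2 (H × H))) [FiniteDimensional ℝ E] : ℝ :=
  ∫ X, min 2 (√t * ‖E.starProjection (WithLp.toLp 2 X) - WithLp.toLp 2 X‖) * ‖θ X‖ ∂m

variable {m : Measure (H × H)} [IsFiniteMeasure m] {θ : H × H → ℂ}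

lemma continuous_min_norm (A A' : WithLp 2 (H × H) →L[ℝ] WithLp 2 (H × H)) (t : ℝ) :
    Continuous fun X : H × H => min 2 (√t * ‖A (WithLp.toLp 2 X) - A' (WithLp.toLp 2 X)‖) := by
  have h1 := WithLp.prod_continuous_toLp 2 H H
  fun_prop

lemma integrable_min_norm_mul (hθ : Integrable θ m)
    (A A' : WithLp 2 (H × H) →L[ℝ] WithLp 2 (H × H)) (t : ℝ) :
    Integrable (fun X : H × H => min 2 (√t * ‖A (WithLp.toLp 2 X) - A' (WithLp.toLp 2 X)‖) *
      ‖θ X‖) m := by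
  have := UniformSpace.secondCountable_of_separable H
  refine hθ.norm.bdd_mul (c := 2) (continuous_min_norm A A' t).aestronglyMeasurable
    (ae_of_all _ fun X => ?_)
  rw [Real.norm_eq_abs, abs_of_nonneg (by positivity)]
  exact min_le_left _ _

lemma tendsto_projDefect (hθ : Integrable θ m) (t : ℝ) {E : ℕ → Submodule ℝ (WithLp 2 (H × H))}
    [∀ n, FiniteDimensional ℝ (E n)] (hE : Monotone E)
    (hd : Dense (⋃ n, (E n : Set (WithLp 2 (H × H))))) :
    Tendsto (fun n => projDefect m θ t (E n)) atTop (𝓝 0) := by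
  have h0 : ∫ X : H × H, (0 : ℝ) * ‖θ X‖ ∂m = 0 := by simp
  rw [← h0]
  refine tendsto_integral_of_dominated_convergence (fun X => 2 * ‖θ X‖)
    (fun n => (integrable_min_norm_mul hθ _ (ContinuousLinearMap.id ℝ _) t).aestronglyMeasurable)
    (hθ.norm.const_mul 2) (fun n => ae_of_all _ fun X => ?_) (ae_of_all _ fun X => ?_)
  · rw [norm_mul, norm_norm, Real.norm_eq_abs, abs_of_nonneg (by positivity)]
    gcongr
    exact min_le_left _ _
  · refine Tendsto.mul_const _ ?_
    have h1 := (tendsto_starProjection_of_dense hE hd (WithLp.toLp 2 X)).sub_const (WithLp.toLp 2 X)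
    rw [sub_self] at h1
    have h2 := (tendsto_const_nhds (x := (2 : ℝ))).min (h1.norm.const_mul √t)
    simpa using h2

/-- Both projections are compared with the identity, using subadditivity of `min 2`. The bound
separates into two defects that tend to zero independently, which gives the Cauchy property. -/
lemma integral_norm_fourierSymbol_projTilde_sub_le (hi : IsAbstractWiener i) (ht : 0 < t)
    (hθ : Integrable θ m) (E E' : Submodule ℝ (WithLp 2 (H × H)))
    [FiniteDimensional ℝ E] [FiniteDimensional ℝ E'] :
    ∫ Z, ‖fourierSymbol m θ (projTilde i t E Z) - fourierSymbol m θ (projTilde i t E' Z)‖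
      ∂(wienerMeasure2 i t) ≤ projDefect m θ t E + projDefect m θ t E' := by
  have := UniformSpace.secondCountable_of_separable H
  have := isProbabilityMeasure_wienerMeasure2 hi ht
  have hI := isIsonormal_ell2 hi ht
  have h1 := integral_norm_fourierSymbol_sub_le (P := wienerMeasure2 i t) hθ
    (measurable_projTilde hi ht E) (measurable_projTilde hi ht E')
    (continuous_min_norm E.starProjection E'.starProjection t).measurable
    (fun X => min_le_left _ _) (fun X => by
      refine le_of_eq_of_le (integral_congr_ae ?_)
        (hI.integral_norm_cexp_sub_le ht (E.starProjection (WithLp.toLp 2 X))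
          (E'.starProjection (WithLp.toLp 2 X)))
      filter_upwards [planeWave_projTilde hi ht E X, planeWave_projTilde hi ht E' X] with Z h1 h2
      rw [h1, h2])
  refine h1.trans ?_
  have i1 : Integrable (fun X : H × H => min 2 (√t * ‖E.starProjection (WithLp.toLp 2 X) -
      WithLp.toLp 2 X‖) * ‖θ X‖) m :=
    integrable_min_norm_mul hθ E.starProjection (ContinuousLinearMap.id ℝ _) t
  have i2 : Integrable (fun X : H × H => min 2 (√t * ‖E'.starProjection (WithLp.toLp 2 X) -
      WithLp.toLp 2 X‖) * ‖θ X‖) m :=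
    integrable_min_norm_mul hθ E'.starProjection (ContinuousLinearMap.id ℝ _) t
  rw [projDefect, projDefect, ← integral_add i1 i2]
  refine integral_mono (integrable_min_norm_mul hθ _ _ t) (i1.add i2) fun X => ?_
  simp only [← add_mul]
  gcongr
  set x := WithLp.toLp 2 X
  have hx : √t * ‖E.starProjection x - E'.starProjection x‖ ≤
      √t * ‖E.starProjection x - x‖ + √t * ‖E'.starProjection x - x‖ := by
    rw [← mul_add]
    gcongr
    have := norm_sub_le_norm_sub_add_norm_sub (E.starProjection x) x (E'.starProjection x)
    rwa [norm_sub_rev x] at this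
  have p1 : 0 ≤ √t * ‖E.starProjection x - x‖ := by positivity
  have p2 : 0 ≤ √t * ‖E'.starProjection x - x‖ := by positivity
  simp only [min_def]
  split_ifs <;> linarith

lemma eLpNorm_fourierSymbol_projTilde_sub_le (hi : IsAbstractWiener i) (ht : 0 < t)
    (hm : Measurable θ) (hθ : Integrable θ m) (E E' : Submodule ℝ (WithLp 2 (H × H)))
    [FiniteDimensional ℝ E] [FiniteDimensional ℝ E'] :
    eLpNorm (fun Z => fourierSymbol m θ (projTilde i t E Z) -
      fourierSymbol m θ (projTilde i t E' Z)) 1 (wienerMeasure2 i t) ≤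
        ENNReal.ofReal (projDefect m θ t E + projDefect m θ t E') := by
  have := UniformSpace.secondCountable_of_separable H
  have := isProbabilityMeasure_wienerMeasure2 hi ht
  have hF := measurable_fourierSymbol (m := m) hm
  have hi1 : ∀ (E : Submodule ℝ (WithLp 2 (H × H))) [FiniteDimensional ℝ E],
      Integrable (fun Z => fourierSymbol m θ (projTilde i t E Z)) (wienerMeasure2 i t) := by
    intro E _
    refine Integrable.of_bound (hF.comp (measurable_projTilde hi ht E)).aestronglyMeasurable
      (∫ X, ‖θ X‖ ∂m) (ae_of_all _ fun Z => norm_fourierSymbol_le _)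
  have hsub : Integrable (fun Z => fourierSymbol m θ (projTilde i t E Z) -
      fourierSymbol m θ (projTilde i t E' Z)) (wienerMeasure2 i t) := (hi1 E).sub (hi1 E')
  rw [eLpNorm_one_eq_lintegral_enorm, ← ofReal_integral_norm_eq_lintegral_enorm hsub]
  exact ENNReal.ofReal_le_ofReal (integral_norm_fourierSymbol_projTilde_sub_le hi ht hθ E E')

/-- The Fourier transform of a complex measure has a stochastic extension, common to two
parameters. -/
theorem exists_isStochExt_fourierSymbol (hi : IsAbstractWiener i) {s : ℝ} (hs : 0 < s) (ht : 0 < t)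
    (hm : Measurable θ) (hθ : Integrable θ m) :
    ∃ Ft, IsStochExt i s (fourierSymbol m θ) Ft ∧ IsStochExt i t (fourierSymbol m θ) Ft := by
  have := UniformSpace.secondCountable_of_separable H
  have := secondCountableTopology_of_isAbstractWiener hi
  have := isProbabilityMeasure_wienerMeasure2 hi hs
  have := isProbabilityMeasure_wienerMeasure2 hi ht
  have hF := measurable_fourierSymbol (m := m) hm
  obtain ⟨E, hfd, hE, hED, hd⟩ := exists_exhausting (dense_pairSubmodule (dense_dualSubmodule hi))
  -- Convergence in `L¹` of the sum of the measures gives one limit valid for both parameters.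
  set M := wienerMeasure2 i s + wienerMeasure2 i t with hM
  set G : ℕ → B × B → ℂ := fun n Z => fourierSymbol m θ (projPair i (E n) Z) with hG
  have hGm : ∀ n, Measurable (G n) := fun n => hF.comp (continuous_projPair _).measurable
  have hG1 : ∀ n, MemLp (G n) 1 M := fun n =>
    MemLp.of_bound (hGm n).aestronglyMeasurable (∫ X, ‖θ X‖ ∂m)
      (ae_of_all _ fun Z => norm_fourierSymbol_le _)
  have hdist : ∀ r, 0 < r → ∀ n k, eLpNorm (G n - G k) 1 (wienerMeasure2 i r) ≤
      ENNReal.ofReal (projDefect m θ r (E n) + projDefect m θ r (E k)) := by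
    intro r hr n k
    refine le_of_eq_of_le (eLpNorm_congr_ae ?_)
      (eLpNorm_fourierSymbol_projTilde_sub_le hi hr hm hθ (E n) (E k))
    filter_upwards [projTilde_ae_eq_projPair hi hr (hED n),
      projTilde_ae_eq_projPair hi hr (hED k)] with Z h1 h2
    rw [h1, h2]
    rfl
  have hcauchy : CauchySeq fun n => (hG1 n).toLp (G n) := by
    have hlim : Tendsto (fun p : ℕ × ℕ => ENNReal.ofReal (projDefect m θ s (E p.1) +
        projDefect m θ s (E p.2)) + ENNReal.ofReal (projDefect m θ t (E p.1) +
        projDefect m θ t (E p.2))) atTop (𝓝 0) := by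
      have l : ∀ r, Tendsto (fun p : ℕ × ℕ => ENNReal.ofReal (projDefect m θ r (E p.1) +
          projDefect m θ r (E p.2))) atTop (𝓝 0) := by
        intro r
        have l1 := tendsto_projDefect hθ r hE hd
        have l2 : Tendsto (fun p : ℕ × ℕ => projDefect m θ r (E p.1) +
          projDefect m θ r (E p.2)) atTop (𝓝 (0 + 0)) := by
          rw [← prod_atTop_atTop_eq]
          exact (l1.comp tendsto_fst).add (l1.comp tendsto_snd)
        rw [add_zero] at l2
        simpa using ENNReal.tendsto_ofReal l2
      simpa using (l s).add (l t)
    rw [Lp.cauchySeq_Lp_iff_cauchySeq_eLpNorm]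
    refine tendsto_of_tendsto_of_tendsto_of_le_of_le tendsto_const_nhds hlim (fun _ => bot_le)
      fun p => ?_
    simp only
    rw [eLpNorm_congr_ae ((hG1 p.1).coeFn_toLp.sub (hG1 p.2).coeFn_toLp),
      eLpNorm_one_eq_lintegral_enorm, hM, lintegral_add_measure,
      ← eLpNorm_one_eq_lintegral_enorm, ← eLpNorm_one_eq_lintegral_enorm]
    exact add_le_add (hdist s hs _ _) (hdist t ht _ _)
  obtain ⟨g, hg⟩ := cauchySeq_tendsto_of_complete hcauchy
  have hgm := Lp.aestronglyMeasurable g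
  set Ft : B × B → ℂ := hgm.mk g with hFt
  have hFtm : Measurable Ft := hgm.stronglyMeasurable_mk.measurable
  have hFt1 : MemLp Ft 1 M := (Lp.memLp g).ae_eq hgm.ae_eq_mk
  have hgF : g = hFt1.toLp Ft := by
    refine Lp.ext ?_
    exact hgm.ae_eq_mk.trans hFt1.coeFn_toLp.symm
  have hlim : Tendsto (fun n => eLpNorm (G n - Ft) 1 M) atTop (𝓝 0) := by
    rw [hgF] at hg
    exact (Lp.tendsto_Lp_iff_tendsto_eLpNorm'' G hG1 Ft hFt1).1 hg
  have key : ∀ r, 0 < r → wienerMeasure2 i r ≤ M → IsStochExt i r (fourierSymbol m θ) Ft := by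
    intro r hr hrM
    have := isProbabilityMeasure_wienerMeasure2 hi hr
    refine ⟨hF, hFtm, fun E' _ hE' hd' => ?_⟩
    refine tendstoInMeasure_of_tendsto_eLpNorm one_ne_zero
      (fun n => (hF.comp (measurable_projTilde hi hr (E' n))).aestronglyMeasurable)
      hFtm.aestronglyMeasurable ?_
    -- An arbitrary sequence is compared, index by index, with the fixed sequence that defines `Ft`.
    have hb : ∀ n, eLpNorm ((fun Z => fourierSymbol m θ (projTilde i r (E' n) Z)) - Ft) 1
        (wienerMeasure2 i r) ≤
        ENNReal.ofReal (projDefect m θ r (E' n) + projDefect m θ r (E n)) +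
          eLpNorm (G n - Ft) 1 M := by
      intro n
      have e : ((fun Z => fourierSymbol m θ (projTilde i r (E' n) Z)) - Ft) =ᵐ[wienerMeasure2 i r]
          (fun Z => fourierSymbol m θ (projTilde i r (E' n) Z) -
            fourierSymbol m θ (projTilde i r (E n) Z)) + (G n - Ft) := by
        filter_upwards [projTilde_ae_eq_projPair hi hr (hED n)] with Z h1
        simp only [Pi.sub_apply, Pi.add_apply, h1, hG]
        ring
      rw [eLpNorm_congr_ae e]
      refine (eLpNorm_add_le ((hF.comp (measurable_projTilde hi hr (E' n))).sub
        (hF.comp (measurable_projTilde hi hr (E n)))).aestronglyMeasurable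
        ((hGm n).sub hFtm).aestronglyMeasurable le_rfl).trans ?_
      exact add_le_add (eLpNorm_fourierSymbol_projTilde_sub_le hi hr hm hθ _ _)
        (eLpNorm_mono_measure _ hrM)
    refine tendsto_of_tendsto_of_tendsto_of_le_of_le tendsto_const_nhds ?_ (fun _ => bot_le) hb
    have l1 := (tendsto_projDefect hθ r hE' hd').add (tendsto_projDefect hθ r hE hd)
    rw [add_zero] at l1
    simpa using (ENNReal.tendsto_ofReal l1).add hlim
  exact ⟨Ft, key s hs (Measure.le_add_right le_rfl), key t ht (Measure.le_add_left le_rfl)⟩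

end FourierExtension

end WienerWeyl

namespace WienerWeyl

/-! ### Weyl and anti-Wick forms of a Fourier transform -/

section Quantization

variable {H B : Type*} [NormedAddCommGroup H] [InnerProductSpace ℝ H] [CompleteSpace H]
  [TopologicalSpace.SeparableSpace H] [MeasurableSpace H] [BorelSpace H]
  [NormedAddCommGroup B] [NormedSpace ℝ B] [CompleteSpace B]
  [MeasurableSpace B] [BorelSpace B] {i : H →L[ℝ] B} {t h : ℝ}
  {m : Measure (H × H)} [IsFiniteMeasure m] {θ : H × H → ℂ}

/-- The Weyl form of the Fourier transform of `θ m`. -/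
theorem weylForm_of_isStochExt_fourierSymbol (hi : IsAbstractWiener i) (hh : 0 < h)
    (hm : Measurable θ) (hθ : Integrable θ m) {Ft : B × B → ℂ}
    (hF : IsStochExt i (h / 2) (fourierSymbol m θ) Ft) :
    IsWeylSymbol i h Ft ∧ ∀ f ∈ testSpace i h, ∀ g ∈ testSpace i h,
      Integrable (fun Z => Ft Z * wignerGauss i h f g Z) (wienerMeasure2 i (h / 2)) ∧
      weylForm i h Ft f g = ∫ X, l2Inner i h (weylU i h X.1 X.2 f) g * θ X ∂m := by
  have hh' := half_pos hh
  have := UniformSpace.secondCountable_of_separable H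
  have := isProbabilityMeasure_wienerMeasure2 hi hh'
  obtain ⟨E, hfd, hE, -, hd⟩ := exists_exhausting (K := WithLp 2 (H × H)) (D := ⊤) (by simp)
  -- An almost surely convergent subsequence suffices: it gives the bound `∫ |θ|` on `Ft` and
  -- identifies the pairings by dominated convergence.
  obtain ⟨ns, hns, hae⟩ := (hF.tendsto E hE hd).exists_seq_tendsto_ae
  obtain ⟨hb, key⟩ := integral_mul_of_ae_tendsto (P := wienerMeasure2 i (h / 2)) hm hθ
    (S := fun n => projTilde i (h / 2) (E (ns n)))
    (fun n => measurable_projTilde hi hh' _) hae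
  refine ⟨isWeylSymbol_of_ae_bound hi hh hF.measurable_ext.aestronglyMeasurable hb,
    fun f hf g hg => key _ _ (integrable_wignerGauss hi hh hf hg) fun X => ?_⟩
  have h1 : ∀ n, ∫ Z, planeWave X (projTilde i (h / 2) (E (ns n)) Z) * wignerGauss i h f g Z
      ∂(wienerMeasure2 i (h / 2)) = l2Inner i h (weylU i h
        ((E (ns n)).starProjection (WithLp.toLp 2 X)).fst
        ((E (ns n)).starProjection (WithLp.toLp 2 X)).snd f) g := by
    intro n
    rw [← integral_cexp_ell2_mul_wignerGauss hi hh hf hg]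
    refine integral_congr_ae ?_
    filter_upwards [planeWave_projTilde hi hh' (E (ns n)) X] with Z hZ
    rw [hZ]
  simp only [h1]
  exact ((continuous_l2Inner_weylU hi hh hf hg).tendsto (WithLp.toLp 2 X)).comp
    ((tendsto_starProjection_of_dense hE hd (WithLp.toLp 2 X)).comp hns.tendsto_atTop)

/-- The convolution identity on `B` in each coordinate; on rectangles it is Fubini after exchanging
the order of the four variables. -/
lemma measurePreserving_add_wienerMeasure2 (hi : IsAbstractWiener i) (hh : 0 < h) :
    MeasurePreserving (fun p : (B × B) × (B × B) => p.1 + p.2)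
      ((wienerMeasure2 i (h / 2)).prod (wienerMeasure2 i (h / 2))) (wienerMeasure2 i h) := by
  have hh' := half_pos hh
  have := secondCountableTopology_of_isAbstractWiener hi
  have := isProbabilityMeasure_wienerMeasure hi hh'
  have := isProbabilityMeasure_wienerMeasure hi hh
  have := isProbabilityMeasure_wienerMeasure2 hi hh'
  have := isProbabilityMeasure_wienerMeasure2 hi hh
  refine ⟨by fun_prop, ?_⟩
  have := Measure.isProbabilityMeasure_map
    (μ := (wienerMeasure2 i (h / 2)).prod (wienerMeasure2 i (h / 2)))
    (f := fun p : (B × B) × (B × B) => p.1 + p.2) (by fun_prop)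
  have hadd := map_add_prod_wienerMeasure hi hh' hh'
  rw [add_halves] at hadd
  refine (Measure.prod_eq fun s t hs ht => ?_).symm
  have hma : Measurable fun p : B × B => p.1 + p.2 := by fun_prop
  rw [Measure.map_apply (by fun_prop) (hs.prod ht), ← hadd, Measure.map_apply hma hs,
    Measure.map_apply hma ht]
  set S := (fun p : B × B => p.1 + p.2) ⁻¹' s with hS
  set T := (fun p : B × B => p.1 + p.2) ⁻¹' t with hT
  have hSm : MeasurableSet S := hma hs
  have hTm : MeasurableSet T := hma ht
  set μ := wienerMeasure i (h / 2)
  have hpre : MeasurableSet ((fun p : (B × B) × (B × B) => p.1 + p.2) ⁻¹' s ×ˢ t) :=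
    (by fun_prop : Measurable fun p : (B × B) × (B × B) => p.1 + p.2) (hs.prod ht)
  rw [Measure.prod_apply hpre, Measure.prod_apply hSm, Measure.prod_apply hTm,
    ← lintegral_prod_mul (measurable_measure_prodMk_left hSm).aemeasurable
      (measurable_measure_prodMk_left hTm).aemeasurable]
  refine lintegral_congr fun p => ?_
  rw [← Measure.prod_prod]
  rfl

/-- The heat transform of the Fourier transform of `θ m`, and its Weyl form. -/
theorem weylForm_heat_of_isStochExt_fourierSymbol (hi : IsAbstractWiener i) (hh : 0 < h)
    (hm : Measurable θ) (hθ : Integrable θ m) {Ft : B × B → ℂ}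
    (hF : IsStochExt i h (fourierSymbol m θ) Ft) :
    IsWeylSymbol i h (heat i (h / 2) Ft) ∧ ∀ f ∈ testSpace i h, ∀ g ∈ testSpace i h,
      Integrable (fun Z => heat i (h / 2) Ft Z * wignerGauss i h f g Z)
        (wienerMeasure2 i (h / 2)) ∧
      weylForm i h (heat i (h / 2) Ft) f g =
        ∫ X, ((Real.exp (-(h / 4) * (‖X.1‖ ^ 2 + ‖X.2‖ ^ 2)) : ℝ) : ℂ) *
          l2Inner i h (weylU i h X.1 X.2 f) g * θ X ∂m := by
  have hh' := half_pos hh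
  have := UniformSpace.secondCountable_of_separable H
  have := secondCountableTopology_of_isAbstractWiener hi
  have := isProbabilityMeasure_wienerMeasure2 hi hh'
  have hI := isIsonormal_ell2 hi hh'
  set μ := wienerMeasure2 i (h / 2) with hμ
  obtain ⟨E, hfd, hE, hED, hd⟩ := exists_exhausting (dense_pairSubmodule (dense_dualSubmodule hi))
  obtain ⟨ns, hns, hae⟩ := (hF.tendsto E hE hd).exists_seq_tendsto_ae
  have hmp := measurePreserving_add_wienerMeasure2 hi hh
  -- The sum of two independent points of law `μ_{h/2}` has law `μ_h`, where convergence is known.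
  -- The everywhere defined `projPair` is needed here, since `projTilde` depends on the parameter.
  have hae2 : ∀ᵐ p ∂(μ.prod μ), Tendsto (fun n => fourierSymbol m θ
      (projPair i (E (ns n)) (p.1 + p.2))) atTop (𝓝 (Ft (p.1 + p.2))) := by
    refine hmp.quasiMeasurePreserving.ae (p := fun Z => Tendsto (fun n => fourierSymbol m θ
      (projPair i (E (ns n)) Z)) atTop (𝓝 (Ft Z))) ?_
    have h2 : ∀ᵐ Z ∂(wienerMeasure2 i h), ∀ n,
        projTilde i h (E (ns n)) Z = projPair i (E (ns n)) Z :=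
      ae_all_iff.2 fun n => projTilde_ae_eq_projPair hi hh (hED _)
    filter_upwards [hae, h2] with Z h1 h2
    simpa only [h2] using h1
  obtain ⟨hb, key⟩ := integral_mul_of_ae_tendsto (P := μ.prod μ) hm hθ
    (S := fun n p => projPair i (E (ns n)) (p.1 + p.2))
    (fun n => ((continuous_projPair _).comp continuous_add).measurable) hae2
  have hFm : Measurable fun p : (B × B) × (B × B) => Ft (p.1 + p.2) :=
    hF.measurable_ext.comp (by fun_prop)
  have hheatm : StronglyMeasurable (heat i (h / 2) Ft) :=
    hFm.stronglyMeasurable.integral_prod_right'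
  have hheatb : ∀ᵐ Z ∂μ, ‖heat i (h / 2) Ft Z‖ ≤ ∫ X, ‖θ X‖ ∂m := by
    filter_upwards [Measure.ae_ae_of_ae_prod hb] with Z hZ
    have h1 := norm_integral_le_of_norm_le_const hZ
    rwa [probReal_univ, mul_one] at h1
  refine ⟨isWeylSymbol_of_ae_bound hi hh hheatm.aestronglyMeasurable hheatb,
    fun f hf g hg => ⟨(integrable_wignerGauss hi hh hf hg).bdd_mul hheatm.aestronglyMeasurable
      hheatb, ?_⟩⟩
  have hw := integrable_wignerGauss hi hh hf hg
  have hlim : ∀ X : H × H, Tendsto (fun n => ∫ p,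
      planeWave X (projPair i (E (ns n)) (p.1 + p.2)) * wignerGauss i h f g p.1 ∂(μ.prod μ))
      atTop (𝓝 (((Real.exp (-(h / 4) * (‖X.1‖ ^ 2 + ‖X.2‖ ^ 2)) : ℝ) : ℂ) *
          l2Inner i h (weylU i h X.1 X.2 f) g)) := by
    intro X
    set x := WithLp.toLp 2 X with hx
    have hpw : ∀ n, ∀ᵐ Z ∂μ, planeWave X (projPair i (E n) Z) =
        Complex.exp (Complex.I * (ell2 i (h / 2) ((E n).starProjection x) Z : ℂ)) := by
      intro n
      filter_upwards [planeWave_projTilde hi hh' (E n) X,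
        projTilde_ae_eq_projPair hi hh' (hED n)] with Z h1 h2
      rw [← h2, h1]
    have h1 : ∀ n, ∫ p, planeWave X (projPair i (E (ns n)) (p.1 + p.2)) * wignerGauss i h f g p.1
        ∂(μ.prod μ) = l2Inner i h (weylU i h ((E (ns n)).starProjection x).fst
          ((E (ns n)).starProjection x).snd f) g *
          ((Real.exp (-(h / 2) * ‖(E (ns n)).starProjection x‖ ^ 2 / 2) : ℝ) : ℂ) := by
      intro n
      -- The plane wave at a sum factors. The factor in `p.2` integrates to the Gaussian damping,
      -- that in `p.1` to the Weyl form.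
      have e : ∀ p : (B × B) × (B × B), planeWave X (projPair i (E (ns n)) (p.1 + p.2)) *
          wignerGauss i h f g p.1 = (planeWave X (projPair i (E (ns n)) p.1) *
          wignerGauss i h f g p.1) * planeWave X (projPair i (E (ns n)) p.2) := by
        intro p
        rw [projPair_add, mul_right_comm]
        congr 1
        rw [planeWave, planeWave, planeWave, ← Complex.exp_add]
        congr 1
        simp only [Prod.fst_add, Prod.snd_add, inner_add_right]
        push_cast
        ring
      simp only [e]
      rw [integral_prod_mul (fun Z => planeWave X (projPair i (E (ns n)) Z) *
        wignerGauss i h f g Z) (fun Z => planeWave X (projPair i (E (ns n)) Z)),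
        ← integral_cexp_ell2_mul_wignerGauss hi hh hf hg, ← hI.integral_cexp]
      congr 1
      · refine integral_congr_ae ?_
        filter_upwards [hpw (ns n)] with Z hZ
        rw [hZ]
      · exact integral_congr_ae (hpw (ns n))
    simp only [h1]
    have l0 := (tendsto_starProjection_of_dense hE hd x).comp hns.tendsto_atTop
    have l1 := ((continuous_l2Inner_weylU hi hh hf hg).tendsto x).comp l0
    have hce : Continuous fun y : WithLp 2 (H × H) =>
        ((Real.exp (-(h / 2) * ‖y‖ ^ 2 / 2) : ℝ) : ℂ) := by fun_prop
    have l2 := (hce.tendsto x).comp l0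
    have l3 := l1.mul l2
    have e2 : l2Inner i h (weylU i h x.fst x.snd f) g *
        ((Real.exp (-(h / 2) * ‖x‖ ^ 2 / 2) : ℝ) : ℂ) =
        ((Real.exp (-(h / 4) * (‖X.1‖ ^ 2 + ‖X.2‖ ^ 2)) : ℝ) : ℂ) *
          l2Inner i h (weylU i h X.1 X.2 f) g := by
      rw [mul_comm, WithLp.prod_norm_sq_eq_of_L2]
      congr 3
      change -(h / 2) * (‖X.1‖ ^ 2 + ‖X.2‖ ^ 2) / 2 = _
      ring
    rw [e2] at l3
    exact l3
  obtain ⟨k1, k2⟩ := key (fun p => wignerGauss i h f g p.1) _ (hw.comp_fst μ) hlim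
  rw [← k2, integral_prod _ k1, weylForm]
  refine integral_congr_ae (ae_of_all _ fun Z => ?_)
  simp only [heat]
  rw [← integral_mul_const]

end Quantization

end WienerWeyl

namespace WienerWeyl

/-! ### Bounded sesquilinear forms and operators -/

section BoundedForm

variable {V 𝓗 : Type*} [AddCommGroup V] [Module ℂ V] [NormedAddCommGroup 𝓗]
  [InnerProductSpace ℂ 𝓗] [CompleteSpace 𝓗]

/-- Extend by density in one variable, then in the other, and apply Riesz. The operator given by
Riesz acts on the antilinear variable, hence the adjoint. -/
lemma exists_clm_of_dense_of_norm_le {ι : V →ₗ[ℂ] 𝓗} (hι : DenseRange ι)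
    {b : V →ₗ⋆[ℂ] V →ₗ[ℂ] ℂ} {C : ℝ} (hC : 0 ≤ C) (hb : ∀ g f, ‖b g f‖ ≤ C * ‖ι g‖ * ‖ι f‖) :
    ∃ T : 𝓗 →L[ℂ] 𝓗, ‖T‖ ≤ C ∧ ∀ g f, b g f = inner ℂ (ι g) (T (ι f)) := by
  have h1 : ∀ g f, (b g).extendOfNorm ι (ι f) = b g f := fun g f =>
    LinearMap.extendOfNorm_eq hι ⟨_, hb g⟩ f
  let b1 : V →ₗ⋆[ℂ] (𝓗 →L[ℂ] ℂ) :=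
    { toFun := fun g => (b g).extendOfNorm ι
      map_add' := fun g g' => ContinuousLinearMap.coeFn_injective <|
        hι.equalizer (by fun_prop) (by fun_prop) <| funext fun f => by
          rw [Function.comp_apply, Function.comp_apply, add_apply, h1, h1, h1, map_add,
            LinearMap.add_apply]
      map_smul' := fun r g => ContinuousLinearMap.coeFn_injective <|
        hι.equalizer (by fun_prop) (by fun_prop) <| funext fun f => by
          rw [Function.comp_apply, Function.comp_apply, smul_apply, h1, h1, map_smulₛₗ,
            LinearMap.smul_apply] }
  have h2 : ∀ g, ‖b1 g‖ ≤ C * ‖ι g‖ := fun g =>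
    LinearMap.opNorm_extendOfNorm_le hι (by positivity) (hb g)
  let b2 : 𝓗 →L⋆[ℂ] 𝓗 →L[ℂ] ℂ := b1.extendOfNorm ι
  have h3 : ∀ g f, b2 (ι g) (ι f) = b g f := fun g f => by
    have : b2 (ι g) = b1 g := LinearMap.extendOfNorm_eq hι ⟨C, h2⟩ g
    rw [this]; exact h1 g f
  have h4 : ‖b2‖ ≤ C := LinearMap.opNorm_extendOfNorm_le hι hC h2
  refine ⟨(InnerProductSpace.continuousLinearMapOfBilin b2).adjoint, ?_, fun g f => ?_⟩
  · rw [LinearIsometryEquiv.norm_map]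
    refine ContinuousLinearMap.opNorm_le_bound _ hC fun v => ?_
    change ‖(InnerProductSpace.toDual ℂ 𝓗).symm (b2 v)‖ ≤ _
    rw [LinearIsometryEquiv.norm_map]
    exact b2.le_of_opNorm_le h4 v
  · rw [ContinuousLinearMap.adjoint_inner_right, InnerProductSpace.continuousLinearMapOfBilin_apply,
      h3]

/-- A bounded sesquilinear form on a space of vectors of `𝓗` is given by a bounded operator. -/
lemma exists_clm_of_norm_le (ι : V →ₗ[ℂ] 𝓗)
    {b : V →ₗ⋆[ℂ] V →ₗ[ℂ] ℂ} {C : ℝ} (hC : 0 ≤ C) (hb : ∀ g f, ‖b g f‖ ≤ C * ‖ι g‖ * ‖ι f‖) :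
    ∃ T : 𝓗 →L[ℂ] 𝓗, ‖T‖ ≤ C ∧ ∀ g f, b g f = inner ℂ (ι g) (T (ι f)) := by
  let S := (LinearMap.range ι).topologicalClosure
  have hιS : ∀ f, ι f ∈ S := fun f => subset_closure ⟨f, rfl⟩
  have : CompleteSpace S := (Submodule.isClosed_topologicalClosure _).completeSpace_coe
  let e : V →ₗ[ℂ] S := ι.codRestrict S hιS
  have he : DenseRange e := by
    intro x
    rw [closure_subtype, ← Set.range_comp]
    exact x.2
  obtain ⟨T, hT, hTb⟩ := exists_clm_of_dense_of_norm_le (b := b) he hC hb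
  -- Extension by zero on the orthogonal complement of the closure; density of the test functions in
  -- `L²` is thus not required.
  refine ⟨S.subtypeL ∘L T ∘L S.orthogonalProjectionOnto, ?_, fun g f => ?_⟩
  · refine ContinuousLinearMap.opNorm_le_bound _ hC fun v => ?_
    refine (T.le_of_opNorm_le hT _).trans ?_
    gcongr
    exact S.norm_orthogonalProjectionOnto_apply_le v
  · have h1 : S.orthogonalProjectionOnto (ι f) = e f :=
      S.orthogonalProjectionOnto_mem_subspace_eq_self (e f)
    simp only [ContinuousLinearMap.comp_apply, h1]
    exact hTb g f

end BoundedForm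

/-! ### Isometry of the Weyl operators and the bounded operator -/

section WeylOperators

variable {H B : Type*} [NormedAddCommGroup H] [InnerProductSpace ℝ H] [CompleteSpace H]
  [TopologicalSpace.SeparableSpace H] [MeasurableSpace H] [BorelSpace H]
  [NormedAddCommGroup B] [NormedSpace ℝ B] [CompleteSpace B]
  [MeasurableSpace B] [BorelSpace B] {i : H →L[ℝ] B} {t h : ℝ}

lemma measurable_weylU (hi : IsAbstractWiener i) (hh : 0 < h) (a b : H) {f : B → ℂ}
    (hf : Measurable f) : Measurable (weylU i h a b f) := by
  have m1 := measurable_ell hi (half_pos hh) a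
  have m2 := measurable_ell hi (half_pos hh) b
  have := secondCountableTopology_of_isAbstractWiener hi
  unfold weylU ellC
  fun_prop

lemma enorm_weylU (a b : H) (f : B → ℂ) (u : B) :
    ‖weylU i h a b f u‖ₑ = ENNReal.ofReal (Real.exp (-(h / 2 * ‖b‖ ^ 2) - ell i (h / 2) b u)) *
      ‖f (u + h • i b)‖ₑ := by
  rw [weylU, enorm_mul, ← ofReal_norm (Complex.exp _), Complex.norm_exp]
  congr 3
  simp [ellC, -Complex.ofReal_pow]
  ring

/-- The Weyl operators are isometric. -/
theorem eLpNorm_weylU (hi : IsAbstractWiener i) (hh : 0 < h) (a b : H) {f : B → ℂ}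
    (hf : Measurable f) :
    eLpNorm (weylU i h a b f) 2 (wienerMeasure i (h / 2)) =
      eLpNorm f 2 (wienerMeasure i (h / 2)) := by
  have hh' := half_pos hh
  have := secondCountableTopology_of_isAbstractWiener hi
  have hI := isIsonormal_ell hi hh'
  have hm := measurable_ell hi hh'
  have hadd : Measurable fun x : B => x + i (-(h • b)) := by fun_prop
  -- At parameter `h/2` the density of the shift by `-hb` is `exp(-2ℓ_b - h|b|²)`, the squared
  -- modulus of the exponential factor of the Weyl operator.
  have hmap := map_add_wienerMeasure hi hh' (-(h • b))
  have hfe : Measurable fun u => ‖f (u + h • i b)‖ₑ ^ (2 : ℝ) := by fun_prop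
  have key : ∫⁻ u, ‖weylU i h a b f u‖ₑ ^ (2 : ℝ) ∂(wienerMeasure i (h / 2)) =
      ∫⁻ u, ‖f u‖ₑ ^ (2 : ℝ) ∂(wienerMeasure i (h / 2)) := by
    calc _ = ∫⁻ u, ‖f (u + h • i b)‖ₑ ^ (2 : ℝ)
          ∂((wienerMeasure i (h / 2)).map fun x => x + i (-(h • b))) := by
          rw [hmap, lintegral_withDensity_eq_lintegral_mul _
            (by have := hm (-(h • b)); fun_prop) hfe]
          refine lintegral_congr_ae ?_
          filter_upwards [hI.smul (-h) b] with u hu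
          rw [neg_smul] at hu
          rw [enorm_weylU, ENNReal.mul_rpow_of_nonneg _ _ zero_le_two, Pi.mul_apply,
            ENNReal.ofReal_rpow_of_pos (Real.exp_pos _), ← Real.exp_mul, hu]
          congr 3
          rw [norm_neg, norm_smul, Real.norm_eq_abs, mul_pow, sq_abs]
          field_simp
          ring
      _ = _ := by
          rw [lintegral_map hfe hadd]
          refine lintegral_congr fun u => ?_
          congr 3
          rw [map_neg, map_smul]; abel_nf
  rw [eLpNorm_eq_lintegral_rpow_enorm_toReal two_ne_zero ENNReal.ofNat_ne_top,
    eLpNorm_eq_lintegral_rpow_enorm_toReal two_ne_zero ENNReal.ofNat_ne_top]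
  simp only [ENNReal.toReal_ofNat, key]

lemma memLp_weylU (hi : IsAbstractWiener i) (hh : 0 < h) (a b : H) {f : B → ℂ}
    (hf : f ∈ testSpace i h) : MemLp (weylU i h a b f) 2 (wienerMeasure i (h / 2)) := by
  have hm := (continuous_of_mem_testSpace hh hf).measurable
  have := secondCountableTopology_of_isAbstractWiener hi
  refine ⟨(measurable_weylU hi hh a b hm).aestronglyMeasurable, ?_⟩
  rw [eLpNorm_weylU hi hh a b hm]
  exact (memLp_of_mem_testSpace hi hh hf).2

lemma l2Inner_eq_inner {f g : B → ℂ} (hf : MemLp f 2 (wienerMeasure i (h / 2)))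
    (hg : MemLp g 2 (wienerMeasure i (h / 2))) :
    l2Inner i h f g = inner ℂ (hg.toLp g) (hf.toLp f) := by
  rw [L2.inner_def, l2Inner]
  refine integral_congr_ae ?_
  filter_upwards [hf.coeFn_toLp, hg.coeFn_toLp] with u h1 h2
  rw [h1, h2, RCLike.inner_apply]

lemma norm_l2Inner_weylU_le_mul (hi : IsAbstractWiener i) (hh : 0 < h) {f g : B → ℂ}
    (hf : f ∈ testSpace i h) (hg : g ∈ testSpace i h) (X : H × H) :
    ‖l2Inner i h (weylU i h X.1 X.2 f) g‖ ≤
      ‖(memLp_of_mem_testSpace hi hh hg).toLp g‖ * ‖(memLp_of_mem_testSpace hi hh hf).toLp f‖ := by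
  rw [l2Inner_eq_inner (memLp_weylU hi hh X.1 X.2 hf) (memLp_of_mem_testSpace hi hh hg)]
  refine (norm_inner_le_norm _ _).trans_eq ?_
  rw [Lp.norm_toLp, Lp.norm_toLp, Lp.norm_toLp,
    eLpNorm_weylU hi hh _ _ (continuous_of_mem_testSpace hh hf).measurable]

/-- The canonical map from the test functions to `L²`. -/
noncomputable def testToLp (hi : IsAbstractWiener i) (hh : 0 < h) :
    testSubmodule hi hh →ₗ[ℂ] Lp ℂ 2 (wienerMeasure i (h / 2)) where
  toFun f := (memLp_of_mem_testSpace hi hh f.2).toLp f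
  map_add' _ _ := rfl
  map_smul' _ _ := rfl

/-- The superposition of the forms `⟨U_{x,ξ,h} f, g⟩` against `θ m`. -/
noncomputable def weylSuperposition (hi : IsAbstractWiener i) (hh : 0 < h) {m : Measure (H × H)}
    [IsFiniteMeasure m] {θ : H × H → ℂ} (hθ : Integrable θ m) :
    testSubmodule hi hh →ₗ⋆[ℂ] testSubmodule hi hh →ₗ[ℂ] ℂ :=
  have hint : ∀ f g : testSubmodule hi hh, Integrable (fun X : H × H =>
      l2Inner i h (weylU i h X.1 X.2 f) g * θ X) m := fun f g =>
    have := UniformSpace.secondCountable_of_separable H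
    hθ.bdd_mul (continuous_l2Inner_weylU_prod hi hh f.2 g.2).aestronglyMeasurable
      (ae_of_all _ (norm_l2Inner_weylU_le hi hh f.2 g.2))
  have hint2 : ∀ (X : H × H) (f g : testSubmodule hi hh), Integrable
      (fun u => weylU i h X.1 X.2 f u * conj ((g : B → ℂ) u)) (wienerMeasure i (h / 2)) :=
    fun X f g => (memLp_weylU hi hh X.1 X.2 f.2).integrable_mul
      (memLp_of_mem_testSpace hi hh g.2).star
  LinearMap.mk₂'ₛₗ (starRingEnd ℂ) (RingHom.id ℂ)
    (fun g f => ∫ X, l2Inner i h (weylU i h X.1 X.2 f) g * θ X ∂m)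
    (fun g g' f => by
      rw [← integral_add (hint _ _) (hint _ _)]
      refine integral_congr_ae (ae_of_all _ fun X => ?_)
      simp only [l2Inner, ← add_mul]
      rw [← integral_add (hint2 _ _ _) (hint2 _ _ _)]
      simp [mul_add])
    (fun r g f => by
      simp only [smul_eq_mul]
      rw [← integral_const_mul]
      refine integral_congr_ae (ae_of_all _ fun X => ?_)
      simp only [l2Inner, ← mul_assoc]
      rw [← integral_const_mul]
      congr 2
      ext u
      simp
      ring)
    (fun g f f' => by
      rw [← integral_add (hint _ _) (hint _ _)]
      refine integral_congr_ae (ae_of_all _ fun X => ?_)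
      simp only [l2Inner, ← add_mul]
      rw [← integral_add (hint2 _ _ _) (hint2 _ _ _)]
      simp [weylU, mul_add, add_mul])
    (fun r g f => by
      simp only [smul_eq_mul, RingHom.id_apply]
      rw [← integral_const_mul]
      refine integral_congr_ae (ae_of_all _ fun X => ?_)
      simp only [l2Inner, ← mul_assoc]
      rw [← integral_const_mul]
      congr 2
      ext u
      simp [weylU]
      ring)

/-- The hypothesis on bounded kernels lets `C` be the total variation itself; isometry of the Weyl
operators and Cauchy-Schwarz bound the kernel by the product of the two `L²` norms. -/
lemma exists_clm_weylSuperposition (hi : IsAbstractWiener i) (hh : 0 < h) {m : Measure (H × H)}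
    [IsFiniteMeasure m] {θ : H × H → ℂ} (hθ : Integrable θ m) {C : ℝ} (hC : 0 ≤ C)
    (hb : ∀ κ : H × H → ℂ, StronglyMeasurable κ → ∀ M, (∀ X, ‖κ X‖ ≤ M) →
      ‖∫ X, κ X * θ X ∂m‖ ≤ M * C) :
    ∃ T : Lp ℂ 2 (wienerMeasure i (h / 2)) →L[ℂ] Lp ℂ 2 (wienerMeasure i (h / 2)), ‖T‖ ≤ C ∧
      ∀ f (hf : f ∈ testSpace i h), ∀ g (hg : g ∈ testSpace i h),
        ∫ X, l2Inner i h (weylU i h X.1 X.2 f) g * θ X ∂m =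
          inner ℂ ((memLp_of_mem_testSpace hi hh hg).toLp g)
            (T ((memLp_of_mem_testSpace hi hh hf).toLp f)) := by
  have := UniformSpace.secondCountable_of_separable H
  obtain ⟨T, hT, hTb⟩ := exists_clm_of_norm_le (testToLp hi hh)
    (b := weylSuperposition hi hh hθ) hC fun g f => by
      refine (hb _ (continuous_l2Inner_weylU_prod hi hh f.2 g.2).stronglyMeasurable _
        (norm_l2Inner_weylU_le_mul hi hh f.2 g.2)).trans_eq ?_
      rw [mul_comm, mul_assoc]
      rfl
  exact ⟨T, hT, fun f hf g hg => hTb ⟨g, hg⟩ ⟨f, hf⟩⟩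

/-- The Weyl form of a version of `ℓ_{a,b}` is the form of the Segal field. -/
lemma weylForm_of_ae_eq_ell2 (hi : IsAbstractWiener i) (hh : 0 < h) (a b : H) {F : B × B → ℂ}
    (hF : F =ᵐ[wienerMeasure2 i (h / 2)] fun Z => (ell2 i (h / 2) (WithLp.toLp 2 (a, b)) Z : ℂ))
    {f g : B → ℂ} (hf : f ∈ testSpace i h) (hg : g ∈ testSpace i h) :
    Integrable (fun Z => F Z * wignerGauss i h f g Z) (wienerMeasure2 i (h / 2)) ∧
      MemLp (segalField i h a b f) 2 (wienerMeasure i (h / 2)) ∧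
      weylForm i h F f g = l2Inner i h (segalField i h a b f) g := by
  obtain ⟨E, _, φ, ψ, hE, hφ, hψ, rfl, rfl, hW⟩ := exists_wignerGauss_eq hi hh hf hg
  have h1 := integral_ell2_mul_wigner hi hh hE hφ hψ (WithLp.toLp 2 (a, b))
  have h2 := segalField_comp_projB hi hh hE hφ hψ a b
  have h3 : (fun Z => F Z * wignerGauss i h (φ ∘ projB i E) (ψ ∘ projB i E) Z)
      =ᵐ[wienerMeasure2 i (h / 2)] fun Z => (ell2 i (h / 2) (WithLp.toLp 2 (a, b)) Z : ℂ) *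
        wignerHat h φ ψ (projB i E Z.1) (projB i E Z.2) := by
    filter_upwards [hF] with Z hZ
    rw [hZ, hW]
  refine ⟨h1.1.congr h3.symm, h2.1, ?_⟩
  rw [weylForm, integral_congr_ae h3, h1.2, h2.2]
  rfl

end WeylOperators

end WienerWeyl

/-! ### The proposition -/

open WienerWeyl in
theorem proposition8p13 {H B : Type*}
    [NormedAddCommGroup H] [InnerProductSpace ℝ H] [CompleteSpace H]
    [TopologicalSpace.SeparableSpace H] [MeasurableSpace H] [BorelSpace H]
    [NormedAddCommGroup B] [NormedSpace ℝ B] [CompleteSpace B]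
    [MeasurableSpace B] [BorelSpace B]
    (i : H →L[ℝ] B) (hi : IsAbstractWiener i) (h : ℝ) (hh : 0 < h) :
    -- (1) linear symbols
    (∀ a b : H,
      (∃ φt, IsStochExt i (h / 2) (linearSymbol a b) φt) ∧
      ∀ φt, IsStochExt i (h / 2) (linearSymbol a b) φt →
        IsWeylSymbol i h φt ∧
        ∀ f ∈ testSpace i h, ∀ g ∈ testSpace i h,
          Integrable (fun Z => φt Z * wignerGauss i h f g Z) (wienerMeasure2 i (h / 2)) ∧
          MemLp (segalField i h a b f) 2 (wienerMeasure i (h / 2)) ∧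
          MemLp g 2 (wienerMeasure i (h / 2)) ∧
          weylForm i h φt f g = l2Inner i h (segalField i h a b f) g) ∧
    -- (2) Fourier transforms of complex measures
    (∀ (ν : ComplexMeasure (H × H)) (F : H × H → ℂ),
      (∀ t τ : H, F (t, τ) =
        cIntegral ν (fun X => Complex.exp (Complex.I * ((inner ℝ X.1 t + inner ℝ X.2 τ : ℝ) : ℂ)))) →
      -- existence of the stochastic extension, common to the two parameters that are used
      (∃ Ft, IsStochExt i (h / 2) F Ft ∧ IsStochExt i h F Ft) ∧
      -- the pairings against `ν` are well defined
      (∀ f ∈ testSpace i h, ∀ g ∈ testSpace i h,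
        (∀ x ξ : H, MemLp (weylU i h x ξ f) 2 (wienerMeasure i (h / 2))) ∧
        ν.Integrable (fun X => l2Inner i h (weylU i h X.1 X.2 f) g)) ∧
      -- the Weyl form
      (∀ Ft, IsStochExt i (h / 2) F Ft →
        IsWeylSymbol i h Ft ∧
        ∀ f ∈ testSpace i h, ∀ g ∈ testSpace i h,
          Integrable (fun Z => Ft Z * wignerGauss i h f g Z) (wienerMeasure2 i (h / 2)) ∧
          weylForm i h Ft f g = cIntegral ν (fun X => l2Inner i h (weylU i h X.1 X.2 f) g)) ∧
      -- the anti-Wick form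
      (∀ Ft, IsStochExt i h F Ft →
        IsWeylSymbol i h (heat i (h / 2) Ft) ∧
        ∀ f ∈ testSpace i h, ∀ g ∈ testSpace i h,
          Integrable (fun Z => heat i (h / 2) Ft Z * wignerGauss i h f g Z)
            (wienerMeasure2 i (h / 2)) ∧
          antiWickForm i h Ft f g = cIntegral ν (fun X =>
            ((Real.exp (-(h / 4) * (‖X.1‖ ^ 2 + ‖X.2‖ ^ 2)) : ℝ) : ℂ) *
              l2Inner i h (weylU i h X.1 X.2 f) g)) ∧
      -- the bounded operator
      (∃ T : Lp ℂ 2 (wienerMeasure i (h / 2)) →L[ℂ] Lp ℂ 2 (wienerMeasure i (h / 2)),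
        ‖T‖ ≤ (ν.variation Set.univ).toReal ∧
        ∀ Ft, IsStochExt i (h / 2) F Ft →
          ∀ f ∈ testSpace i h, ∀ g ∈ testSpace i h,
            ∃ (hf : MemLp f 2 (wienerMeasure i (h / 2)))
              (hg : MemLp g 2 (wienerMeasure i (h / 2))),
              weylForm i h Ft f g = inner ℂ (hg.toLp g) (T (hf.toLp f)))) := by
  have hh' := half_pos hh
  have := UniformSpace.secondCountable_of_separable H
  refine ⟨fun a b => ⟨⟨_, isStochExt_linearSymbol hi hh' a b⟩, fun φt hφ => ?_⟩,
    fun ν F hF => ?_⟩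
  · have hae := hφ.ae_eq (isStochExt_linearSymbol hi hh' a b)
    refine ⟨isWeylSymbol_of_ae_eq_ell2 hi hh _ hae, fun f hf g hg => ?_⟩
    obtain ⟨h1, h2, h3⟩ := weylForm_of_ae_eq_ell2 hi hh a b hae hf hg
    exact ⟨h1, h2, memLp_of_mem_testSpace hi hh hg, h3⟩
  obtain ⟨θ, hm, hθ, hν⟩ := exists_integrable_density ν
  have hcI : ∀ κ : H × H → ℂ, StronglyMeasurable κ → ∀ M, (∀ X, ‖κ X‖ ≤ M) →
      cIntegral ν κ = ∫ X, κ X * θ X ∂ν.variation :=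
    fun κ hκ M hM => cIntegral_eq_integral_of_bounded hθ hν hκ hM
  -- From here on the complex measure is traded for the finite positive measure `|ν|` with density
  -- `θ`.
  have hFθ : F = fourierSymbol ν.variation θ := by
    ext ⟨t, τ⟩
    rw [hF]
    exact hcI (fun X => planeWave X (t, τ))
      (continuous_planeWave.comp (Continuous.prodMk_left (t, τ))).stronglyMeasurable 1
      fun X => (norm_planeWave X _).le
  subst hFθ
  have hK : ∀ f ∈ testSpace i h, ∀ g ∈ testSpace i h,
      cIntegral ν (fun X => l2Inner i h (weylU i h X.1 X.2 f) g) =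
        ∫ X, l2Inner i h (weylU i h X.1 X.2 f) g * θ X ∂ν.variation := fun f hf g hg =>
    hcI _ (continuous_l2Inner_weylU_prod hi hh hf hg).stronglyMeasurable _
      (norm_l2Inner_weylU_le hi hh hf hg)
  refine ⟨exists_isStochExt_fourierSymbol hi hh' hh hm hθ, fun f hf g hg =>
    ⟨fun x ξ => memLp_weylU hi hh x ξ hf, ?_⟩, fun Ft hFt => ?_, fun Ft hFt => ?_, ?_⟩
  · exact Integrable.of_bound (μ := ν.variation)
      (continuous_l2Inner_weylU_prod hi hh hf hg).aestronglyMeasurable _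
      (ae_of_all _ (norm_l2Inner_weylU_le hi hh hf hg))
  · obtain ⟨h1, h2⟩ := weylForm_of_isStochExt_fourierSymbol hi hh hm hθ hFt
    refine ⟨h1, fun f hf g hg => ?_⟩
    rw [hK f hf g hg]
    exact h2 f hf g hg
  · obtain ⟨h1, h2⟩ := weylForm_heat_of_isStochExt_fourierSymbol hi hh hm hθ hFt
    -- The damping factor is at most `1`, so the damped kernel obeys the same uniform bound as the
    -- undamped one.
    refine ⟨h1, fun f hf g hg => ⟨(h2 f hf g hg).1, (h2 f hf g hg).2.trans (hcI _ ?_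
      (∫ Z, ‖wignerGauss i h f g Z‖ ∂(wienerMeasure2 i (h / 2))) ?_).symm⟩⟩
    · have hc := continuous_l2Inner_weylU_prod hi hh hf hg
      exact Continuous.stronglyMeasurable (by fun_prop)
    · intro X
      rw [norm_mul, Complex.norm_real, Real.norm_eq_abs, Real.abs_exp]
      refine (mul_le_of_le_one_left (norm_nonneg _) ?_).trans
        (norm_l2Inner_weylU_le hi hh hf hg X)
      rw [Real.exp_le_one_iff]
      exact mul_nonpos_of_nonpos_of_nonneg (by linarith) (by positivity)
  · obtain ⟨T, hT, hTb⟩ := exists_clm_weylSuperposition hi hh hθ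
      (C := (ν.variation Set.univ).toReal) ENNReal.toReal_nonneg fun κ hκ M hM => by
        rw [← hcI κ hκ M hM]
        exact norm_cIntegral_le ν hM
    refine ⟨T, hT, fun Ft hFt f hf g hg =>
      ⟨memLp_of_mem_testSpace hi hh hf, memLp_of_mem_testSpace hi hh hg, ?_⟩⟩
    rw [← hTb f hf g hg]
    exact ((weylForm_of_isStochExt_fourierSymbol hi hh hm hθ hFt).2 f hf g hg).2
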